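/- Let $0=a_0<a_1<\dots<a_m<a_{m+1}=d$ be integers with $\gcd(a_0,\dots,a_{m+1})=1$ and let $A=\begin{pmatrix}1&1&\cdots&1&1\\0&a_1&\cdots&a_m&d\end{pmatrix}$; let $B$ (resp. $C$) be $A$ with its last (resp. first) column deleted. For $\alpha\in\mathbb C^2$, the $A$-hypergeometric system with exponent $\alpha$ for functions $\varphi$ of $x=(x_0,\dots,x_{m+1})$ consists of $\prod_{v_j>0}\partial_j^{v_j}\varphi=\prod_{v_j<0}\partial_j^{-v_j}\varphi$ for all $v\in\mathbb Z^{m+2}$ with $Av=0$, together with $\sum_j x_j\partial_j\varphi=\alpha_1\varphi$ and $\sum_j a_jx_j\partial_j\varphi=\alpha_2\varphi$. For an integer matrix $M$ with $r$ columns and an integer vector $\beta$ put $\Phi^M(\beta;x)=\sum_{u\in\mathbb N^r,\,Mu=\beta}x^u/u!$ (in the cases below a finite sum). Let $$E(A)=\Big(\big(C\,\mathbb N^{m+1}-\mathbb N(1,0)\big)\cap\big(B\,\mathbb N^{m+1}-\mathbb N(1,d)\big)\Big)\setminus A\,\mathbb N^{m+2}\subset\mathbb Z^2 .$$ Let $f(x;t)=\sum_j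 x_jt^{a_j}$ with discriminant $\Delta(f)$ in $t$, let $\Sigma=\{x_0=0\}\cup\{x_{m+1}=0\}\cup\{\Delta(f)=0\}\subset\mathbb C^{m+2}$, and let $U\subset\mathbb C^{m+2}\setminus\Sigma$ be open and simply connected. Then for every $\alpha\in E(A)$ the space $\mathcal H_{\rm alg}(\alpha)(U)$ of solutions of the $A$-hypergeometric system with exponent $\alpha$ that are holomorphic on $U$ and algebraic over $\mathbb C(x)$ satisfies $$\dim_{\mathbb C}\mathcal H_{\rm alg}(\alpha)(U)\ \ge\ d+1 .$$ Moreover, there are holomorphic functions $\rho_1,\dots,\rho_d$ on $U$ which are at each point $x\in U$ the $d$ distinct roots of $f(x;t)$, and for any such choice a basis of $\mathcal H_{\rm alg}(\alpha)(U)$ is given by the $d$ functions $$\psi_j(\alpha;x)=\sum_{0\le i\le d\alpha_1,\ i\ne\alpha_2}\Phi^A((\alpha_1,i);x)\,\frac{\rho_j(x)^{i-\alpha_2}}{i-\alpha_2}\qquad(1\le j\le d)$$ together with $$\Psi^A_0(\alpha;x)=\sum_{r\ge1}(-1)^r(r-1)!\,\frac{\Phi^C(\alpha+r(1,0);x_1,\dots,x_{m+1})}{x_0^{\,r}}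 .$$ (For $\alpha\in E(A)$ one has $\alpha_1>0$, and the sum defining $\Psi_0^A$ is finite.) -/

import Mathlib

namespace AHyp

/-! ## Partial derivatives and general `A`-hypergeometric systems -/

/-- The partial derivative `∂F/∂x_j` of a function on `ℂ^r`. -/
noncomputable def pd {r : ℕ} (j : Fin r) (F : (Fin r → ℂ) → ℂ) : (Fin r → ℂ) → ℂ :=
  fun x => fderiv ℂ F x (Pi.single j 1)

/-- The higher partial derivative `D_u = ∂^{|u|}/∂x^u`, `u ∈ ℕ^r`. -/
noncomputable def pdMulti {r : ℕ} (u : Fin r → ℕ) (F : (Fin r → ℂ) → ℂ) : (Fin r → ℂ) → ℂ :=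
  (List.finRange r).foldr (fun j G => (pd j)^[u j] G) F

/-- `F` is holomorphic on `U` and satisfies there the `A`-hypergeometric system with exponent `α`:
the equations `∏_{v_j > 0} ∂_j^{v_j} F = ∏_{v_j < 0} ∂_j^{-v_j} F` for all integral `v` in the kernel
of `A`, and the homogeneity equations `∑_j A_{ij} x_j ∂_j F = α_i F`. -/
structure IsHypergeometricOn {s r : ℕ} (A : Matrix (Fin s) (Fin r) ℤ) (α : Fin s → ℂ)
    (U : Set (Fin r → ℂ)) (F : (Fin r → ℂ) → ℂ) : Prop where
  holomorphic : AnalyticOnNhd ℂ F U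
  toric : ∀ v : Fin r → ℤ, A.mulVec v = 0 → ∀ x ∈ U,
    pdMulti (fun j => (v j).toNat) F x = pdMulti (fun j => (-v j).toNat) F x
  euler : ∀ i : Fin s, ∀ x ∈ U, ∑ j, (A i j : ℂ) * x j * pd j F x = α i * F x

/-- A function `φ` on `U ⊆ ℂ^r` is algebraic: `P(x, φ(x)) = 0` on `U` for some nonzero polynomial
`P ∈ ℂ[x_1, …, x_r][y]`. -/
def IsAlgebraicFun {r : ℕ} {U : Set (Fin r → ℂ)} (φ : U → ℂ) : Prop :=
  ∃ P : Polynomial (MvPolynomial (Fin r) ℂ), P ≠ 0 ∧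
    ∀ x : U, (P.map (MvPolynomial.eval (x : Fin r → ℂ))).eval (φ x) = 0

section closure

variable {r : ℕ} {U : Set (Fin r → ℂ)} {F G : (Fin r → ℂ) → ℂ}

theorem pd_analytic (j : Fin r) (hF : AnalyticOnNhd ℂ F U) : AnalyticOnNhd ℂ (pd j F) U :=
  fun x hx => ((ContinuousLinearMap.apply ℂ ℂ (Pi.single j (1 : ℂ) : Fin r → ℂ)).analyticAt
    (fderiv ℂ F x)).comp (hF x hx).fderiv

theorem pd_iter_analytic (j : Fin r) (n : ℕ) (hF : AnalyticOnNhd ℂ F U) :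
    AnalyticOnNhd ℂ ((pd j)^[n] F) U := by
  induction n with
  | zero => exact hF
  | succ n ih => rw [Function.iterate_succ_apply']; exact pd_analytic j ih

theorem pd_congr (hU : IsOpen U) (j : Fin r) (h : Set.EqOn F G U) :
    Set.EqOn (pd j F) (pd j G) U := by
  intro x hx
  have : F =ᶠ[nhds x] G := Filter.eventuallyEq_of_mem (hU.mem_nhds hx) h
  simp only [pd, this.fderiv_eq]

theorem pd_lin (c : ℂ) (j : Fin r) (hF : AnalyticOnNhd ℂ F U) (hG : AnalyticOnNhd ℂ G U) :
    Set.EqOn (pd j (c • F + G)) (c • pd j F + pd j G) U := by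
  intro x hx
  have h1 := (hF x hx).differentiableAt
  have h2 := (hG x hx).differentiableAt
  simp [pd, fderiv_add (h1.const_smul c) h2, fderiv_const_smul h1]

theorem pd_iter_lin (hU : IsOpen U) (c : ℂ) (j : Fin r) (n : ℕ)
    (hF : AnalyticOnNhd ℂ F U) (hG : AnalyticOnNhd ℂ G U) {H : (Fin r → ℂ) → ℂ}
    (hH : Set.EqOn H (c • F + G) U) :
    Set.EqOn ((pd j)^[n] H) (c • (pd j)^[n] F + (pd j)^[n] G) U := by
  induction n with
  | zero => exact hH
  | succ n ih =>
    simp only [Function.iterate_succ_apply']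
    exact (pd_congr hU j ih).trans
      (pd_lin c j (pd_iter_analytic j n hF) (pd_iter_analytic j n hG))

theorem pdMulti_lin (hU : IsOpen U) (c : ℂ) (u : Fin r → ℕ)
    (hF : AnalyticOnNhd ℂ F U) (hG : AnalyticOnNhd ℂ G U) :
    Set.EqOn (pdMulti u (c • F + G)) (c • pdMulti u F + pdMulti u G) U := by
  unfold pdMulti
  have key : ∀ l : List (Fin r),
      AnalyticOnNhd ℂ (l.foldr (fun j G => (pd j)^[u j] G) F) U ∧
      AnalyticOnNhd ℂ (l.foldr (fun j G => (pd j)^[u j] G) G) U ∧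
      Set.EqOn (l.foldr (fun j G => (pd j)^[u j] G) (c • F + G))
        (c • l.foldr (fun j G => (pd j)^[u j] G) F + l.foldr (fun j G => (pd j)^[u j] G) G) U := by
    intro l
    induction l with
    | nil => exact ⟨hF, hG, fun _ _ => rfl⟩
    | cons j l ih =>
      obtain ⟨h1, h2, h3⟩ := ih
      exact ⟨pd_iter_analytic j _ h1, pd_iter_analytic j _ h2, pd_iter_lin hU c j _ h1 h2 h3⟩
  exact (key _).2.2

theorem IsHypergeometricOn.lin {s : ℕ} {A : Matrix (Fin s) (Fin r) ℤ} {α : Fin s → ℂ}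
    (hU : IsOpen U) (c : ℂ) (hF : IsHypergeometricOn A α U F) (hG : IsHypergeometricOn A α U G) :
    IsHypergeometricOn A α U (c • F + G) where
  holomorphic := (hF.holomorphic.const_smul (c := c)).add hG.holomorphic
  toric v hv x hx := by
    rw [pdMulti_lin hU c _ hF.holomorphic hG.holomorphic hx,
      pdMulti_lin hU c _ hF.holomorphic hG.holomorphic hx]
    simp [hF.toric v hv x hx, hG.toric v hv x hx]
  euler i x hx := by
    have h : ∀ j, pd j (c • F + G) x = c * pd j F x + pd j G x := fun j => by
      simpa using pd_lin c j hF.holomorphic hG.holomorphic hx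
    simp only [h, Pi.add_apply, Pi.smul_apply, smul_eq_mul]
    rw [mul_add, mul_left_comm, ← hF.euler i x hx, ← hG.euler i x hx, Finset.mul_sum,
      ← Finset.sum_add_distrib]
    exact Finset.sum_congr rfl fun j _ => by ring

theorem isHypergeometricOn_zero {s : ℕ} {A : Matrix (Fin s) (Fin r) ℤ} {α : Fin s → ℂ} :
    IsHypergeometricOn A α U 0 := by
  have h : ∀ j : Fin r, pd j (0 : (Fin r → ℂ) → ℂ) = 0 := fun j => by
    funext x; simp [pd]
  have hn : ∀ (j : Fin r) (n : ℕ), (pd j)^[n] (0 : (Fin r → ℂ) → ℂ) = 0 := fun j n =>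
    Function.iterate_fixed (h j) n
  have hm : ∀ u : Fin r → ℕ, pdMulti u (0 : (Fin r → ℂ) → ℂ) = 0 := fun u => by
    unfold pdMulti
    induction List.finRange r with
    | nil => rfl
    | cons j l ih => rw [List.foldr_cons, ih, hn]
  exact ⟨analyticOnNhd_const, fun v _ x _ => by rw [hm, hm], fun i x _ => by simp [h]⟩

theorem isAlgebraicFun_iff (φ : U → ℂ) : IsAlgebraicFun φ ↔
    @IsAlgebraic (MvPolynomial (Fin r) ℂ) (U → ℂ) _ _
      (RingHom.pi fun x : U => MvPolynomial.eval (x : Fin r → ℂ)).toAlgebra φ := by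
  let _ : Algebra (MvPolynomial (Fin r) ℂ) (U → ℂ) :=
    (RingHom.pi fun x : U => MvPolynomial.eval (x : Fin r → ℂ)).toAlgebra
  have h : ∀ (P : Polynomial (MvPolynomial (Fin r) ℂ)) (x : U),
      Polynomial.aeval φ P x = (P.map (MvPolynomial.eval (x : Fin r → ℂ))).eval (φ x) := by
    intro P x
    rw [Polynomial.eval_map, Polynomial.aeval_def]
    exact Polynomial.hom_eval₂ P _ (Pi.evalRingHom (fun _ : U => ℂ) x) φ
  constructor
  · rintro ⟨P, hP, hx⟩
    exact ⟨P, hP, funext fun x => (h P x).trans (hx x)⟩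
  · rintro ⟨P, hP, hx⟩
    exact ⟨P, hP, fun x => (h P x).symm.trans (congrFun hx x)⟩

theorem IsAlgebraicFun.add {φ ψ : U → ℂ} (hφ : IsAlgebraicFun φ) (hψ : IsAlgebraicFun ψ) :
    IsAlgebraicFun (φ + ψ) := by
  let _ : Algebra (MvPolynomial (Fin r) ℂ) (U → ℂ) :=
    (RingHom.pi fun x : U => MvPolynomial.eval (x : Fin r → ℂ)).toAlgebra
  rw [isAlgebraicFun_iff] at *
  exact IsAlgebraic.add hφ hψ

theorem IsAlgebraicFun.smul {φ : U → ℂ} (c : ℂ) (hφ : IsAlgebraicFun φ) :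
    IsAlgebraicFun (c • φ) := by
  let _ : Algebra (MvPolynomial (Fin r) ℂ) (U → ℂ) :=
    (RingHom.pi fun x : U => MvPolynomial.eval (x : Fin r → ℂ)).toAlgebra
  rw [isAlgebraicFun_iff] at *
  have e : c • φ = algebraMap (MvPolynomial (Fin r) ℂ) (U → ℂ) (MvPolynomial.C c) * φ := by
    funext x
    have h : algebraMap (MvPolynomial (Fin r) ℂ) (U → ℂ) (MvPolynomial.C c) x = c :=
      MvPolynomial.eval_C (f := (x : Fin r → ℂ)) c
    rw [Pi.mul_apply, h, Pi.smul_apply, smul_eq_mul]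
  rw [e]
  exact (isAlgebraic_algebraMap _).mul hφ

theorem isAlgebraicFun_zero : IsAlgebraicFun (0 : U → ℂ) :=
  ⟨Polynomial.X, Polynomial.X_ne_zero, fun x => by simp⟩

end closure

/-- The space of algebraic solutions, holomorphic on the open set `U`, of the `A`-hypergeometric
system with exponent `α`, as a space of functions on `U`. (Openness of `U` makes derivatives at
points of `U` independent of the chosen extension `F` of `φ` to the ambient space.) -/
def algSolutions {s r : ℕ} (A : Matrix (Fin s) (Fin r) ℤ) (α : Fin s → ℂ)
    (U : Set (Fin r → ℂ)) (hU : IsOpen U) : Submodule ℂ (U → ℂ) where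
  carrier := {φ | (∃ F, IsHypergeometricOn A α U F ∧ φ = fun x : U => F x) ∧ IsAlgebraicFun φ}
  zero_mem' := ⟨⟨0, isHypergeometricOn_zero, rfl⟩, isAlgebraicFun_zero⟩
  add_mem' := by
    rintro φ ψ ⟨⟨F, hF, rfl⟩, hφ⟩ ⟨⟨G, hG, rfl⟩, hψ⟩
    refine ⟨⟨F + G, ?_, rfl⟩, hφ.add hψ⟩
    simpa using hF.lin hU 1 hG
  smul_mem' := by
    rintro c φ ⟨⟨F, hF, rfl⟩, hφ⟩
    refine ⟨⟨c • F, ?_, rfl⟩, hφ.smul c⟩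
    simpa using hF.lin hU c isHypergeometricOn_zero

/-! ## Hypergeometric polynomials -/

/-- The hypergeometric polynomial `Φ^A(α; x) = ∑_{u ∈ ℕ^r, A u = α} x^u / u!`. -/
noncomputable def hyperPoly {s r : ℕ} (A : Matrix (Fin s) (Fin r) ℤ) (α : Fin s → ℤ)
    (x : Fin r → ℂ) : ℂ :=
  ∑ᶠ u ∈ {u : Fin r → ℕ | A.mulVec (fun j => (u j : ℤ)) = α},
    ∏ j, x j ^ u j / (Nat.factorial (u j) : ℂ)

/-- The image `A · ℕ^r`. -/
def natImage {s r : ℕ} (A : Matrix (Fin s) (Fin r) ℤ) : Set (Fin s → ℤ) :=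
  {α | ∃ u : Fin r → ℕ, A.mulVec (fun j => (u j : ℤ)) = α}

/-! ## Monomial curves

The exponents `0 < k_1 < ⋯ < k_m < d` are the values `a 0 = 0, a 1, …, a m, a (m+1) = d` of a
strictly increasing function `a : Fin (m + 2) → ℕ`. -/

/-- The matrix with rows `(1, …, 1)` and `(a_0, …, a_{r-1})`. -/
def curveMatrix {r : ℕ} (a : Fin r → ℕ) : Matrix (Fin 2) (Fin r) ℤ :=
  Matrix.of ![fun _ => 1, fun j => (a j : ℤ)]

variable {m : ℕ}

/-- The degree `d` of the curve. -/
abbrev deg (a : Fin (m + 2) → ℕ) : ℕ := a (Fin.last (m + 1))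

/-- The matrix `B` obtained by deleting the last column. -/
def matB (a : Fin (m + 2) → ℕ) : Matrix (Fin 2) (Fin (m + 1)) ℤ :=
  curveMatrix fun j => a j.castSucc

/-- The matrix `C` obtained by deleting the first column. -/
def matC (a : Fin (m + 2) → ℕ) : Matrix (Fin 2) (Fin (m + 1)) ℤ :=
  curveMatrix fun j => a j.succ

/-- `E_0(A) = (C·ℕ^{m+1} - ℕ(1,0)) \ A·ℕ^{m+2}`. -/
def setE0 (a : Fin (m + 2) → ℕ) : Set (Fin 2 → ℤ) :=
  {α | ∃ β ∈ natImage (matC a), ∃ n : ℕ, α = β - (n : ℤ) • ![1, 0]} \ natImage (curveMatrix a)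

/-- `E_d(A) = (B·ℕ^{m+1} - ℕ(1,d)) \ A·ℕ^{m+2}`. -/
def setEd (a : Fin (m + 2) → ℕ) : Set (Fin 2 → ℤ) :=
  {α | ∃ β ∈ natImage (matB a), ∃ n : ℕ, α = β - (n : ℤ) • ![1, (deg a : ℤ)]} \
    natImage (curveMatrix a)

/-- `E(A) = E_0(A) ∩ E_d(A)`. -/
def setE (a : Fin (m + 2) → ℕ) : Set (Fin 2 → ℤ) := setE0 a ∩ setEd a

/-- `Ψ_0(α; x) = ∑_{r ≥ 1} (-1)^r (r-1)! Φ^C(α + r(1,0); x_{k_1}, …, x_d) / x_0^r`, with `r = n + 1`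
(only finitely many terms are nonzero). -/
noncomputable def bigPsi0 (a : Fin (m + 2) → ℕ) (α : Fin 2 → ℤ) (x : Fin (m + 2) → ℂ) : ℂ :=
  ∑ᶠ n : ℕ, (-1) ^ (n + 1) * (Nat.factorial n : ℂ) *
    hyperPoly (matC a) (α + ((n + 1 : ℕ) : ℤ) • ![1, 0]) (fun j => x j.succ) / x 0 ^ (n + 1)

/-- The polynomial `f(x; t) = ∑_j x_j t^{a_j}` in `t`. -/
noncomputable def genPoly (a : Fin (m + 2) → ℕ) (x : Fin (m + 2) → ℂ) : Polynomial ℂ :=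
  ∑ j, Polynomial.C (x j) * Polynomial.X ^ a j

/-- The singular locus `Σ = {x_0 = 0} ∪ {x_d = 0} ∪ {Δ(f) = 0}`. -/
def singLocus (a : Fin (m + 2) → ℕ) : Set (Fin (m + 2) → ℂ) :=
  {x | x 0 = 0 ∨ x (Fin.last (m + 1)) = 0 ∨ (genPoly a x).discr = 0}

/-- `ρ_1, …, ρ_d` are holomorphic functions on `U` which are, at each point of `U`, the `d` distinct
roots of `f(x; t)`. -/
structure IsRootSystemOn (a : Fin (m + 2) → ℕ) (U : Set (Fin (m + 2) → ℂ))
    (ρ : Fin (deg a) → (Fin (m + 2) → ℂ) → ℂ) : Prop where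
  holomorphic : ∀ i, AnalyticOnNhd ℂ (ρ i) U
  isRoot : ∀ i, ∀ x ∈ U, (genPoly a x).IsRoot (ρ i x)
  distinct : ∀ x ∈ U, Function.Injective fun i => ρ i x

/-- For a root `ρ` of `f(x; t)` and `α_1 ≥ 0`,
`ψ_ρ(α; x) = ∑_{0 ≤ i ≤ d α_1, i ≠ α_2} Φ^A((α_1, i); x) ρ(x)^{i - α_2} / (i - α_2)
  + Φ^A(α; x) log ρ(x)`.
For `α ∉ A·ℕ^{m+2}` (the only case that is used) the coefficient of the logarithm is `0`, so the
choice of the branch is immaterial. Elements of `E(A)` have `α_1 > 0`. -/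
noncomputable def psi (a : Fin (m + 2) → ℕ) (ρ : (Fin (m + 2) → ℂ) → ℂ) (α : Fin 2 → ℤ)
    (x : Fin (m + 2) → ℂ) : ℂ :=
  (∑ i ∈ (Finset.Icc (0 : ℤ) (deg a * α 0)).erase (α 1),
    hyperPoly (curveMatrix a) ![α 0, i] x * (ρ x ^ (i - α 1) / ((i - α 1 : ℤ) : ℂ)))
  + hyperPoly (curveMatrix a) α x * Complex.log (ρ x)

end AHyp

/-! Upper bound. Fix p in U and write D_u for the partial derivatives of a solution. The toric
equations make D_u depend only on A u, and the two Euler equations at p link order n to order n + 1.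
As α is outside A ℕ^{m+2}, vanishing of all derivatives of order n + 1 at p forces vanishing at
order n (`IsHypergeometricOn.vanish_pred`). As p_0 ≠ 0, vanishing at order n + 1 needs to be checked
only for second weights that are new at that level, or equal to α_2
(`IsHypergeometricOn.vanish_level`). Level n has at most d n + 1 weights, so for infinitely many n
there are at most d + 1 weights to check. In a space of dimension greater than d + 1 there would
thus be, for every n, a nonzero solution whose derivatives up to order n vanish at p; the descending
chain of these subspaces stabilises and yields a nonzero solution with zero Taylor series, which is
absurd (`rank_algSolutions_le`).

Solutions. Since ∑_i Φ^A((n, i); x) t^i = f(x; t)^n / n!, the function ψ_j is the value at t = ρ_j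
of a t-primitive of t^{-α_2-1} f^{α_1} / α_1!, with no logarithm because Φ^A(α) = 0. Both ψ_j and
Ψ_0 sit in families G(n, b) with ∂_j G(n, b) = G(n - 1, b - a_j) off the semigroup, and this rule
gives the toric equations at once (`isHypergeometricOn_of_family`).

Independence. Differentiate a relation ∑ c_i ψ_i + c' Ψ_0 = 0 down to index (-n, -b). For b > 0 the
Ψ_0 term disappears and what remains says that ∂_0^n kills ∑ c_i ρ_i^b, so this power sum is a
polynomial in x_0 of degree below n. Take b = d n + k for 0 ≤ k < d. Lagrange interpolation at the
roots isolates c_i ρ_i^{dn} f'(ρ_i), and comparing degrees in ρ_i modulo d gives c_i = 0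
(`eq_zero_of_sum_quotCoeff_mul`). The decisive bound is that for k = 0, where the order n is
available because α ∈ E_d(A). Finally α ∈ E_0(A) permits b = 0, where Ψ_0 has a nonzero derivative,
so c' = 0.

Roots. The incidence variety {f(x; t) = 0} is parametrised by (t, x_1, …, x_{m+1}); its projection
to x is a finite covering off Σ, so the roots lift to holomorphic functions on the simply connected
U (`exists_isRootSystemOn`). The d + 1 independent solutions then meet the upper bound. -/

namespace AHyp

/-! ### Iterated partial derivatives and the identity theorem -/

section calculus

variable {r : ℕ} {U : Set (Fin r → ℂ)} {F G : (Fin r → ℂ) → ℂ}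

theorem pd_comm (hF : AnalyticOnNhd ℂ F U) (i j : Fin r) :
    Set.EqOn (pd i (pd j F)) (pd j (pd i F)) U := by
  intro x hx
  have hs : IsSymmSndFDerivAt ℂ F x :=
    (hF x hx).contDiffAt (n := 2).isSymmSndFDerivAt (by simp)
  have hd : DifferentiableAt ℂ (fderiv ℂ F) x := (hF x hx).fderiv.differentiableAt
  have key : ∀ i j : Fin r, pd i (pd j F) x
      = fderiv ℂ (fderiv ℂ F) x (Pi.single i 1) (Pi.single j 1) := by
    intro i j
    unfold pd
    rw [fderiv_clm_apply hd (differentiableAt_const _)]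
    simp
  rw [key, key, hs]

/-- Each ∂_j shifts a weight by a fixed amount; this does the bookkeeping once. It serves both for
Euler eigenvalues and for the indices (n, b) of families closed under differentiation. -/
theorem pdMulti_induction {E : Type*} [AddCommGroup E] (w : Fin r → E)
    {P : ((Fin r → ℂ) → ℂ) → E → Prop} (step : ∀ j F β, P F β → P (pd j F) (β - w j))
    {β : E} (hF : P F β) (u : Fin r → ℕ) : P (pdMulti u F) (β - ∑ j, u j • w j) := by
  have iter : ∀ (j : Fin r) (n : ℕ) (F) (β : E), P F β → P ((pd j)^[n] F) (β - n • w j) := by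
    intro j n
    induction n with
    | zero => intro F β h; simpa using h
    | succ n ih =>
      intro F β h
      rw [Function.iterate_succ_apply', succ_nsmul, ← sub_sub]
      exact step _ _ _ (ih _ _ h)
  unfold pdMulti
  rw [Fin.sum_univ_def]
  induction List.finRange r with
  | nil => simpa using hF
  | cons j l ih =>
    rw [List.foldr_cons, List.map_cons, List.sum_cons, add_comm, ← sub_sub]
    exact iter _ _ _ _ ih

theorem pd_iter_congr (hU : IsOpen U) (j : Fin r) (n : ℕ) (h : Set.EqOn F G U) :
    Set.EqOn ((pd j)^[n] F) ((pd j)^[n] G) U := by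
  induction n with
  | zero => exact h
  | succ n ih => simp only [Function.iterate_succ_apply']; exact pd_congr hU j ih

theorem pdMulti_congr (hU : IsOpen U) (u : Fin r → ℕ) (h : Set.EqOn F G U) :
    Set.EqOn (pdMulti u F) (pdMulti u G) U := by
  unfold pdMulti
  induction List.finRange r with
  | nil => exact h
  | cons j l ih => exact pd_iter_congr hU j _ ih

theorem pd_iter_comm (hU : IsOpen U) (hF : AnalyticOnNhd ℂ F U) (i j : Fin r) (n : ℕ) :
    Set.EqOn (pd i ((pd j)^[n] F)) ((pd j)^[n] (pd i F)) U := by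
  induction n with
  | zero => exact fun _ _ => rfl
  | succ n ih =>
    simp only [Function.iterate_succ_apply']
    exact (pd_comm (pd_iter_analytic j n hF) i j).trans (pd_congr hU j ih)

theorem pd_iter_iter_comm (hU : IsOpen U) (hF : AnalyticOnNhd ℂ F U) (i j : Fin r) (k n : ℕ) :
    Set.EqOn ((pd i)^[k] ((pd j)^[n] F)) ((pd j)^[n] ((pd i)^[k] F)) U := by
  induction k with
  | zero => exact fun _ _ => rfl
  | succ k ih =>
    simp only [Function.iterate_succ_apply']
    exact (pd_congr hU i ih).trans (pd_iter_comm hU (pd_iter_analytic i k hF) i j n)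

theorem pdMulti_add (hU : IsOpen U) (hF : AnalyticOnNhd ℂ F U) (u v : Fin r → ℕ) :
    Set.EqOn (pdMulti (u + v) F) (pdMulti u (pdMulti v F)) U := by
  unfold pdMulti
  have an : ∀ (u : Fin r → ℕ) (l : List (Fin r)) (F), AnalyticOnNhd ℂ F U →
      AnalyticOnNhd ℂ (l.foldr (fun j G => (pd j)^[u j] G) F) U := by
    intro u l F hF
    induction l with
    | nil => exact hF
    | cons j l ih => exact pd_iter_analytic j _ ih
  have comm : ∀ (l : List (Fin r)) (j : Fin r) (n : ℕ) (F), AnalyticOnNhd ℂ F U →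
      Set.EqOn ((pd j)^[n] (l.foldr (fun j G => (pd j)^[u j] G) F))
        (l.foldr (fun j G => (pd j)^[u j] G) ((pd j)^[n] F)) U := by
    intro l j n F hF
    induction l with
    | nil => exact fun _ _ => rfl
    | cons i l ih =>
      exact (pd_iter_iter_comm hU (an u l F hF) j i n (u i)).trans (pd_iter_congr hU i _ ih)
  induction List.finRange r with
  | nil => exact fun _ _ => rfl
  | cons j l ih =>
    simp only [List.foldr_cons]
    rw [show (u + v) j = u j + v j from rfl, Function.iterate_add_apply]
    exact (pd_iter_congr hU j _ (pd_iter_congr hU j _ ih)).trans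
      (pd_iter_congr hU j _ (comm l j _ _ (an v l F hF)))

theorem pdMulti_zero : pdMulti (0 : Fin r → ℕ) F = F := by
  unfold pdMulti
  induction List.finRange r with
  | nil => rfl
  | cons j l ih => simp

theorem pdMulti_single (j : Fin r) (n : ℕ) : pdMulti (Pi.single j n) F = (pd j)^[n] F := by
  have key : ∀ l : List (Fin r), l.Nodup →
      l.foldr (fun i G => (pd i)^[(Pi.single j n : Fin r → ℕ) i] G) F
        = if j ∈ l then (pd j)^[n] F else F := by
    intro l hl
    induction l with
    | nil => simp
    | cons i l ih =>
      rw [List.foldr_cons, ih hl.of_cons]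
      have hi : i ∉ l := (List.nodup_cons.mp hl).1
      by_cases hij : j = i
      · subst hij; simp [hi]
      · simp [hij]
  have := key _ (List.nodup_finRange r)
  rwa [if_pos (List.mem_finRange j)] at this

theorem pdMulti_add_single (hU : IsOpen U) (hF : AnalyticOnNhd ℂ F U) (u : Fin r → ℕ)
    (j : Fin r) : Set.EqOn (pdMulti (u + Pi.single j 1) F) (pd j (pdMulti u F)) U := by
  rw [add_comm]
  simpa only [pdMulti_single, Function.iterate_one] using pdMulti_add hU hF (Pi.single j 1) u

theorem iteratedFDeriv_single (hU : IsOpen U) (hF : AnalyticOnNhd ℂ F U) (n : ℕ)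
    (j : Fin n → Fin r) : ∃ u : Fin r → ℕ, Set.EqOn
      (fun x => iteratedFDeriv ℂ n F x fun i => Pi.single (j i) 1) (pdMulti u F) U := by
  induction n with
  | zero => exact ⟨0, fun x _ => by simp [pdMulti_zero]⟩
  | succ n ih =>
    obtain ⟨u, hu⟩ := ih (fun i => j i.succ)
    refine ⟨u + Pi.single (j 0) 1, fun x hx => ?_⟩
    rw [pdMulti_add_single hU hF u (j 0) hx, ← pd_congr hU (j 0) hu hx]
    have hd : DifferentiableAt ℂ (iteratedFDeriv ℂ n F) x :=
      (hF.iteratedFDeriv n x hx).differentiableAt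
    simp only [iteratedFDeriv_succ_apply_left, pd]
    rw [fderiv_continuousMultilinear_apply_const_apply hd]
    rfl

/-- A multilinear map is determined by its values on basis vectors, and for the iterated Fréchet
derivatives these values are the D_u. So every term of the power series at p vanishes. -/
theorem eventually_eq_zero_of_pdMulti (hU : IsOpen U) (hF : AnalyticOnNhd ℂ F U)
    {p : Fin r → ℂ} (hp : p ∈ U) (h : ∀ u, pdMulti u F p = 0) : ∀ᶠ x in nhds p, F x = 0 := by
  have hz : ∀ n, iteratedFDeriv ℂ n F p = 0 := by
    intro n
    apply ContinuousMultilinearMap.toMultilinearMap_injective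
    refine Module.Basis.ext_multilinear (fun _ => Pi.basisFun ℂ (Fin r)) fun j => ?_
    obtain ⟨u, hu⟩ := iteratedFDeriv_single hU hF n j
    simpa [h u] using hu hp
  obtain ⟨q, R, hq⟩ := hF p hp
  have h0 : ∀ n y, (q n fun _ => y) = 0 := by
    intro n y
    have := hq.factorial_smul y n
    rw [hz] at this
    simpa [Nat.factorial_ne_zero] using this
  filter_upwards [hq.eventually_hasSum_sub] with x hx
  simp only [h0] at hx
  exact hx.unique hasSum_zero

theorem eqOn_zero_of_pdMulti (hU : IsOpen U) (hc : IsPreconnected U) (hF : AnalyticOnNhd ℂ F U)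
    {p : Fin r → ℂ} (hp : p ∈ U) (h : ∀ u, pdMulti u F p = 0) : Set.EqOn F 0 U :=
  hF.eqOn_zero_of_preconnected_of_eventuallyEq_zero hc hp
    (eventually_eq_zero_of_pdMulti hU hF hp h)

end calculus

/-! ### Differentiation rules for `pd` -/

section rules

variable {r : ℕ} {F G : (Fin r → ℂ) → ℂ} {x : Fin r → ℂ}

theorem pd_fun_add (j : Fin r) (hF : DifferentiableAt ℂ F x) (hG : DifferentiableAt ℂ G x) :
    pd j (fun y => F y + G y) x = pd j F x + pd j G x := by
  simp [pd, fderiv_fun_add hF hG]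

theorem pd_fun_mul (j : Fin r) (hF : DifferentiableAt ℂ F x) (hG : DifferentiableAt ℂ G x) :
    pd j (fun y => F y * G y) x = F x * pd j G x + pd j F x * G x := by
  simp [pd, fderiv_fun_mul hF hG, mul_comm]

theorem pd_const_mul (j : Fin r) (c : ℂ) (hF : DifferentiableAt ℂ F x) :
    pd j (fun y => c * F y) x = c * pd j F x := by
  simp [pd, fderiv_const_mul hF c]

theorem pd_const (j : Fin r) (c : ℂ) : pd j (fun _ => c) x = 0 := by
  simp [pd]

theorem pd_fun_sum {ι : Type*} (s : Finset ι) (j : Fin r) {F : ι → (Fin r → ℂ) → ℂ}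
    (hF : ∀ i ∈ s, DifferentiableAt ℂ (F i) x) :
    pd j (fun y => ∑ i ∈ s, F i y) x = ∑ i ∈ s, pd j (F i) x := by
  simp [pd, fderiv_fun_sum hF]

theorem pd_coord (i j : Fin r) : pd i (fun y => y j) x = if j = i then 1 else 0 := by
  have : fderiv ℂ (fun y : Fin r → ℂ => y j) x = ContinuousLinearMap.proj j :=
    (ContinuousLinearMap.proj (R := ℂ) (φ := fun _ : Fin r => ℂ) j).fderiv
  rw [pd, this, ContinuousLinearMap.proj_apply, Pi.single_apply]

end rules

/-! ### Euler operators and derivatives of solutions -/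

section general

variable {s r : ℕ} {A : Matrix (Fin s) (Fin r) ℤ} {α : Fin s → ℂ}
  {U : Set (Fin r → ℂ)} {F : (Fin r → ℂ) → ℂ}

/-- The commutator of x_k ∂_k with ∂_k is -∂_k, so applying ∂_k lowers the Euler eigenvalue by the
entry A i k. -/
theorem euler_pd (hU : IsOpen U) (hF : AnalyticOnNhd ℂ F U) (i : Fin s) {b : ℂ}
    (h : ∀ x ∈ U, ∑ j, (A i j : ℂ) * x j * pd j F x = b * F x) (k : Fin r) :
    ∀ x ∈ U, ∑ j, (A i j : ℂ) * x j * pd j (pd k F) x = (b - A i k) * pd k F x := by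
  intro x hx
  have hd : ∀ j, DifferentiableAt ℂ (pd j F) x := fun j => (pd_analytic j hF x hx).differentiableAt
  have h1 := pd_congr hU k (F := fun x => ∑ j, (A i j : ℂ) * x j * pd j F x)
    (G := fun x => b * F x) h hx
  rw [pd_const_mul k b (hF x hx).differentiableAt, pd_fun_sum _ _ (fun j _ => by
    have := hd j; fun_prop)] at h1
  have h2 : ∀ j, pd k (fun y => (A i j : ℂ) * y j * pd j F y) x
      = (A i j : ℂ) * x j * pd j (pd k F) x + if j = k then (A i j : ℂ) * pd j F x else 0 := by
    intro j
    rw [pd_fun_mul k (by fun_prop) (hd j), pd_const_mul k _ (by fun_prop), pd_coord,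
      pd_comm hF k j hx]
    split_ifs <;> simp
  simp only [h2, Finset.sum_add_distrib, Finset.sum_ite_eq', Finset.mem_univ, if_true] at h1
  linear_combination h1

theorem IsHypergeometricOn.euler_pdMulti (hU : IsOpen U) (h : IsHypergeometricOn A α U F)
    (u : Fin r → ℕ) (i : Fin s) {x : Fin r → ℂ} (hx : x ∈ U) :
    ∑ j, (A i j : ℂ) * x j * pd j (pdMulti u F) x
      = (α i - ∑ j, (u j : ℂ) * A i j) * pdMulti u F x := by
  have := pdMulti_induction (E := ℂ) (w := fun j => (A i j : ℂ)) (β := α i) (F := F)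
    (P := fun F b => AnalyticOnNhd ℂ F U ∧
      ∀ x ∈ U, ∑ j, (A i j : ℂ) * x j * pd j F x = b * F x)
    (fun j F b h => ⟨pd_analytic j h.1, euler_pd hU h.1 i h.2 j⟩) ⟨h.holomorphic, h.euler i⟩ u
  simpa using this.2 x hx

/-- Split off the common part min(u, u'); what is left on the two sides are the positive and
negative parts of u - u', which lies in the kernel of A. -/
theorem IsHypergeometricOn.pdMulti_eq (hU : IsOpen U) (h : IsHypergeometricOn A α U F)
    {u u' : Fin r → ℕ} (huu : A.mulVec (fun j => (u j : ℤ)) = A.mulVec (fun j => (u' j : ℤ))) :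
    Set.EqOn (pdMulti u F) (pdMulti u' F) U := by
  set v : Fin r → ℤ := (fun j => (u j : ℤ)) - fun j => (u' j : ℤ) with hv
  have h1 : u = (fun j => min (u j) (u' j)) + fun j => (v j).toNat := by
    funext j; simp only [hv, Pi.add_apply, Pi.sub_apply]; omega
  have h2 : u' = (fun j => min (u j) (u' j)) + fun j => (-v j).toNat := by
    funext j; simp only [hv, Pi.add_apply, Pi.sub_apply]; omega
  have h3 := h.toric v (by rw [hv, Matrix.mulVec_sub, huu, sub_self])
  rw [h1]
  conv => arg 2; rw [h2]
  exact (pdMulti_add hU h.holomorphic _ _).trans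
    ((pdMulti_congr hU _ h3).trans (pdMulti_add hU h.holomorphic _ _).symm)

end general

/-! ### Levels of the semigroup and the propagation of vanishing -/

section curve

variable {r : ℕ}

theorem curveMatrix_mulVec (a : Fin r → ℕ) (v : Fin r → ℤ) :
    (curveMatrix a).mulVec v = ![∑ j, v j, ∑ j, v j * a j] := by
  funext i
  fin_cases i <;> simp [curveMatrix, Matrix.mulVec, dotProduct, mul_comm]

theorem curveMatrix_mulVec_eq_iff (a : Fin r → ℕ) (u : Fin r → ℕ) (n b : ℤ) :
    (curveMatrix a).mulVec (fun j => (u j : ℤ)) = ![n, b] ↔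
      ((∑ j, u j : ℕ) : ℤ) = n ∧ ((∑ j, u j * a j : ℕ) : ℤ) = b := by
  rw [curveMatrix_mulVec]
  simp [Matrix.vecCons_inj]

theorem mem_natImage_curveMatrix (a : Fin r → ℕ) (α : Fin 2 → ℤ) :
    α ∈ natImage (curveMatrix a) ↔
      ∃ u : Fin r → ℕ, ((∑ j, u j : ℕ) : ℤ) = α 0 ∧ ((∑ j, u j * a j : ℕ) : ℤ) = α 1 := by
  have : α = ![α 0, α 1] := by funext i; fin_cases i <;> rfl
  conv_lhs => rw [this]
  exact exists_congr fun u => curveMatrix_mulVec_eq_iff a u _ _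

/-- The second coordinates of the elements of `A · ℕ^r` with first coordinate `n`. -/
def level (a : Fin r → ℕ) (n : ℕ) : Finset ℕ :=
  (Finset.piAntidiag Finset.univ n).image fun u => ∑ j, u j * a j

theorem mem_level {a : Fin r → ℕ} {n e : ℕ} :
    e ∈ level a n ↔ ∃ u : Fin r → ℕ, ∑ j, u j = n ∧ ∑ j, u j * a j = e := by
  simp [level]

theorem level_subset_succ {m : ℕ} {a : Fin (m + 1) → ℕ} (ha0 : a 0 = 0) (n : ℕ) :
    level a n ⊆ level a (n + 1) := by
  intro e he
  obtain ⟨u, hu, hue⟩ := mem_level.mp he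
  exact mem_level.mpr ⟨u + Pi.single 0 1, by simp [Finset.sum_add_distrib, hu],
    by simp [add_mul, Finset.sum_add_distrib, hue, Pi.single_apply, ha0]⟩

theorem card_level_le {a : Fin r → ℕ} {d : ℕ} (hd : ∀ j, a j ≤ d) (n : ℕ) :
    (level a n).card ≤ d * n + 1 := by
  have : level a n ⊆ Finset.range (d * n + 1) := by
    intro e he
    obtain ⟨u, rfl, rfl⟩ := mem_level.mp he
    rw [Finset.mem_range, Nat.lt_succ_iff, Finset.mul_sum]
    exact Finset.sum_le_sum fun j _ => by rw [mul_comm]; exact Nat.mul_le_mul_right _ (hd j)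
  simpa using Finset.card_le_card this

/-- Growth by at least d + 1 at every step from N on would overtake the linear bound d n + 1. -/
theorem exists_card_level_succ_le {a : Fin r → ℕ} {d : ℕ} (hd : ∀ j, a j ≤ d) (N : ℕ) :
    ∃ n ≥ N, (level a (n + 1)).card ≤ (level a n).card + d := by
  by_contra! h
  have key : ∀ k, (d + 1) * k ≤ (level a (N + k)).card := by
    intro k
    induction k with
    | zero => simp
    | succ k ih => have := h (N + k) (by omega); rw [← add_assoc]; linarith
  -- With k = d N + 2 the lower bound (d + 1) k exceeds d (N + k) + 1, the difference being k - (d N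
  -- + 1) = 1.
  have h1 := key (d * N + 2)
  have h2 := card_level_le hd (N + (d * N + 2))
  nlinarith

variable {m : ℕ} {a : Fin (m + 1) → ℕ} {α : Fin 2 → ℤ}
  {U : Set (Fin (m + 1) → ℂ)} {F : (Fin (m + 1) → ℂ) → ℂ} {p : Fin (m + 1) → ℂ}

theorem IsHypergeometricOn.euler_fst (hU : IsOpen U)
    (h : IsHypergeometricOn (curveMatrix a) (fun i => (α i : ℂ)) U F) (hp : p ∈ U)
    (u : Fin (m + 1) → ℕ) :
    ∑ j, p j * pdMulti (u + Pi.single j 1) F p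
      = (α 0 - (∑ j, u j : ℕ)) * pdMulti u F p := by
  have := h.euler_pdMulti hU u 0 hp
  simp only [curveMatrix, Matrix.of_apply, Matrix.cons_val_zero, Int.cast_one, one_mul,
    mul_one] at this
  push_cast
  rw [← this]
  exact Finset.sum_congr rfl fun j _ => by rw [pdMulti_add_single hU h.holomorphic u j hp]

theorem IsHypergeometricOn.euler_snd (hU : IsOpen U)
    (h : IsHypergeometricOn (curveMatrix a) (fun i => (α i : ℂ)) U F) (hp : p ∈ U)
    (u : Fin (m + 1) → ℕ) :
    ∑ j, (a j : ℂ) * p j * pdMulti (u + Pi.single j 1) F p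
      = (α 1 - (∑ j, u j * a j : ℕ)) * pdMulti u F p := by
  have := h.euler_pdMulti hU u 1 hp
  simp only [show ∀ j, curveMatrix a 1 j = (a j : ℤ) from fun _ => rfl, Int.cast_natCast] at this
  push_cast
  rw [← this]
  exact Finset.sum_congr rfl fun j _ => by rw [pdMulti_add_single hU h.holomorphic u j hp]

/-- If the derivatives of order `n + 1` vanish at a point, so do those of order `n`. -/
theorem IsHypergeometricOn.vanish_pred (hU : IsOpen U)
    (h : IsHypergeometricOn (curveMatrix a) (fun i => (α i : ℂ)) U F) (hp : p ∈ U)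
    (hα : α ∉ natImage (curveMatrix a)) {n : ℕ}
    (hv : ∀ u : Fin (m + 1) → ℕ, ∑ j, u j = n + 1 → pdMulti u F p = 0)
    (u : Fin (m + 1) → ℕ) (hu : ∑ j, u j = n) : pdMulti u F p = 0 := by
  have hv' : ∀ j, pdMulti (u + Pi.single j 1) F p = 0 := fun j =>
    hv _ (by simp [Finset.sum_add_distrib, hu])
  have h1 := h.euler_fst hU hp u
  have h2 := h.euler_snd hU hp u
  simp only [hv', mul_zero, Finset.sum_const_zero, zero_eq_mul, sub_eq_zero] at h1 h2
  -- If D_u ≠ 0, both Euler factors vanish, which says α = A u.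
  by_contra hne
  have h1 := h1.resolve_right hne
  have h2 := h2.resolve_right hne
  exact hα ((mem_natImage_curveMatrix a α).mpr ⟨u, by exact_mod_cast h1.symm,
    by exact_mod_cast h2.symm⟩)

/-- The derivatives of order `n + 1` at a point are determined by few of them. -/
theorem IsHypergeometricOn.vanish_level (hU : IsOpen U)
    (h : IsHypergeometricOn (curveMatrix a) (fun i => (α i : ℂ)) U F) (hp : p ∈ U)
    (hp0 : p 0 ≠ 0) (ha0 : a 0 = 0) (ha : ∀ j, j ≠ 0 → 0 < a j) {d : ℕ} (hd : ∀ j, a j ≤ d)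
    {n : ℕ} (hv : ∀ u : Fin (m + 1) → ℕ, ∑ j, u j = n + 1 →
      ∑ j, u j * a j ∈ level a (n + 1) \ (level a n).erase (α 1).toNat → pdMulti u F p = 0)
    (u : Fin (m + 1) → ℕ) (hu : ∑ j, u j = n + 1) : pdMulti u F p = 0 := by
  have bound : ∀ u : Fin (m + 1) → ℕ, ∑ j, u j = n + 1 → ∑ j, u j * a j ≤ d * (n + 1) := by
    intro u hu
    rw [← hu, Finset.mul_sum]
    exact Finset.sum_le_sum fun j _ => by rw [mul_comm]; exact Nat.mul_le_mul_right _ (hd j)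
  -- Downward induction on the second weight, which is at most d (n + 1).
  induction hk : d * (n + 1) - ∑ j, u j * a j using Nat.strong_induction_on generalizing u with
  | _ k ih =>
    by_cases hJ : ∑ j, u j * a j ∈ level a (n + 1) \ (level a n).erase (α 1).toNat
    · exact hv u hu hJ
    have hmem : ∑ j, u j * a j ∈ level a (n + 1) := mem_level.mpr ⟨u, hu, rfl⟩
    rw [Finset.mem_sdiff, not_and, not_not] at hJ
    obtain ⟨hne, hl⟩ := Finset.mem_erase.mp (hJ hmem)
    -- The weight already occurs at order n, say for w. Because a_0 = 0, w + e_0 has the weights of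
    -- u, while w + e_j for j ≠ 0 has a larger second weight and is covered by induction.
    obtain ⟨w, hw, hwe⟩ := mem_level.mp hl
    have hs : ∀ j, ∑ i, (w + Pi.single j 1 : Fin (m + 1) → ℕ) i = n + 1 := fun j => by
      simp [Finset.sum_add_distrib, hw]
    have hsa : ∀ j, ∑ i, (w + Pi.single j 1 : Fin (m + 1) → ℕ) i * a i = ∑ i, u i * a i + a j := fun j => by
      simp [add_mul, Finset.sum_add_distrib, hwe, Pi.single_apply]
    have hz : ∀ j, j ≠ 0 → pdMulti (w + Pi.single j 1) F p = 0 := by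
      intro j hj
      have := ha j hj
      have hb := bound _ (hs j)
      rw [hsa] at hb
      exact ih (d * (n + 1) - ∑ i, (w + Pi.single j 1 : Fin (m + 1) → ℕ) i * a i) (by rw [hsa]; omega) _ (hs j) rfl
    have h0 : pdMulti (w + Pi.single 0 1) F p = pdMulti u F p := by
      refine h.pdMulti_eq hU ?_ hp
      rw [(curveMatrix_mulVec_eq_iff a u _ _).mpr ⟨rfl, rfl⟩, curveMatrix_mulVec_eq_iff, hs, hsa,
        hu, ha0]
      simp
    have h1 := h.euler_fst hU hp w
    have h2 := h.euler_snd hU hp w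
    rw [Finset.sum_eq_single 0 (fun j _ hj => by rw [hz j hj, mul_zero]) (by simp), h0] at h1 h2
    -- The second Euler equation has lost its only remaining term, so D_w = 0 unless the weight is α
    -- 1; then the first equation reads p_0 D_u = 0.
    rw [ha0, Nat.cast_zero, zero_mul, zero_mul, zero_eq_mul, hwe] at h2
    rcases h2 with h2 | h2
    -- Here α 1 equals a natural number, so `toNat` loses nothing. For negative α 1 the erased
    -- element 0 only enlarges the set to be checked.
    · refine absurd ?_ hne
      have : α 1 = (∑ j, u j * a j : ℕ) := by exact_mod_cast sub_eq_zero.mp h2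
      rw [this, Int.toNat_natCast]
    · rw [h2, mul_zero] at h1
      exact (mul_eq_zero.mp h1).resolve_left hp0

end curve

/-! ### Derivatives at a point as linear forms, and the upper bound -/

section extension

variable {r : ℕ} {U : Set (Fin r → ℂ)}

open Classical in
/-- Extension by zero of a function on `U`. -/
noncomputable def extendZero (φ : U → ℂ) : (Fin r → ℂ) → ℂ :=
  fun x => if h : x ∈ U then φ ⟨x, h⟩ else 0

theorem extendZero_apply (φ : U → ℂ) (x : U) : extendZero φ x = φ x := by
  simp [extendZero]

theorem extendZero_add (φ ψ : U → ℂ) : extendZero (φ + ψ) = extendZero φ + extendZero ψ := by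
  funext x; by_cases h : x ∈ U <;> simp [extendZero, h]

theorem extendZero_smul (c : ℂ) (φ : U → ℂ) : extendZero (c • φ) = c • extendZero φ := by
  funext x; by_cases h : x ∈ U <;> simp [extendZero, h]

theorem IsHypergeometricOn.congr {s : ℕ} {A : Matrix (Fin s) (Fin r) ℤ} {α : Fin s → ℂ}
    {F G : (Fin r → ℂ) → ℂ} (hU : IsOpen U) (h : IsHypergeometricOn A α U F)
    (hFG : Set.EqOn F G U) : IsHypergeometricOn A α U G where
  holomorphic := (analyticOnNhd_congr hU hFG).mp h.holomorphic
  toric v hv x hx := by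
    rw [← pdMulti_congr hU _ hFG hx, ← pdMulti_congr hU _ hFG hx, h.toric v hv x hx]
  euler i x hx := by
    rw [← hFG hx, ← h.euler i x hx]
    exact Finset.sum_congr rfl fun j _ => by rw [pd_congr hU j hFG hx]

theorem isHypergeometricOn_extendZero {s : ℕ} {A : Matrix (Fin s) (Fin r) ℤ} {α : Fin s → ℂ}
    {hU : IsOpen U} (φ : algSolutions A α U hU) :
    IsHypergeometricOn A α U (extendZero (φ : U → ℂ)) := by
  obtain ⟨⟨F, hF, hφ⟩, -⟩ := φ.2
  refine hF.congr hU fun x hx => ?_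
  rw [hφ]
  simp [extendZero, hx]

theorem pdMulti_zero_fun (u : Fin r → ℕ) : pdMulti u (0 : (Fin r → ℂ) → ℂ) = 0 :=
  pdMulti_induction (E := ℤ) (w := 0) (P := fun F _ => F = 0) (β := 0)
    (fun j F _ h => by subst h; funext x; simp [pd]) rfl u

/-- The value at a point of a higher derivative, as a linear form on the space of solutions. -/
noncomputable def evalDeriv {s : ℕ} (A : Matrix (Fin s) (Fin r) ℤ) (α : Fin s → ℂ)
    (hU : IsOpen U) {p : Fin r → ℂ} (hp : p ∈ U) (u : Fin r → ℕ) :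
    algSolutions A α U hU →ₗ[ℂ] ℂ where
  toFun φ := pdMulti u (extendZero (φ : U → ℂ)) p
  map_add' φ ψ := by
    have := pdMulti_lin hU 1 u (isHypergeometricOn_extendZero φ).holomorphic
      (isHypergeometricOn_extendZero ψ).holomorphic hp
    rw [Submodule.coe_add, extendZero_add]
    simpa using this
  map_smul' c φ := by
    have := pdMulti_lin hU c u (isHypergeometricOn_extendZero φ).holomorphic
      (analyticOnNhd_const (v := 0)) hp
    have h0 : (fun _ : Fin r → ℂ => (0 : ℂ)) = 0 := rfl
    rw [h0, add_zero, pdMulti_zero_fun, add_zero] at this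
    rw [Submodule.coe_smul, extendZero_smul]
    simpa using this

end extension

/-- A descending chain in a finite-dimensional space stabilises, and its last member is nonzero. -/
theorem exists_ne_zero_forall_mem {k W : Type*} [Field k] [AddCommGroup W] [Module k W]
    [FiniteDimensional k W] {K : ℕ → Submodule k W} (hK : Antitone K) (hne : ∀ n, K n ≠ ⊥) :
    ∃ w, w ≠ 0 ∧ ∀ n, w ∈ K n := by
  obtain ⟨N, hN⟩ := IsArtinian.monotone_stabilizes (R := k) (M := W)
    ⟨fun n => OrderDual.toDual (K n), fun _ _ h => hK h⟩
  obtain ⟨w, hw, hw0⟩ := Submodule.exists_mem_ne_zero_of_ne_bot (hne N)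
  refine ⟨w, hw0, fun n => ?_⟩
  rcases le_total n N with h | h
  · exact hK h hw
  · have : K N = K n := hN n h
    exact this ▸ hw

theorem rank_algSolutions_le {m : ℕ} {a : Fin (m + 1) → ℕ} (ha0 : a 0 = 0)
    (ha : ∀ j, j ≠ 0 → 0 < a j) {d : ℕ} (hd : ∀ j, a j ≤ d)
    {α : Fin 2 → ℤ} (hα : α ∉ natImage (curveMatrix a))
    {U : Set (Fin (m + 1) → ℂ)} (hU : IsOpen U) (hc : IsPreconnected U)
    {p : Fin (m + 1) → ℂ} (hp : p ∈ U) (hp0 : p 0 ≠ 0) :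
    Module.rank ℂ (algSolutions (curveMatrix a) (fun i => (α i : ℂ)) U hU) ≤ (d + 1 : ℕ) := by
  set V := algSolutions (curveMatrix a) (fun i => (α i : ℂ)) U hU
  refine rank_le fun s hs => ?_
  by_contra! hcard
  let W : Submodule ℂ V := Submodule.span ℂ (s : Set V)
  have hW : Module.finrank ℂ W = s.card := finrank_span_finset_eq_card hs
  have : FiniteDimensional ℂ W := FiniteDimensional.span_finset ℂ s
  let ev : (Fin (m + 1) → ℕ) → W →ₗ[ℂ] ℂ := fun u => (evalDeriv _ _ hU hp u).comp W.subtype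
  have hev : ∀ u w, ev u w = pdMulti u (extendZero ((w : V) : U → ℂ)) p := fun _ _ => rfl
  -- Only order n is imposed; lower orders follow from `vanish_pred`, which makes K antitone.
  let K : ℕ → Submodule ℂ W := fun n => ⨅ (u) (_ : ∑ j, u j = n), LinearMap.ker (ev u)
  have hK : ∀ n w, w ∈ K n ↔ ∀ u, ∑ j, u j = n → ev u w = 0 := by
    intro n w; simp [K, Submodule.mem_iInf]
  have hanti : Antitone K := antitone_nat_of_succ_le fun n w hw => by
    rw [hK] at hw ⊢
    exact (isHypergeometricOn_extendZero (w : V)).vanish_pred hU hp hα hw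
  have hne : ∀ N, K N ≠ ⊥ := by
    intro N
    obtain ⟨n, hn, hcl⟩ := exists_card_level_succ_le hd N
    set J := level a (n + 1) \ (level a n).erase (α 1).toNat with hJ
    -- The increment of the levels contributes d, the possible erasure of α 1 one more.
    have hJc : J.card ≤ d + 1 := by
      rw [hJ, Finset.card_sdiff_of_subset
        ((Finset.erase_subset _ _).trans (level_subset_succ ha0 n))]
      have := Finset.pred_card_le_card_erase (s := level a n) (a := (α 1).toNat)
      omega
    have hch : ∀ e : J, ∃ u : Fin (m + 1) → ℕ, ∑ j, u j = n + 1 ∧ ∑ j, u j * a j = e := fun e =>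
      mem_level.mp (Finset.mem_sdiff.mp e.2).1
    choose u hu hue using hch
    have hker : LinearMap.ker (LinearMap.pi fun e => ev (u e)) ≠ ⊥ :=
      LinearMap.ker_ne_bot_of_finrank_lt (K := ℂ) (V := W) (V₂ := J → ℂ) (by
        rw [hW, Module.finrank_pi, Fintype.card_coe]; omega)
    -- The solutions killed by the |J| < dim W chosen forms lie in K (n + 1), hence in K N, so K N
    -- cannot be zero.
    refine fun h => hker (le_bot_iff.mp (le_trans (fun w hw => ?_)
      ((hanti (Nat.le_succ_of_le hn)).trans h.le)))
    rw [hK]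
    have hF := isHypergeometricOn_extendZero (w : V)
    refine hF.vanish_level hU hp hp0 ha0 ha hd fun v hv hvJ => ?_
    have hz : ev (u ⟨_, hvJ⟩) w = 0 := congrFun (LinearMap.mem_ker.mp hw) ⟨_, hvJ⟩
    rw [hev] at hz
    rw [← hz]
    refine hF.pdMulti_eq hU ?_ hp
    rw [(curveMatrix_mulVec_eq_iff a (u _) _ _).mpr ⟨rfl, rfl⟩, curveMatrix_mulVec_eq_iff, hu, hue,
      hv]
    exact ⟨rfl, rfl⟩
  obtain ⟨w, hw0, hall⟩ := exists_ne_zero_forall_mem (k := ℂ) (W := W) (K := K) hanti hne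
  apply hw0
  have h0 := eqOn_zero_of_pdMulti hU hc (isHypergeometricOn_extendZero (w : V)).holomorphic hp
    fun u => (hK _ w).mp (hall _) u rfl
  ext x
  have := h0 x.2
  rwa [extendZero_apply] at this

/-! ### Hypergeometric polynomials as coefficients of powers of f -/

section hyperPoly

variable {r : ℕ} (a : Fin r → ℕ)

/-- The coefficient of `t^i` in `(∑_j x_j t^{a_j})^n`. -/
noncomputable def coefPow : ℕ → ℤ → (Fin r → ℂ) → ℂ
  | 0, i, _ => if i = 0 then 1 else 0
  | n + 1, i, x => ∑ j, x j * coefPow n (i - a j) x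

theorem coefPow_of_neg (n : ℕ) {i : ℤ} (hi : i < 0) (x : Fin r → ℂ) : coefPow a n i x = 0 := by
  induction n generalizing i with
  | zero => simp [coefPow, hi.ne]
  | succ n ih =>
    rw [coefPow]
    exact Finset.sum_eq_zero fun j _ => by rw [ih (by omega), mul_zero]

theorem coefPow_natCast (n i : ℕ) (x : Fin r → ℂ) : coefPow a n i x
    = ((∑ j, Polynomial.C (x j) * Polynomial.X ^ a j : Polynomial ℂ) ^ n).coeff i := by
  induction n generalizing i with
  | zero => simp [coefPow, Polynomial.coeff_one]
  | succ n ih =>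
    rw [coefPow, pow_succ', Finset.sum_mul, Polynomial.finsetSum_coeff]
    refine Finset.sum_congr rfl fun j _ => ?_
    rw [mul_assoc, Polynomial.coeff_C_mul, Polynomial.coeff_X_pow_mul']
    split_ifs with h
    · rw [← ih, Nat.cast_sub h]
    · rw [coefPow_of_neg a n (by omega)]

theorem coefPow_analytic (n : ℕ) (i : ℤ) : AnalyticOnNhd ℂ (coefPow a n i) Set.univ := by
  induction n generalizing i with
  | zero => exact analyticOnNhd_const
  | succ n ih =>
    refine Finset.analyticOnNhd_fun_sum _ fun j _ => ?_
    exact ((ContinuousLinearMap.proj (R := ℂ) (φ := fun _ : Fin r => ℂ) j).analyticOnNhd _).mul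
      (ih _)

theorem pd_coefPow_succ (n : ℕ) (i : ℤ) (k : Fin r) (x : Fin r → ℂ) :
    pd k (coefPow a (n + 1) i) x = (n + 1) * coefPow a n (i - a k) x := by
  have hd : ∀ n i, DifferentiableAt ℂ (coefPow a n i) x := fun n i =>
    (coefPow_analytic a n i x trivial).differentiableAt
  have hrec : ∀ n i, pd k (coefPow a (n + 1) i) x
      = coefPow a n (i - a k) x + ∑ j, x j * pd k (coefPow a n (i - a j)) x := by
    intro n i
    have : coefPow a (n + 1) i = fun x => ∑ j, x j * coefPow a n (i - a j) x := rfl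
    rw [this, pd_fun_sum _ _ fun j _ => by have := hd n (i - a j); fun_prop]
    have h : ∀ j, pd k (fun y => y j * coefPow a n (i - a j) y) x
        = x j * pd k (coefPow a n (i - a j)) x
          + if j = k then coefPow a n (i - a j) x else 0 := by
      intro j
      rw [pd_fun_mul k (by fun_prop) (hd _ _), pd_coord]
      split_ifs <;> simp
    simp only [h, Finset.sum_add_distrib, Finset.sum_ite_eq', Finset.mem_univ, if_true]
    ring
  induction n generalizing i with
  | zero =>
    rw [hrec, Finset.sum_eq_zero]
    · simp
    · intro j _
      have : coefPow a 0 (i - a j) = fun _ => if i - a j = 0 then 1 else 0 := rfl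
      rw [this, pd_const, mul_zero]
  | succ n ih =>
    rw [hrec]
    have : coefPow a (n + 1) (i - a k) x
      = ∑ j, x j * coefPow a n (i - a k - a j) x := rfl
    simp only [ih, this]
    push_cast
    rw [Finset.sum_congr rfl fun j _ => show
      x j * ((n + 1 : ℂ) * coefPow a n (i - a j - a k) x)
        = (n + 1) * (x j * coefPow a n (i - a k - a j) x) by rw [sub_right_comm]; ring,
      ← Finset.mul_sum]
    ring

/-- Compare coefficients of t^i in t d/dt of f^{n+1} = (n + 1) f^n · t f'. -/
theorem sum_mul_coefPow (n : ℕ) (i : ℤ) (x : Fin r → ℂ) :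
    ∑ j, (a j : ℂ) * x j * ((n + 1) * coefPow a n (i - a j) x) = i * coefPow a (n + 1) i x := by
  induction n generalizing i with
  | zero =>
    simp only [coefPow, Nat.cast_zero, zero_add, one_mul]
    rw [Finset.mul_sum]
    refine Finset.sum_congr rfl fun j _ => ?_
    split_ifs with h
    · have : (i : ℂ) = a j := by exact_mod_cast sub_eq_zero.mp h
      rw [this]; ring
    · simp
  | succ n ih =>
    have h1 : (i : ℂ) * coefPow a (n + 2) i x = ∑ j, (a j : ℂ) * x j * coefPow a (n + 1) (i - a j) x
        + ∑ j, x j * (((i - a j : ℤ) : ℂ) * coefPow a (n + 1) (i - a j) x) := by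
      rw [← Finset.sum_add_distrib, coefPow, Finset.mul_sum]
      refine Finset.sum_congr rfl fun j _ => ?_
      push_cast; ring
    have h2 : ∑ j, x j * (((i - a j : ℤ) : ℂ) * coefPow a (n + 1) (i - a j) x)
        = ∑ j, (a j : ℂ) * x j * ((n + 1) * coefPow a (n + 1) (i - a j) x) := by
      rw [Finset.sum_congr rfl fun j _ => by rw [← ih]]
      simp only [coefPow, Finset.mul_sum]
      rw [Finset.sum_comm]
      refine Finset.sum_congr rfl fun j _ => Finset.sum_congr rfl fun k _ => ?_
      rw [sub_right_comm]; ring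
    rw [h1, h2, ← Finset.sum_add_distrib]
    refine Finset.sum_congr rfl fun j _ => ?_
    push_cast; ring

theorem hyperPoly_eq_zero {s : ℕ} {A : Matrix (Fin s) (Fin r) ℤ} {α : Fin s → ℤ}
    (hα : α ∉ natImage A) : hyperPoly A α = 0 := by
  funext x
  have : {u : Fin r → ℕ | A.mulVec (fun j => (u j : ℤ)) = α} = ∅ :=
    Set.eq_empty_iff_forall_notMem.mpr fun u hu => hα ⟨u, hu⟩
  rw [hyperPoly, this, finsum_mem_empty, Pi.zero_apply]

/-- Multinomial theorem. The recursion for `coefPow` then replaces sums over exponent vectors. -/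
theorem hyperPoly_natCast (n : ℕ) (i : ℤ) (x : Fin r → ℂ) :
    hyperPoly (curveMatrix a) ![(n : ℤ), i] x = coefPow a n i x / (Nat.factorial n : ℂ) := by
  rcases lt_or_ge i 0 with hi | hi
  · rw [coefPow_of_neg a n hi, hyperPoly_eq_zero, zero_div, Pi.zero_apply]
    rintro ⟨u, hu⟩
    rw [curveMatrix_mulVec_eq_iff] at hu
    omega
  lift i to ℕ using hi
  have hset : {u : Fin r → ℕ | (curveMatrix a).mulVec (fun j => (u j : ℤ)) = ![(n : ℤ), (i : ℤ)]}
      = ((Finset.piAntidiag Finset.univ n).filter fun u => ∑ j, u j * a j = i : Finset _) := by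
    ext u
    rw [Set.mem_ofPred_eq, curveMatrix_mulVec_eq_iff]
    simp only [Finset.coe_filter, Finset.mem_piAntidiag, Set.mem_ofPred_eq, Finset.mem_univ,
      implies_true, and_true, Nat.cast_inj]
  have hprod : ∀ u : Fin r → ℕ, ∏ j, (Polynomial.C (x j) * Polynomial.X ^ a j) ^ u j
      = Polynomial.C (∏ j, x j ^ u j) * Polynomial.X ^ ∑ j, u j * a j := by
    intro u
    simp only [mul_pow, Finset.prod_mul_distrib, map_prod, map_pow, ← pow_mul,
      Finset.prod_pow_eq_pow_sum, mul_comm]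
  rw [coefPow_natCast, Finset.sum_pow_eq_sum_piAntidiag, Polynomial.finsetSum_coeff, hyperPoly,
    hset, finsum_mem_coe_finset, Finset.sum_filter, Finset.sum_div]
  refine Finset.sum_congr rfl fun u hu => ?_
  have hun : ∑ j, u j = n := (Finset.mem_piAntidiag.mp hu).1
  rw [hprod, ← Polynomial.C_eq_natCast, Polynomial.coeff_C_mul, Polynomial.coeff_C_mul,
    Polynomial.coeff_X_pow]
  have hm : (∏ j, (Nat.factorial (u j) : ℂ)) * (Nat.multinomial Finset.univ u : ℂ)
      = (Nat.factorial n : ℂ) := by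
    rw [← hun]; exact_mod_cast Nat.multinomial_spec Finset.univ u
  have hn0 : (Nat.factorial n : ℂ) ≠ 0 := Nat.cast_ne_zero.mpr (Nat.factorial_ne_zero _)
  have hp0 : ∏ j, (Nat.factorial (u j) : ℂ) ≠ 0 :=
    Finset.prod_ne_zero_iff.mpr fun j _ => Nat.cast_ne_zero.mpr (Nat.factorial_ne_zero _)
  by_cases h : ∑ j, u j * a j = i
  · rw [if_pos h, if_pos h.symm, Finset.prod_div_distrib, div_eq_div_iff hp0 hn0, ← hm]
    ring
  · rw [if_neg h, if_neg (Ne.symm h)]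
    simp

theorem hyperPoly_of_neg {n : ℤ} (hn : n < 0) (i : ℤ) :
    hyperPoly (curveMatrix a) ![n, i] = 0 := by
  apply hyperPoly_eq_zero
  rintro ⟨u, hu⟩
  rw [curveMatrix_mulVec_eq_iff] at hu
  omega

theorem hyperPoly_analytic (n i : ℤ) :
    AnalyticOnNhd ℂ (hyperPoly (curveMatrix a) ![n, i]) Set.univ := by
  rcases lt_or_ge n 0 with hn | hn
  · rw [hyperPoly_of_neg a hn]; exact analyticOnNhd_const
  · lift n to ℕ using hn
    have : hyperPoly (curveMatrix a) ![(n : ℤ), i]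
        = fun x => coefPow a n i x * (Nat.factorial n : ℂ)⁻¹ :=
      funext fun x => by rw [hyperPoly_natCast, div_eq_mul_inv]
    rw [this]
    exact (coefPow_analytic a n i).mul analyticOnNhd_const

/-- The division by n! absorbs the factor n from differentiating f^n; the value 0 at negative order
keeps the rule valid at n = 0. -/
theorem pd_hyperPoly (n i : ℤ) (j : Fin r) (x : Fin r → ℂ) :
    pd j (hyperPoly (curveMatrix a) ![n, i]) x
      = hyperPoly (curveMatrix a) ![n - 1, i - a j] x := by
  rcases lt_or_ge n 0 with hn | hn
  · rw [hyperPoly_of_neg a hn, hyperPoly_of_neg a (by omega)]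
    simp [pd]
  lift n to ℕ using hn
  have : hyperPoly (curveMatrix a) ![(n : ℤ), i]
      = fun x => (Nat.factorial n : ℂ)⁻¹ * coefPow a n i x :=
    funext fun x => by rw [hyperPoly_natCast, div_eq_inv_mul]
  rw [this, pd_const_mul _ _ (coefPow_analytic a n i x trivial).differentiableAt]
  cases n with
  | zero =>
    have h0 : coefPow a 0 i = fun _ => if i = 0 then 1 else 0 := rfl
    rw [hyperPoly_of_neg a (by simp), h0, pd_const]
    simp
  | succ n =>
    rw [pd_coefPow_succ, show ((n + 1 : ℕ) : ℤ) - 1 = n by push_cast; ring, hyperPoly_natCast,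
      Nat.factorial_succ]
    have hn0 : (Nat.factorial n : ℂ) ≠ 0 := Nat.cast_ne_zero.mpr (Nat.factorial_ne_zero _)
    have hn1 : (n + 1 : ℂ) ≠ 0 := by exact_mod_cast n.succ_ne_zero
    push_cast
    field_simp

theorem sum_mul_hyperPoly_fst (n i : ℤ) (x : Fin r → ℂ) :
    ∑ j, x j * hyperPoly (curveMatrix a) ![n - 1, i - a j] x
      = n * hyperPoly (curveMatrix a) ![n, i] x := by
  rcases lt_trichotomy n 0 with hn | rfl | hn
  · simp [hyperPoly_of_neg a hn, hyperPoly_of_neg a (show n - 1 < 0 by omega)]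
  · simp [hyperPoly_of_neg a (show (-1 : ℤ) < 0 by omega)]
  obtain ⟨k, rfl⟩ : ∃ k : ℕ, n = ((k + 1 : ℕ) : ℤ) := ⟨(n - 1).toNat, by omega⟩
  rw [show ((k + 1 : ℕ) : ℤ) - 1 = k by push_cast; ring, hyperPoly_natCast]
  simp only [hyperPoly_natCast]
  have hn0 : (Nat.factorial k : ℂ) ≠ 0 := Nat.cast_ne_zero.mpr (Nat.factorial_ne_zero _)
  have hn1 : (k + 1 : ℂ) ≠ 0 := by exact_mod_cast k.succ_ne_zero
  rw [coefPow, Nat.factorial_succ]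
  simp only [mul_div_assoc', ← Finset.sum_div]
  push_cast
  field_simp

theorem sum_mul_hyperPoly_snd (n i : ℤ) (x : Fin r → ℂ) :
    ∑ j, (a j : ℂ) * x j * hyperPoly (curveMatrix a) ![n - 1, i - a j] x
      = i * hyperPoly (curveMatrix a) ![n, i] x := by
  rcases lt_trichotomy n 0 with hn | rfl | hn
  · simp [hyperPoly_of_neg a hn, hyperPoly_of_neg a (show n - 1 < 0 by omega)]
  · have h0 := hyperPoly_natCast a 0 i x
    rw [Nat.cast_zero, coefPow] at h0
    rw [h0]
    simp only [hyperPoly_of_neg a (show (0 : ℤ) - 1 < 0 by omega)]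
    split_ifs with h <;> simp [h]
  obtain ⟨k, rfl⟩ : ∃ k : ℕ, n = ((k + 1 : ℕ) : ℤ) := ⟨(n - 1).toNat, by omega⟩
  rw [show ((k + 1 : ℕ) : ℤ) - 1 = k by push_cast; ring, hyperPoly_natCast, mul_div_assoc',
    ← sum_mul_coefPow, Finset.sum_div]
  simp only [hyperPoly_natCast]
  have hn0 : (Nat.factorial k : ℂ) ≠ 0 := Nat.cast_ne_zero.mpr (Nat.factorial_ne_zero _)
  have hn1 : (k + 1 : ℂ) ≠ 0 := by exact_mod_cast k.succ_ne_zero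
  refine Finset.sum_congr rfl fun j _ => ?_
  rw [Nat.factorial_succ]
  push_cast
  field_simp

theorem sum_hyperPoly_mul_pow {d : ℕ} (hd : ∀ j, a j ≤ d) (n : ℕ) (x : Fin r → ℂ) (t : ℂ) :
    ∑ i ∈ Finset.range (d * n + 1), hyperPoly (curveMatrix a) ![(n : ℤ), (i : ℤ)] x * t ^ i
      = (∑ j, x j * t ^ a j) ^ n / (Nat.factorial n : ℂ) := by
  have hdeg : ((∑ j, Polynomial.C (x j) * Polynomial.X ^ a j : Polynomial ℂ) ^ n).natDegree
      < d * n + 1 := by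
    rw [Nat.lt_succ_iff, mul_comm]
    refine Polynomial.natDegree_pow_le_of_le n (Polynomial.natDegree_sum_le_of_forall_le _ _ ?_)
    exact fun j _ => (Polynomial.natDegree_C_mul_X_pow_le _ _).trans (hd j)
  have := Polynomial.eval_eq_sum_range' hdeg t
  simp only [Polynomial.eval_pow, Polynomial.eval_finsetSum, Polynomial.eval_mul,
    Polynomial.eval_C, Polynomial.eval_X] at this
  rw [this, Finset.sum_div]
  refine Finset.sum_congr rfl fun i _ => ?_
  rw [hyperPoly_natCast, coefPow_natCast]
  ring

theorem hyperPoly_eq_zero_of_notMem_Icc {d : ℕ} (hd : ∀ j, a j ≤ d) {n i : ℤ}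
    (hi : i ∉ Finset.Icc 0 (d * n)) : hyperPoly (curveMatrix a) ![n, i] = 0 := by
  apply hyperPoly_eq_zero
  rintro ⟨u, hu⟩
  obtain ⟨rfl, rfl⟩ := (curveMatrix_mulVec_eq_iff a u n i).mp hu
  refine hi (Finset.mem_Icc.mpr ⟨by positivity, ?_⟩)
  rw [← Nat.cast_mul, Nat.cast_le, Finset.mul_sum]
  exact Finset.sum_le_sum fun j _ => by rw [mul_comm]; exact Nat.mul_le_mul_right _ (hd j)

end hyperPoly

theorem vec_eta (α : Fin 2 → ℤ) : ![α 0, α 1] = α := by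
  funext i; fin_cases i <;> rfl

/-! ### Families closed under differentiation -/

section family

variable {r : ℕ} {a : Fin r → ℕ} {U : Set (Fin r → ℂ)}

/-- The complement of the semigroup is stable under subtracting columns of A, so a differentiation
rule that holds only there can be iterated. -/
theorem sub_notMem_natImage {n b : ℤ} (h : ![n, b] ∉ natImage (curveMatrix a)) (j : Fin r) :
    ![n - 1, b - a j] ∉ natImage (curveMatrix a) := by
  rintro ⟨u, hu⟩
  rw [curveMatrix_mulVec_eq_iff] at hu
  refine h ⟨u + Pi.single j 1, (curveMatrix_mulVec_eq_iff a _ _ _).mpr ⟨?_, ?_⟩⟩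
  · simp only [Pi.add_apply, Finset.sum_add_distrib, Finset.sum_pi_single', Finset.mem_univ,
      if_true]
    omega
  · simp only [Pi.add_apply, add_mul, Finset.sum_add_distrib, Pi.single_apply, ite_mul, one_mul,
      zero_mul, Finset.sum_ite_eq', Finset.mem_univ, if_true]
    omega

theorem pdMulti_family (hU : IsOpen U) {G : ℤ → ℤ → (Fin r → ℂ) → ℂ}
    (hG : ∀ n b, ![n, b] ∉ natImage (curveMatrix a) → ∀ j, ∀ x ∈ U,
      pd j (G n b) x = G (n - 1) (b - a j) x)
    {n b : ℤ} (h : ![n, b] ∉ natImage (curveMatrix a)) {F : (Fin r → ℂ) → ℂ}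
    (hF : Set.EqOn F (G n b) U) (u : Fin r → ℕ) :
    Set.EqOn (pdMulti u F) (G (n - (∑ j, u j : ℕ)) (b - (∑ j, u j * a j : ℕ))) U := by
  have := pdMulti_induction (E := ℤ × ℤ) (w := fun j => (1, (a j : ℤ))) (β := (n, b)) (F := F)
    (P := fun F β => ![β.1, β.2] ∉ natImage (curveMatrix a) ∧ Set.EqOn F (G β.1 β.2) U)
    (fun j F β hβ => ⟨sub_notMem_natImage hβ.1 j,
      (pd_congr hU j hβ.2).trans (hG _ _ hβ.1 j)⟩) ⟨h, hF⟩ u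
  have h2 := this.2
  simp only [Prod.fst_sub, Prod.snd_sub, Prod.fst_sum, Prod.snd_sum, Prod.smul_fst,
    Prod.smul_snd] at h2
  simp only [nsmul_eq_mul, mul_one] at h2
  exact_mod_cast h2

/-- D_u moves (n, b) by A u, so it depends on u only through A u. This is the toric condition; only
the Euler equations at α itself remain to be supplied. -/
theorem isHypergeometricOn_of_family (hU : IsOpen U) {G : ℤ → ℤ → (Fin r → ℂ) → ℂ}
    (hG : ∀ n b, ![n, b] ∉ natImage (curveMatrix a) → ∀ j, ∀ x ∈ U,
      pd j (G n b) x = G (n - 1) (b - a j) x)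
    {α : Fin 2 → ℤ} (h : α ∉ natImage (curveMatrix a))
    (han : AnalyticOnNhd ℂ (G (α 0) (α 1)) U)
    (h0 : ∀ x ∈ U, ∑ j, x j * pd j (G (α 0) (α 1)) x = α 0 * G (α 0) (α 1) x)
    (h1 : ∀ x ∈ U, ∑ j, (a j : ℂ) * x j * pd j (G (α 0) (α 1)) x = α 1 * G (α 0) (α 1) x) :
    IsHypergeometricOn (curveMatrix a) (fun i => (α i : ℂ)) U (G (α 0) (α 1)) where
  holomorphic := han
  toric v hv x hx := by
    have hα : ![α 0, α 1] ∉ natImage (curveMatrix a) := by rwa [vec_eta]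
    rw [pdMulti_family hU hG hα (fun _ _ => rfl) _ hx, pdMulti_family hU hG hα (fun _ _ => rfl) _ hx]
    rw [curveMatrix_mulVec] at hv
    have hv0 : ∑ j, v j = 0 := congrFun hv 0
    have hv1 : ∑ j, v j * (a j : ℤ) = 0 := congrFun hv 1
    have e0 : ((∑ j, (v j).toNat : ℕ) : ℤ) = (∑ j, (-v j).toNat : ℕ) := by
      rw [← sub_eq_zero, ← hv0]
      push_cast
      rw [← Finset.sum_sub_distrib]
      exact Finset.sum_congr rfl fun j _ => by omega
    have e1 : ((∑ j, (v j).toNat * a j : ℕ) : ℤ) = (∑ j, (-v j).toNat * a j : ℕ) := by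
      rw [← sub_eq_zero, ← hv1]
      push_cast
      rw [← Finset.sum_sub_distrib]
      refine Finset.sum_congr rfl fun j _ => ?_
      rw [← sub_mul]
      congr 1
      omega
    rw [e0, e1]
  euler i x hx := by
    fin_cases i
    · simpa [curveMatrix] using h0 x hx
    · simpa [curveMatrix] using h1 x hx

end family

/-! ### Differentiating a simple root, and the solutions attached to it -/

section root

theorem pd_comp {r : ℕ} {F : (Fin r → ℂ) → ℂ} {x : Fin r → ℂ} {g : ℂ → ℂ} {g' : ℂ}
    (hg : HasDerivAt g g' (F x)) (hF : DifferentiableAt ℂ F x) (j : Fin r) :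
    pd j (fun y => g (F y)) x = g' * pd j F x := by
  have := (hg.comp_hasFDerivAt x hF.hasFDerivAt).fderiv
  rw [pd, show (fun y => g (F y)) = g ∘ F from rfl, this]
  simp [pd]

theorem pd_pow {r : ℕ} {F : (Fin r → ℂ) → ℂ} {x : Fin r → ℂ} (n : ℕ)
    (hF : DifferentiableAt ℂ F x) (j : Fin r) :
    pd j (fun y => F y ^ n) x = n * F x ^ (n - 1) * pd j F x :=
  pd_comp (hasDerivAt_pow n (F x)) hF j

theorem pd_zpow {r : ℕ} {F : (Fin r → ℂ) → ℂ} {x : Fin r → ℂ} (n : ℤ) (h : F x ≠ 0)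
    (hF : DifferentiableAt ℂ F x) (j : Fin r) :
    pd j (fun y => F y ^ n) x = n * F x ^ (n - 1) * pd j F x :=
  pd_comp (hasDerivAt_zpow n (F x) (Or.inl h)) hF j

/-- `ρ` is a holomorphic function on `U` whose values are simple nonzero roots of
`∑_j x_j t^{a_j}`. -/
structure IsSimpleRootOn {r : ℕ} (a : Fin r → ℕ) (U : Set (Fin r → ℂ))
    (ρ : (Fin r → ℂ) → ℂ) : Prop where
  holomorphic : AnalyticOnNhd ℂ ρ U
  root : ∀ x ∈ U, ∑ j, x j * ρ x ^ a j = 0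
  ne_zero : ∀ x ∈ U, ρ x ≠ 0
  simple : ∀ x ∈ U, ∑ j, (a j : ℂ) * x j * ρ x ^ a j ≠ 0

variable {m : ℕ} {a : Fin (m + 1) → ℕ} {U : Set (Fin (m + 1) → ℂ)} {ρ : (Fin (m + 1) → ℂ) → ℂ}

/-- Implicit differentiation of f(x; ρ) = 0, multiplied by ρ so that the truncated exponents a_i - 1
disappear. -/
theorem IsSimpleRootOn.pd_mul (hU : IsOpen U) (h : IsSimpleRootOn a U ρ) {x : Fin (m + 1) → ℂ}
    (hx : x ∈ U) (j : Fin (m + 1)) :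
    (∑ i, (a i : ℂ) * x i * ρ x ^ a i) * pd j ρ x = -ρ x ^ (a j + 1) := by
  have hd : DifferentiableAt ℂ ρ x := (h.holomorphic x hx).differentiableAt
  have h1 := pd_congr hU j (F := fun x => ∑ i, x i * ρ x ^ a i) (G := fun _ => 0) h.root hx
  rw [pd_const, pd_fun_sum _ _ (fun i _ => by fun_prop)] at h1
  have h2 : ∀ i, ρ x * pd j (fun y => y i * ρ y ^ a i) x
      = (a i : ℂ) * x i * ρ x ^ a i * pd j ρ x + if i = j then ρ x ^ (a i + 1) else 0 := by
    intro i
    rw [pd_fun_mul j (by fun_prop) (by fun_prop), pd_coord, pd_pow _ hd]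
    rcases Nat.eq_zero_or_pos (a i) with h0 | h0
    · split_ifs <;> simp [h0]
    · have : ρ x ^ a i = ρ x ^ (a i - 1) * ρ x := by rw [← pow_succ, Nat.sub_add_cancel h0]
      rw [pow_succ (ρ x) (a i), this]
      split_ifs <;> ring
  have h3 := congrArg (ρ x * ·) h1
  simp only [Finset.mul_sum, h2, Finset.sum_add_distrib, Finset.sum_ite_eq', Finset.mem_univ,
    if_true, mul_zero, ← Finset.sum_mul] at h3
  linear_combination h3

theorem IsSimpleRootOn.pd_eq (hU : IsOpen U) (h : IsSimpleRootOn a U ρ) (ha0 : a 0 = 0)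
    {x : Fin (m + 1) → ℂ} (hx : x ∈ U) (j : Fin (m + 1)) :
    pd j ρ x = ρ x ^ a j * pd 0 ρ x := by
  apply mul_left_cancel₀ (h.simple x hx)
  rw [mul_left_comm, h.pd_mul hU hx, h.pd_mul hU hx, ha0]
  ring

theorem IsSimpleRootOn.euler_fst (hU : IsOpen U) (h : IsSimpleRootOn a U ρ) (ha0 : a 0 = 0)
    {x : Fin (m + 1) → ℂ} (hx : x ∈ U) : ∑ j, x j * pd j ρ x = 0 := by
  rw [Finset.sum_congr rfl fun j _ => by rw [h.pd_eq hU ha0 hx j, ← mul_assoc]]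
  rw [← Finset.sum_mul, h.root x hx, zero_mul]

theorem IsSimpleRootOn.euler_snd (hU : IsOpen U) (h : IsSimpleRootOn a U ρ) (ha0 : a 0 = 0)
    {x : Fin (m + 1) → ℂ} (hx : x ∈ U) : ∑ j, (a j : ℂ) * x j * pd j ρ x = -ρ x := by
  rw [Finset.sum_congr rfl fun j _ => by rw [h.pd_eq hU ha0 hx j, ← mul_assoc]]
  rw [← Finset.sum_mul, h.pd_mul hU hx, ha0, zero_add, pow_one]

/-- The functions `ρ^c ∂_0 ρ` satisfy `∂_j (ρ^c ∂_0 ρ) = ∂_0 (ρ^{c + a_j} ∂_0 ρ)`. -/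
theorem IsSimpleRootOn.pd_zpow_mul (hU : IsOpen U) (h : IsSimpleRootOn a U ρ) (ha0 : a 0 = 0)
    (c : ℤ) (j : Fin (m + 1)) {x : Fin (m + 1) → ℂ} (hx : x ∈ U) :
    pd j (fun y => ρ y ^ c * pd 0 ρ y) x = pd 0 (fun y => ρ y ^ (c + a j) * pd 0 ρ y) x := by
  have hd : DifferentiableAt ℂ ρ x := (h.holomorphic x hx).differentiableAt
  have hd0 : DifferentiableAt ℂ (pd 0 ρ) x :=
    (pd_analytic 0 h.holomorphic x hx).differentiableAt
  have hne := h.ne_zero x hx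
  have hz : ∀ c : ℤ, DifferentiableAt ℂ (fun y => ρ y ^ c) x := fun c => hd.zpow (Or.inl hne)
  have h1 : pd j (pd 0 ρ) x = pd 0 (fun y => ρ y ^ a j * pd 0 ρ y) x := by
    rw [pd_comm h.holomorphic j 0 hx]
    exact pd_congr hU 0 (fun y hy => h.pd_eq hU ha0 hy j) hx
  rw [pd_fun_mul 0 (by fun_prop) hd0, pd_pow _ hd] at h1
  rw [pd_fun_mul j (hz _) hd0, pd_fun_mul 0 (hz _) hd0, pd_zpow _ hne hd, pd_zpow _ hne hd, h1,
    h.pd_eq hU ha0 hx j]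
  have e1 : ρ x ^ (c - 1) = ρ x ^ c / ρ x := by rw [zpow_sub_one₀ hne, div_eq_mul_inv]
  have e2 : ρ x ^ (c + a j) = ρ x ^ c * ρ x ^ a j := by rw [zpow_add₀ hne, zpow_natCast]
  have e3 : ρ x ^ (c + a j - 1) = ρ x ^ c * ρ x ^ a j / ρ x := by
    rw [zpow_sub_one₀ hne, e2, div_eq_mul_inv]
  have e4 : (a j : ℂ) * ρ x ^ (a j - 1) = a j * (ρ x ^ a j / ρ x) := by
    rcases Nat.eq_zero_or_pos (a j) with h0 | h0
    · simp [h0]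
    · have : ρ x ^ a j = ρ x ^ (a j - 1) * ρ x := by rw [← pow_succ, Nat.sub_add_cancel h0]
      rw [this, mul_div_assoc, div_self hne, mul_one]
  rw [e1, e2, e3, e4]
  push_cast
  ring

/-- The family of derivatives of `psi`. -/
noncomputable def psiFamily (a : Fin (m + 1) → ℕ) (d : ℕ) (ρ : (Fin (m + 1) → ℂ) → ℂ) (n b : ℤ) :
    (Fin (m + 1) → ℂ) → ℂ :=
  if 0 ≤ n then fun x => ∑ i ∈ Finset.Icc (0 : ℤ) (d * n),
    hyperPoly (curveMatrix a) ![n, i] x * (ρ x ^ (i - b) / ((i - b : ℤ) : ℂ))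
  else (pd 0)^[(-n - 1).toNat] fun x => ρ x ^ (-b - 1) * pd 0 ρ x

theorem IsSimpleRootOn.psiFamily_analytic (h : IsSimpleRootOn a U ρ) (d : ℕ) (n b : ℤ) :
    AnalyticOnNhd ℂ (psiFamily a d ρ n b) U := by
  have hz : ∀ c : ℤ, AnalyticOnNhd ℂ (fun x => ρ x ^ c) U := fun c x hx =>
    (h.holomorphic x hx).fun_zpow (h.ne_zero x hx)
  unfold psiFamily
  split_ifs with hn
  · refine Finset.analyticOnNhd_fun_sum _ fun i _ => ?_
    refine ((hyperPoly_analytic a n i).mono (Set.subset_univ _)).mul ?_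
    simp only [div_eq_mul_inv]
    exact (hz _).mul analyticOnNhd_const
  · exact pd_iter_analytic _ _ ((hz _).mul (pd_analytic 0 h.holomorphic))

/-- Shifting by k keeps the support inside [0, d n] because 0 ≤ k ≤ d. -/
theorem sum_Icc_sub {d n : ℤ} {k : ℤ} (hk0 : 0 ≤ k) (hk : k ≤ d) {g : ℤ → ℂ}
    (hg : ∀ i ∉ Finset.Icc 0 (d * (n - 1)), g i = 0) :
    ∑ i ∈ Finset.Icc 0 (d * n), g (i - k) = ∑ i ∈ Finset.Icc 0 (d * (n - 1)), g i := by
  have hsupp : Function.support g ⊆ Finset.Icc 0 (d * (n - 1)) := fun i hi => by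
    by_contra hc; exact hi (hg i hc)
  rw [← finsum_eq_sum_of_support_subset g hsupp, ← finsum_comp_equiv (Equiv.subRight k)]
  symm
  refine finsum_eq_sum_of_support_subset (fun i => g (i - k)) fun i hi => ?_
  have := hsupp (show i - k ∈ Function.support g from hi)
  simp only [Finset.coe_Icc, Set.mem_Icc] at this ⊢
  constructor
  · omega
  · nlinarith [this.2]

theorem sum_Icc_hyperPoly_mul_zpow {d : ℕ} (hd : ∀ j, a j ≤ d) {n : ℤ} (hn : 0 ≤ n)
    (x : Fin (m + 1) → ℂ) (t : ℂ) :
    ∑ i ∈ Finset.Icc (0 : ℤ) (d * n), hyperPoly (curveMatrix a) ![n, i] x * t ^ i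
      = (∑ j, x j * t ^ a j) ^ n.toNat / (Nat.factorial n.toNat : ℂ) := by
  lift n to ℕ using hn
  rw [Int.toNat_natCast, ← sum_hyperPoly_mul_pow a hd]
  symm
  refine Finset.sum_nbij (fun i : ℕ => (i : ℤ)) ?_ ?_ ?_ ?_
  · intro i hi
    have := Finset.mem_range.mp hi
    rw [Finset.mem_Icc]
    exact ⟨by positivity, by exact_mod_cast Nat.lt_succ_iff.mp this⟩
  · exact fun _ _ _ _ h => Nat.cast_injective (R := ℤ) h
  · intro i hi
    obtain ⟨h0, h1⟩ := Finset.mem_Icc.mp hi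
    lift i to ℕ using h0
    exact ⟨i, Finset.mem_coe.mpr (Finset.mem_range.mpr (Nat.lt_succ_iff.mpr (by exact_mod_cast h1))),
      rfl⟩
  · intro i _
    rw [zpow_natCast]

/-- Product rule, before f(ρ) = 0 is used. The denominator i - b cancels against the exponent; at i
= b, where division yields 0, the coefficient Φ^A((n, b)) is zero anyway. -/
theorem IsSimpleRootOn.pd_psiFamily_aux (h : IsSimpleRootOn a U ρ) (d : ℕ) {n b : ℤ} (hn : 0 ≤ n)
    (hb : ![n, b] ∉ natImage (curveMatrix a)) (j : Fin (m + 1)) {x : Fin (m + 1) → ℂ}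
    (hx : x ∈ U) :
    pd j (psiFamily a d ρ n b) x = ∑ i ∈ Finset.Icc (0 : ℤ) (d * n),
      (hyperPoly (curveMatrix a) ![n - 1, i - a j] x * (ρ x ^ (i - b) / ((i - b : ℤ) : ℂ))
        + hyperPoly (curveMatrix a) ![n, i] x * ρ x ^ i * (ρ x ^ (-b - 1) * pd j ρ x)) := by
  have hd : DifferentiableAt ℂ ρ x := (h.holomorphic x hx).differentiableAt
  have hne := h.ne_zero x hx
  have hz : ∀ c : ℤ, DifferentiableAt ℂ (fun y => ρ y ^ c) x := fun c => hd.zpow (Or.inl hne)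
  have hz' : ∀ c : ℤ, DifferentiableAt ℂ (fun y => ρ y ^ c / (c : ℂ)) x :=
    fun c => by simpa only [div_eq_mul_inv] using (hz c).mul_const _
  have hh : ∀ i, DifferentiableAt ℂ (hyperPoly (curveMatrix a) ![n, i]) x := fun i =>
    (hyperPoly_analytic a n i x trivial).differentiableAt
  rw [psiFamily, if_pos hn, pd_fun_sum _ _ fun i _ => (hh i).fun_mul (hz' (i - b))]
  refine Finset.sum_congr rfl fun i _ => ?_
  rw [pd_fun_mul j (hh i) (hz' _), pd_hyperPoly]
  simp only [div_eq_inv_mul]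
  rw [pd_const_mul _ _ (hz _), pd_zpow _ hne hd, add_comm]
  congr 1
  by_cases hib : i = b
  · rw [hib, hyperPoly_eq_zero hb]; simp
  · have h0 : ((i - b : ℤ) : ℂ) ≠ 0 := by exact_mod_cast sub_ne_zero.mpr hib
    rw [show i - b - 1 = i + (-b - 1) by ring, zpow_add₀ hne]
    field_simp

/-- For n ≥ 1 the boundary term from differentiating ρ is a multiple of f(ρ)^n = 0. For n = 0 that
factor is 1, and the boundary term is the first negative member. For n < 0 the rule is that of ρ^c
∂_0 ρ. -/
theorem IsSimpleRootOn.pd_psiFamily (hU : IsOpen U) (h : IsSimpleRootOn a U ρ) (ha0 : a 0 = 0)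
    {d : ℕ} (hd : ∀ j, a j ≤ d) (n b : ℤ) (hb : ![n, b] ∉ natImage (curveMatrix a))
    (j : Fin (m + 1)) (x : Fin (m + 1) → ℂ) (hx : x ∈ U) :
    pd j (psiFamily a d ρ n b) x = psiFamily a d ρ (n - 1) (b - a j) x := by
  have hne := h.ne_zero x hx
  rcases lt_or_ge n 0 with hn | hn
  · rw [psiFamily, psiFamily, if_neg (by omega), if_neg (by omega)]
    have hz : ∀ c : ℤ, AnalyticOnNhd ℂ (fun x => ρ x ^ c * pd 0 ρ x) U := fun c =>
      AnalyticOnNhd.mul (fun x hx => (h.holomorphic x hx).fun_zpow (h.ne_zero x hx))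
        (pd_analytic 0 h.holomorphic)
    rw [pd_iter_comm hU (hz _) _ _ _ hx,
      show (-(n - 1) - 1).toNat = (-n - 1).toNat + 1 by omega, Function.iterate_succ_apply]
    refine pd_iter_congr hU 0 _ (fun y hy => ?_) hx
    rw [h.pd_zpow_mul hU ha0 _ j hy, show -(b - (a j : ℤ)) - 1 = -b - 1 + a j by ring]
  rw [h.pd_psiFamily_aux d hn hb j hx, Finset.sum_add_distrib, ← Finset.sum_mul,
    sum_Icc_hyperPoly_mul_zpow hd hn, h.root x hx]
  -- For n = 0 the polynomial part drops out, leaving ρ^{-b-1} ∂_j ρ = ρ^{a_j-b-1} ∂_0 ρ.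
  rcases hn.eq_or_lt with rfl | hn
  · rw [psiFamily, if_neg (by omega), show -(0 - 1 : ℤ) - 1 = 0 by ring, Int.toNat_zero,
      Function.iterate_zero, id, h.pd_eq hU ha0 hx j,
      show -(b - (a j : ℤ)) - 1 = -b - 1 + a j by ring, zpow_add₀ hne, zpow_natCast,
      Finset.sum_eq_zero]
    · simp; ring
    · intro i _
      rw [hyperPoly_of_neg a (by omega)]; simp
  · rw [zero_pow (by omega), zero_div, zero_mul, add_zero, psiFamily, if_pos (by omega)]
    rw [← sum_Icc_sub (d := d) (k := a j) (by positivity) (by exact_mod_cast hd j)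
      (g := fun i => hyperPoly (curveMatrix a) ![n - 1, i] x
        * (ρ x ^ (i - (b - a j)) / ((i - (b - a j) : ℤ) : ℂ)))]
    · refine Finset.sum_congr rfl fun i _ => ?_
      rw [show i - (a j : ℤ) - (b - a j) = i - b by ring]
    · intro i hi
      rw [hyperPoly_eq_zero_of_notMem_Icc a hd hi, Pi.zero_apply, zero_mul]

theorem IsSimpleRootOn.psiFamily_euler_fst (hU : IsOpen U) (h : IsSimpleRootOn a U ρ)
    (ha0 : a 0 = 0) (d : ℕ) {n b : ℤ} (hn : 0 ≤ n) (hb : ![n, b] ∉ natImage (curveMatrix a))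
    {x : Fin (m + 1) → ℂ} (hx : x ∈ U) :
    ∑ j, x j * pd j (psiFamily a d ρ n b) x = n * psiFamily a d ρ n b x := by
  simp only [fun j => h.pd_psiFamily_aux d hn hb j hx, Finset.mul_sum]
  rw [Finset.sum_comm, psiFamily, if_pos hn, Finset.mul_sum]
  refine Finset.sum_congr rfl fun i _ => ?_
  have h1 := sum_mul_hyperPoly_fst a n i x
  have h2 := h.euler_fst hU ha0 hx
  calc _ = (∑ j, x j * hyperPoly (curveMatrix a) ![n - 1, i - a j] x)
          * (ρ x ^ (i - b) / ((i - b : ℤ) : ℂ))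
        + hyperPoly (curveMatrix a) ![n, i] x * ρ x ^ i * ρ x ^ (-b - 1) * ∑ j, x j * pd j ρ x := by
        rw [Finset.sum_mul, Finset.mul_sum, ← Finset.sum_add_distrib]
        exact Finset.sum_congr rfl fun j _ => by ring
    _ = _ := by rw [h1, h2]; ring

/-- The second Euler operator multiplies Φ^A((n, i)) by i and ρ by -1, so each summand has
eigenvalue i - (i - b) = b. -/
theorem IsSimpleRootOn.psiFamily_euler_snd (hU : IsOpen U) (h : IsSimpleRootOn a U ρ)
    (ha0 : a 0 = 0) (d : ℕ) {n b : ℤ} (hn : 0 ≤ n) (hb : ![n, b] ∉ natImage (curveMatrix a))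
    {x : Fin (m + 1) → ℂ} (hx : x ∈ U) :
    ∑ j, (a j : ℂ) * x j * pd j (psiFamily a d ρ n b) x = b * psiFamily a d ρ n b x := by
  simp only [fun j => h.pd_psiFamily_aux d hn hb j hx, Finset.mul_sum]
  rw [Finset.sum_comm, psiFamily, if_pos hn, Finset.mul_sum]
  refine Finset.sum_congr rfl fun i _ => ?_
  have h1 := sum_mul_hyperPoly_snd a n i x
  have h2 := h.euler_snd hU ha0 hx
  have hne := h.ne_zero x hx
  calc _ = (∑ j, (a j : ℂ) * x j * hyperPoly (curveMatrix a) ![n - 1, i - a j] x)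
          * (ρ x ^ (i - b) / ((i - b : ℤ) : ℂ))
        + hyperPoly (curveMatrix a) ![n, i] x * ρ x ^ i * ρ x ^ (-b - 1)
          * ∑ j, (a j : ℂ) * x j * pd j ρ x := by
        rw [Finset.sum_mul, Finset.mul_sum, ← Finset.sum_add_distrib]
        exact Finset.sum_congr rfl fun j _ => by ring
    _ = _ := by
        rw [h1, h2]
        by_cases hib : i = b
        · rw [hib, hyperPoly_eq_zero hb]; simp
        · have h0 : ((i : ℂ) - b) ≠ 0 := by exact_mod_cast sub_ne_zero.mpr hib
          have e : ρ x ^ (i - b) = ρ x ^ i * ρ x ^ (-b - 1) * ρ x := by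
            rw [← zpow_add₀ hne, ← zpow_add_one₀ hne]; congr 1; ring
          rw [e]
          push_cast
          field_simp
          ring

theorem IsSimpleRootOn.isHypergeometricOn_psiFamily (hU : IsOpen U) (h : IsSimpleRootOn a U ρ)
    (ha0 : a 0 = 0) {d : ℕ} (hd : ∀ j, a j ≤ d) {α : Fin 2 → ℤ}
    (hα : α ∉ natImage (curveMatrix a)) (hα0 : 0 ≤ α 0) :
    IsHypergeometricOn (curveMatrix a) (fun i => (α i : ℂ)) U (psiFamily a d ρ (α 0) (α 1)) := by
  have hα' : ![α 0, α 1] ∉ natImage (curveMatrix a) := by rwa [vec_eta]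
  exact isHypergeometricOn_of_family hU (h.pd_psiFamily hU ha0 hd) hα (h.psiFamily_analytic d _ _)
    (fun x hx => h.psiFamily_euler_fst hU ha0 d hα0 hα' hx)
    (fun x hx => h.psiFamily_euler_snd hU ha0 d hα0 hα' hx)

end root

/-! ### The rational solution Ψ_0 -/

section bigPsi

variable {m : ℕ} {a : Fin (m + 2) → ℕ}

theorem hasFDerivAt_comp_tail {r : ℕ} {F : (Fin r → ℂ) → ℂ} {x : Fin (r + 1) → ℂ}
    (hF : DifferentiableAt ℂ F fun j => x j.succ) :
    HasFDerivAt (fun y : Fin (r + 1) → ℂ => F fun j => y j.succ)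
      ((fderiv ℂ F fun j => x j.succ).comp
        (ContinuousLinearMap.pi fun j : Fin r => ContinuousLinearMap.proj j.succ)) x :=
  hF.hasFDerivAt.comp x
    (ContinuousLinearMap.pi fun j : Fin r =>
      ContinuousLinearMap.proj (R := ℂ) (φ := fun _ : Fin (r + 1) => ℂ) j.succ).hasFDerivAt

theorem pd_succ_comp_tail {r : ℕ} {F : (Fin r → ℂ) → ℂ} {x : Fin (r + 1) → ℂ}
    (hF : DifferentiableAt ℂ F fun j => x j.succ) (j : Fin r) :
    pd j.succ (fun y => F fun j => y j.succ) x = pd j F fun j => x j.succ := by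
  rw [pd, (hasFDerivAt_comp_tail hF).fderiv, pd, ContinuousLinearMap.comp_apply]
  congr 1
  funext i
  simp [Pi.single_apply]

theorem pd_zero_comp_tail {r : ℕ} {F : (Fin r → ℂ) → ℂ} {x : Fin (r + 1) → ℂ}
    (hF : DifferentiableAt ℂ F fun j => x j.succ) :
    pd 0 (fun y => F fun j => y j.succ) x = 0 := by
  rw [pd, (hasFDerivAt_comp_tail hF).fderiv, ContinuousLinearMap.comp_apply]
  have : (ContinuousLinearMap.pi fun j : Fin r => ContinuousLinearMap.proj (R := ℂ)
      (φ := fun _ : Fin (r + 1) => ℂ) j.succ) (Pi.single 0 1) = 0 := by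
    funext i
    simp
  rw [this, map_zero]

/-- The terms of the sum defining `bigPsi0`. -/
noncomputable def bigPsiTerm (a : Fin (m + 2) → ℕ) (k : ℕ) (n b : ℤ) (x : Fin (m + 2) → ℂ) : ℂ :=
  (-1) ^ (k + 1) * (Nat.factorial k : ℂ) * hyperPoly (matC a) ![n + (k + 1), b] (fun j => x j.succ)
    / x 0 ^ (k + 1)

theorem natImage_matC_subset : natImage (matC a) ⊆ natImage (curveMatrix a) := by
  rintro β ⟨u, hu⟩
  rw [← vec_eta β, matC, curveMatrix_mulVec_eq_iff] at hu
  rw [mem_natImage_curveMatrix]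
  exact ⟨Fin.cons 0 u, by simpa [Fin.sum_univ_succ] using hu⟩

/-- Every column of C has second entry at least 1; this is why the sum for Ψ_0 is finite. -/
theorem hyperPoly_matC_eq_zero (ha : ∀ j, j ≠ 0 → 0 < a j) {n b : ℤ} (h : b < n) :
    hyperPoly (matC a) ![n, b] = 0 := by
  apply hyperPoly_eq_zero
  rintro ⟨u, hu⟩
  rw [matC, curveMatrix_mulVec_eq_iff] at hu
  have : ∑ j, u j ≤ ∑ j, u j * a j.succ :=
    Finset.sum_le_sum fun j _ => Nat.le_mul_of_pos_right _ (ha _ j.succ_ne_zero)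
  omega

theorem bigPsi0_eq_sum (ha : ∀ j, j ≠ 0 → 0 < a j) {n b : ℤ} {K : ℕ} (hK : b ≤ n + K) :
    bigPsi0 a ![n, b] = fun x => ∑ k ∈ Finset.range K, bigPsiTerm a k n b x := by
  funext x
  have hvec : ∀ k : ℕ, ![n, b] + ((k + 1 : ℕ) : ℤ) • ![1, 0] = ![n + (k + 1), b] := by
    intro k; funext i; fin_cases i <;> simp
  simp only [bigPsi0, hvec]
  refine finsum_eq_sum_of_support_subset _ fun k hk => ?_
  by_contra hc
  refine hk ?_
  have : K ≤ k := by simpa using hc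
  simp only
  rw [hyperPoly_matC_eq_zero ha (by omega)]
  simp

variable {x : Fin (m + 2) → ℂ}

theorem bigPsiTerm_analyticAt (hx : x 0 ≠ 0) (k : ℕ) (n b : ℤ) :
    AnalyticAt ℂ (bigPsiTerm a k n b) x := by
  have h0 : AnalyticAt ℂ (fun y : Fin (m + 2) → ℂ => y 0) x :=
    (ContinuousLinearMap.proj (R := ℂ) (φ := fun _ : Fin (m + 2) => ℂ) 0).analyticAt x
  have h1 : AnalyticAt ℂ (fun y : Fin (m + 2) → ℂ =>
      hyperPoly (matC a) ![n + (k + 1), b] (fun j => y j.succ)) x :=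
    AnalyticAt.comp (g := hyperPoly (matC a) ![n + (k + 1), b])
      (hyperPoly_analytic _ _ _ _ trivial)
      ((ContinuousLinearMap.pi fun j : Fin (m + 1) =>
        ContinuousLinearMap.proj (R := ℂ) (φ := fun _ : Fin (m + 2) => ℂ) j.succ).analyticAt x)
  exact (analyticAt_const.mul h1).div (h0.pow _) (pow_ne_zero _ hx)

theorem pd_succ_bigPsiTerm (hx : x 0 ≠ 0) (k : ℕ) (n b : ℤ) (j : Fin (m + 1)) :
    pd j.succ (bigPsiTerm a k n b) x = bigPsiTerm a k (n - 1) (b - a j.succ) x := by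
  have hd : DifferentiableAt ℂ (hyperPoly (matC a) ![n + (k + 1), b]) fun j => x j.succ :=
    (hyperPoly_analytic _ _ _ _ trivial).differentiableAt
  have hd' := (hasFDerivAt_comp_tail hd).differentiableAt
  have hz : DifferentiableAt ℂ (fun y : Fin (m + 2) → ℂ => y 0) x := by fun_prop
  have hz' : DifferentiableAt ℂ (fun y : Fin (m + 2) → ℂ => y 0 ^ (-(k + 1 : ℕ) : ℤ)) x :=
    hz.zpow (Or.inl hx)
  have e : ∀ n b, bigPsiTerm a k n b = fun y => (-1) ^ (k + 1) * (Nat.factorial k : ℂ)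
      * (hyperPoly (matC a) ![n + (k + 1), b] (fun j => y j.succ)
        * y 0 ^ (-(k + 1 : ℕ) : ℤ)) := by
    intro n b
    funext y
    rw [bigPsiTerm, zpow_neg, zpow_natCast]
    ring
  rw [e, e, pd_const_mul _ _ (hd'.fun_mul hz'), pd_fun_mul _ hd' hz', pd_zpow _ hx hz, pd_coord,
    pd_succ_comp_tail hd, matC, pd_hyperPoly, if_neg j.succ_ne_zero.symm,
    show n + (k + 1) - 1 = n - 1 + (k + 1 : ℤ) by ring]
  ring

theorem pd_zero_bigPsiTerm (hx : x 0 ≠ 0) (k : ℕ) (n b : ℤ) :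
    x 0 * pd 0 (bigPsiTerm a k n b) x = -(k + 1) * bigPsiTerm a k n b x := by
  have hd : DifferentiableAt ℂ (hyperPoly (matC a) ![n + (k + 1), b]) fun j => x j.succ :=
    (hyperPoly_analytic _ _ _ _ trivial).differentiableAt
  have hd' := (hasFDerivAt_comp_tail hd).differentiableAt
  have hz : DifferentiableAt ℂ (fun y : Fin (m + 2) → ℂ => y 0) x := by fun_prop
  have hz' : DifferentiableAt ℂ (fun y : Fin (m + 2) → ℂ => y 0 ^ (-(k + 1 : ℕ) : ℤ)) x :=
    hz.zpow (Or.inl hx)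
  have e : bigPsiTerm a k n b = fun y => (-1) ^ (k + 1) * (Nat.factorial k : ℂ)
      * (hyperPoly (matC a) ![n + (k + 1), b] (fun j => y j.succ)
        * y 0 ^ (-(k + 1 : ℕ) : ℤ)) := by
    funext y
    rw [bigPsiTerm, zpow_neg, zpow_natCast]
    ring
  rw [e, pd_const_mul _ _ (hd'.fun_mul hz'), pd_fun_mul _ hd' hz', pd_zpow _ hx hz, pd_coord,
    pd_zero_comp_tail hd, if_pos rfl, zpow_sub_one₀ hx]
  push_cast
  field_simp
  ring

theorem pd_zero_bigPsiTerm_eq (hx : x 0 ≠ 0) (k : ℕ) (n b : ℤ) :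
    pd 0 (bigPsiTerm a k n b) x = bigPsiTerm a (k + 1) (n - 1) b x := by
  apply mul_left_cancel₀ hx
  rw [pd_zero_bigPsiTerm hx, bigPsiTerm, bigPsiTerm,
    show n - 1 + ((k + 1 : ℕ) + 1 : ℤ) = n + (k + 1) by push_cast; ring, Nat.factorial_succ]
  push_cast
  field_simp
  ring

theorem bigPsiTerm_zero {n b : ℤ} (h : ![n, b] ∉ natImage (curveMatrix a)) :
    bigPsiTerm a 0 (n - 1) b x = 0 := by
  rw [bigPsiTerm, show n - 1 + ((0 : ℕ) + 1 : ℤ) = n by simp,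
    hyperPoly_eq_zero fun hc => h (natImage_matC_subset hc)]
  simp

/-- ∂_0 sends term k to term k + 1, so the result lacks only the term k = 0 of the target, which is
a multiple of Φ^C((n, b)) = 0 off the semigroup. The other derivatives act termwise. -/
theorem pd_bigPsi0 (ha0 : a 0 = 0) (ha : ∀ j, j ≠ 0 → 0 < a j) {n b : ℤ}
    (h : ![n, b] ∉ natImage (curveMatrix a)) (j : Fin (m + 2)) (hx : x 0 ≠ 0) :
    pd j (bigPsi0 a ![n, b]) x = bigPsi0 a ![n - 1, b - a j] x := by
  obtain ⟨K, hK⟩ : ∃ K : ℕ, b ≤ n + K := ⟨(b - n).toNat, by omega⟩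
  rw [bigPsi0_eq_sum ha hK,
    pd_fun_sum _ _ fun k _ => (bigPsiTerm_analyticAt hx k n b).differentiableAt]
  refine Fin.cases ?_ (fun j => ?_) j
  · rw [ha0, bigPsi0_eq_sum ha (K := K + 1) (by push_cast; omega)]
    beta_reduce
    rw [Finset.sum_range_succ', Nat.cast_zero, sub_zero, bigPsiTerm_zero h, add_zero]
    exact Finset.sum_congr rfl fun k _ => pd_zero_bigPsiTerm_eq hx k n b
  · have := ha _ j.succ_ne_zero
    rw [bigPsi0_eq_sum ha (K := K) (by omega)]
    exact Finset.sum_congr rfl fun k _ => pd_succ_bigPsiTerm hx k n b j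

theorem bigPsi0_analyticAt (ha : ∀ j, j ≠ 0 → 0 < a j) (n b : ℤ) (hx : x 0 ≠ 0) :
    AnalyticAt ℂ (bigPsi0 a ![n, b]) x := by
  rw [bigPsi0_eq_sum ha (K := (b - n).toNat) (by omega)]
  exact Finset.analyticAt_fun_sum _ fun k _ => bigPsiTerm_analyticAt hx k n b

theorem bigPsi0_euler_fst (ha : ∀ j, j ≠ 0 → 0 < a j) (n b : ℤ) (hx : x 0 ≠ 0) :
    ∑ j, x j * pd j (bigPsi0 a ![n, b]) x = n * bigPsi0 a ![n, b] x := by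
  rw [bigPsi0_eq_sum ha (K := (b - n).toNat) (by omega)]
  simp only [fun j => pd_fun_sum (Finset.range (b - n).toNat) j
    fun k _ => (bigPsiTerm_analyticAt (a := a) hx k n b).differentiableAt, Finset.mul_sum]
  rw [Finset.sum_comm]
  refine Finset.sum_congr rfl fun k _ => ?_
  rw [Fin.sum_univ_succ, pd_zero_bigPsiTerm hx]
  simp only [pd_succ_bigPsiTerm hx]
  have := sum_mul_hyperPoly_fst (fun j : Fin (m + 1) => a j.succ) (n + (k + 1)) b
    fun j => x j.succ
  have h2 : ∑ j : Fin (m + 1), x j.succ * bigPsiTerm a k (n - 1) (b - a j.succ) x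
      = ((n : ℂ) + (k + 1)) * bigPsiTerm a k n b x := by
    simp only [bigPsiTerm, matC, show n - 1 + (k + 1 : ℤ) = n + (k + 1) - 1 by ring]
    rw [← mul_div_assoc, ← mul_assoc, mul_comm _ ((-1) ^ (k + 1) * (Nat.factorial k : ℂ)), mul_assoc]
    push_cast at this
    rw [← this, Finset.mul_sum, Finset.sum_div]
    exact Finset.sum_congr rfl fun j _ => by ring
  rw [h2]
  ring

theorem bigPsi0_euler_snd (ha0 : a 0 = 0) (ha : ∀ j, j ≠ 0 → 0 < a j) (n b : ℤ) (hx : x 0 ≠ 0) :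
    ∑ j, (a j : ℂ) * x j * pd j (bigPsi0 a ![n, b]) x = b * bigPsi0 a ![n, b] x := by
  rw [bigPsi0_eq_sum ha (K := (b - n).toNat) (by omega)]
  simp only [fun j => pd_fun_sum (Finset.range (b - n).toNat) j
    fun k _ => (bigPsiTerm_analyticAt (a := a) hx k n b).differentiableAt, Finset.mul_sum]
  rw [Finset.sum_comm]
  refine Finset.sum_congr rfl fun k _ => ?_
  rw [Fin.sum_univ_succ, ha0, Nat.cast_zero, zero_mul, zero_mul, zero_add]
  simp only [pd_succ_bigPsiTerm hx]
  have := sum_mul_hyperPoly_snd (fun j : Fin (m + 1) => a j.succ) (n + (k + 1)) b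
    fun j => x j.succ
  simp only [bigPsiTerm, matC, show n - 1 + (k + 1 : ℤ) = n + (k + 1) - 1 by ring]
  rw [← mul_div_assoc, ← mul_assoc, mul_comm _ ((-1) ^ (k + 1) * (Nat.factorial k : ℂ)), mul_assoc,
    ← this, Finset.mul_sum, Finset.sum_div]
  exact Finset.sum_congr rfl fun j _ => by ring

theorem isHypergeometricOn_bigPsi0 (ha0 : a 0 = 0) (ha : ∀ j, j ≠ 0 → 0 < a j)
    {U : Set (Fin (m + 2) → ℂ)} (hU : IsOpen U) (hU0 : ∀ x ∈ U, x 0 ≠ 0)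
    {α : Fin 2 → ℤ} (hα : α ∉ natImage (curveMatrix a)) :
    IsHypergeometricOn (curveMatrix a) (fun i => (α i : ℂ)) U (bigPsi0 a α) := by
  have := isHypergeometricOn_of_family (G := fun n b => bigPsi0 a ![n, b]) hU
    (fun n b h j x hx => pd_bigPsi0 ha0 ha h j (hU0 x hx)) hα
    (fun x hx => bigPsi0_analyticAt ha _ _ (hU0 x hx))
    (fun x hx => bigPsi0_euler_fst ha _ _ (hU0 x hx))
    (fun x hx => bigPsi0_euler_snd ha0 ha _ _ (hU0 x hx))
  rwa [vec_eta] at this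

end bigPsi

/-! ### Translates of α that enter the semigroup -/

section semigroup

theorem exists_forall_ge_eq_sum {r : ℕ} (a : Fin r → ℕ) (hgcd : Finset.univ.gcd a = 1) :
    ∃ N, ∀ e ≥ N, ∃ u : Fin r → ℕ, ∑ j, u j * a j = e := by
  obtain ⟨N, hN⟩ := Nat.exists_mem_closure_of_ge (s := Set.range a)
  refine ⟨N, fun e he => ?_⟩
  have h1 : Nat.setGcd (Set.range a) ∣ e := by
    have : Nat.setGcd (Set.range a) ∣ 1 := by
      rw [← hgcd]
      exact Finset.dvd_gcd fun j _ => Nat.setGcd_dvd_of_mem ⟨j, rfl⟩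
    exact this.trans (one_dvd e)
  have hmem := hN e he h1
  clear he h1
  induction hmem using AddSubmonoid.closure_induction with
  | mem x hx =>
    obtain ⟨j, rfl⟩ := hx
    exact ⟨Pi.single j 1, by simp [Pi.single_apply]⟩
  | zero => exact ⟨0, by simp⟩
  | add x y _ _ hx hy =>
    obtain ⟨u, rfl⟩ := hx
    obtain ⟨v, rfl⟩ := hy
    exact ⟨u + v, by simp [add_mul, Finset.sum_add_distrib]⟩

variable {m : ℕ} {a : Fin (m + 2) → ℕ} {α : Fin 2 → ℤ}

theorem exists_sum_add_single {r : ℕ} {a : Fin r → ℕ} (u : Fin r → ℕ) (j : Fin r) (k : ℕ) :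
    ∃ v : Fin r → ℕ, ∑ i, v i = ∑ i, u i + k ∧ ∑ i, v i * a i = ∑ i, u i * a i + k * a j :=
  ⟨u + Pi.single j k, by simp [Finset.sum_add_distrib],
    by simp [add_mul, Finset.sum_add_distrib, Pi.single_apply]⟩

theorem exists_of_mem_setE0 (ha0 : a 0 = 0) (hα : α ∈ setE0 a) :
    ∃ N : ℕ, ∀ n ≥ N, ∃ u : Fin (m + 2) → ℕ, ((∑ j, u j : ℕ) : ℤ) = α 0 + n ∧
      ((∑ j, u j * a j : ℕ) : ℤ) = α 1 := by
  obtain ⟨⟨β, hβ, N, rfl⟩, -⟩ := hα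
  obtain ⟨u, hu0, hu1⟩ := (mem_natImage_curveMatrix a β).mp (natImage_matC_subset hβ)
  refine ⟨N, fun n hn => ?_⟩
  obtain ⟨v, hv0, hv1⟩ := exists_sum_add_single (a := a) u 0 (n - N)
  refine ⟨v, ?_, ?_⟩
  · have e : (β - (N : ℤ) • ![1, 0] : Fin 2 → ℤ) 0 = β 0 - N := by simp
    rw [hv0, e]; push_cast [Nat.cast_sub hn] at hu0 ⊢; linarith
  · have e : (β - (N : ℤ) • ![1, 0] : Fin 2 → ℤ) 1 = β 1 := by simp
    rw [hv1, ha0, mul_zero, add_zero, e, hu1]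

theorem exists_of_mem_setEd (hα : α ∈ setEd a) :
    ∃ N : ℕ, ∀ n ≥ N, ∃ u : Fin (m + 2) → ℕ, ((∑ j, u j : ℕ) : ℤ) = α 0 + n ∧
      ((∑ j, u j * a j : ℕ) : ℤ) = α 1 + (deg a * n : ℕ) := by
  obtain ⟨⟨β, ⟨w, hw⟩, N, rfl⟩, -⟩ := hα
  rw [← vec_eta β, matB, curveMatrix_mulVec_eq_iff] at hw
  refine ⟨N, fun n hn => ?_⟩
  obtain ⟨v, hv0, hv1⟩ := exists_sum_add_single (a := a) (Fin.snoc w 0) (Fin.last _) (n - N)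
  refine ⟨v, ?_, ?_⟩
  · have e : (β - (N : ℤ) • ![1, (deg a : ℤ)] : Fin 2 → ℤ) 0 = β 0 - N := by simp
    rw [hv0, e, ← hw.1]
    simp only [Fin.sum_univ_castSucc (n := m + 1), Fin.snoc_castSucc, Fin.snoc_last, add_zero]
    push_cast [Nat.cast_sub hn]
    ring
  · have e : (β - (N : ℤ) • ![1, (deg a : ℤ)] : Fin 2 → ℤ) 1 = β 1 - N * deg a := by simp
    rw [hv1, e, ← hw.2]
    simp only [Fin.sum_univ_castSucc (n := m + 1), Fin.snoc_castSucc, Fin.snoc_last, zero_mul,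
      add_zero]
    push_cast [Nat.cast_sub hn]
    ring

/-- Membership in E_0 gives 0 ≤ α 1 and membership in E_d gives α 1 ≤ d α 0. -/
theorem fst_nonneg_of_mem_setE (ha0 : a 0 = 0) (hd : ∀ j, a j ≤ deg a) (hpos : 0 < deg a)
    (hα : α ∈ setE a) : 0 ≤ α 0 := by
  obtain ⟨N, hN⟩ := exists_of_mem_setE0 ha0 hα.1
  obtain ⟨u, -, hu⟩ := hN N le_rfl
  obtain ⟨N', hN'⟩ := exists_of_mem_setEd hα.2
  obtain ⟨v, hv0, hv1⟩ := hN' N' le_rfl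
  have h1 : ∑ j, v j * a j ≤ deg a * ∑ j, v j := by
    rw [Finset.mul_sum]
    exact Finset.sum_le_sum fun j _ => by rw [mul_comm]; exact Nat.mul_le_mul_right _ (hd j)
  have h2 : ((∑ j, v j * a j : ℕ) : ℤ) ≤ deg a * ((∑ j, v j : ℕ) : ℤ) := by exact_mod_cast h1
  rw [hv0, hv1] at h2
  push_cast at h2
  have h3 : 0 ≤ α 1 := hu ▸ Int.natCast_nonneg _
  have h4 : 0 ≤ (deg a : ℤ) * α 0 := by linarith
  exact nonneg_of_mul_nonneg_right h4 (by exact_mod_cast hpos)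

/-- All large integers are sums of the a_j, and copies of a_0 = 0 raise the first coordinate at
will. -/
theorem exists_of_gcd_eq_one (ha0 : a 0 = 0) (hgcd : Finset.univ.gcd a = 1) (α : Fin 2 → ℤ) :
    ∃ N : ℕ, ∀ b ≥ N, ∃ n : ℕ, 0 < n ∧ ∃ u : Fin (m + 2) → ℕ, ((∑ j, u j : ℕ) : ℤ) = α 0 + n ∧
      ((∑ j, u j * a j : ℕ) : ℤ) = α 1 + b := by
  obtain ⟨N, hN⟩ := exists_forall_ge_eq_sum a hgcd
  refine ⟨N + (α 1).natAbs, fun b hb => ?_⟩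
  obtain ⟨u, hu⟩ := hN (α 1 + b).toNat (by omega)
  obtain ⟨v, hv0, hv1⟩ := exists_sum_add_single (a := a) u 0 (1 + (α 0).natAbs)
  refine ⟨((∑ j, v j : ℕ) - α 0).toNat, by omega, v, by omega, ?_⟩
  rw [hv1, ha0, hu]
  omega

end semigroup

/-! ### Functions killed by a power of one partial derivative -/

section line

theorem exists_coeff_of_pd_iter {r : ℕ} {U : Set (Fin r → ℂ)} (p : Fin r → ℂ) (j : Fin r)
    {B : Set ℂ} (hB : IsOpen B) (hc : IsPreconnected B)
    (hBU : ∀ z ∈ B, Function.update p j z ∈ U) (n : ℕ) {F : (Fin r → ℂ) → ℂ}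
    (hF : AnalyticOnNhd ℂ F U) (h : ∀ x ∈ U, (pd j)^[n] F x = 0) :
    ∃ e : ℕ → ℂ, ∀ z ∈ B, F (Function.update p j z) = ∑ i ∈ Finset.range n, e i * z ^ i := by
  induction n generalizing F with
  | zero => exact ⟨0, fun z hz => by simpa using h _ (hBU z hz)⟩
  | succ n ih =>
    obtain ⟨e, he⟩ := ih (pd_analytic j hF) h
    have hl : ∀ z ∈ B, HasDerivAt (fun z => F (Function.update p j z))
        (pd j F (Function.update p j z)) z := fun z hz =>
      (hF _ (hBU z hz)).differentiableAt.hasFDerivAt.comp_hasDerivAt z (hasDerivAt_update p j z)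
    have hq : ∀ z, HasDerivAt (fun z => ∑ i ∈ Finset.range n, e i / (i + 1) * z ^ (i + 1))
        (∑ i ∈ Finset.range n, e i * z ^ i) z := fun z => by
      refine HasDerivAt.fun_sum fun i _ => ?_
      have hi : (i + 1 : ℂ) ≠ 0 := by exact_mod_cast i.succ_ne_zero
      refine ((hasDerivAt_pow (i + 1) z).const_mul (e i / (i + 1))).congr_deriv ?_
      rw [Nat.add_sub_cancel]
      push_cast
      field_simp
    have hdiff : ∀ z ∈ B, HasDerivAt (fun z => F (Function.update p j z)
        - ∑ i ∈ Finset.range n, e i / (i + 1) * z ^ (i + 1)) 0 z := fun z hz => by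
      have := (hl z hz).fun_sub (hq z)
      rwa [he z hz, sub_self] at this
    obtain ⟨c, hc⟩ := hB.exists_is_const_of_deriv_eq_zero hc
      (fun z hz => (hdiff z hz).differentiableAt.differentiableWithinAt)
      (fun z hz => (hdiff z hz).deriv)
    -- Coefficients of the termwise primitive, with the integration constant c in degree 0.
    refine ⟨fun i => Nat.casesOn i c fun i => e i / (i + 1), fun z hz => ?_⟩
    rw [Finset.sum_range_succ']
    have := hc z hz
    simp only [pow_zero, mul_one]
    linear_combination this

theorem exists_polynomial_of_pd_iter {r : ℕ} {U : Set (Fin r → ℂ)} (p : Fin r → ℂ) (j : Fin r)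
    {B : Set ℂ} (hB : IsOpen B) (hc : IsPreconnected B)
    (hBU : ∀ z ∈ B, Function.update p j z ∈ U) (n : ℕ) {F : (Fin r → ℂ) → ℂ}
    (hF : AnalyticOnNhd ℂ F U) (h : ∀ x ∈ U, (pd j)^[n] F x = 0) :
    ∃ P : Polynomial ℂ, P.degree < n ∧ ∀ z ∈ B, F (Function.update p j z) = P.eval z := by
  obtain ⟨e, he⟩ := exists_coeff_of_pd_iter p j hB hc hBU n hF h
  refine ⟨∑ i ∈ Finset.range n, Polynomial.C (e i) * Polynomial.X ^ i, ?_, fun z hz => ?_⟩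
  · refine (Polynomial.degree_sum_le _ _).trans_lt ((Finset.sup_lt_iff (WithBot.bot_lt_coe n)).mpr ?_)
    exact fun i hi => (Polynomial.degree_C_mul_X_pow_le _ _).trans_lt
      ((Nat.cast_lt (α := WithBot ℕ)).mpr (Finset.mem_range.mp hi))
  · rw [he z hz]
    simp [Polynomial.eval_finsetSum]

end line

/-! ### The interpolation identity and its degrees -/

section degree

open Polynomial

theorem natDegree_sum_C_mul_X_pow {ι : Type*} [Fintype ι] {c : ι → ℂ} {e : ι → ℕ} (l : ι)
    (hl : c l ≠ 0) (h : ∀ j, j ≠ l → c j = 0 ∨ e j < e l) :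
    (∑ j, C (c j) * X ^ e j).natDegree = e l := by
  apply natDegree_eq_of_le_of_coeff_ne_zero
  · refine natDegree_sum_le_of_forall_le _ _ fun j _ => ?_
    by_cases hj : j = l
    · rw [hj]; exact natDegree_C_mul_X_pow_le _ _
    · rcases h j hj with h | h
      · simp [h]
      · exact (natDegree_C_mul_X_pow_le _ _).trans h.le
  · rw [finsetSum_coeff, Finset.sum_eq_single l]
    · simpa using hl
    · intro j _ hj
      rw [coeff_C_mul_X_pow]
      rcases h j hj with h | h
      · simp [h]
      · rw [if_neg h.ne']
    · simp

variable {m : ℕ} (a : Fin (m + 2) → ℕ) (p : Fin (m + 2) → ℂ)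

/-- The coefficient of `t^k` in `(f(p; t) - f(p; u)) / (t - u)`, as a polynomial in `u`. -/
noncomputable def quotCoeff (k : ℕ) : ℂ[X] :=
  ∑ j, C (if k < a j then p j else 0) * X ^ (a j - 1 - k)

/-- The derivative of `f(p; t)`. -/
noncomputable def derivPoly : ℂ[X] := ∑ j, C (a j * p j) * X ^ (a j - 1)

/-- The polynomial `-(f(p; t) - p_0)`. -/
noncomputable def tailPoly : ℂ[X] := ∑ j, C (if j = 0 then 0 else -p j) * X ^ a j

variable {a p}

/-- The k-th summand has degree d - 1 - k modulo d, so no leading terms cancel. If c ≠ 0, the right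
side has degree d n + d - 1, which must come from k = 0 and forces deg P_0 = n, against the bound.
-/
theorem eq_zero_of_sum_quotCoeff_mul (ha : StrictMono a) (hd : 0 < deg a)
    (hp : p (Fin.last (m + 1)) ≠ 0) {n : ℕ} {P : ℕ → ℂ[X]} (hP : (P 0).degree < n) {c : ℂ}
    (h : ∑ k ∈ Finset.range (deg a), quotCoeff a p k * (P k).comp (tailPoly a p)
      = C c * X ^ (deg a * n) * derivPoly a p) : c = 0 := by
  have hlt : ∀ j, j ≠ Fin.last (m + 1) → a j < a (Fin.last (m + 1)) := fun j hj =>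
    ha (Fin.lt_last_iff_ne_last.mpr hj)
  have hS : ∀ k < deg a, (quotCoeff a p k).natDegree = deg a - 1 - k := fun k hk =>
    natDegree_sum_C_mul_X_pow (Fin.last (m + 1)) (by rw [if_pos hk]; exact hp) fun j hj => by
      have := hlt j hj
      have hk : k < a (Fin.last (m + 1)) := hk
      split_ifs with hkj
      · right; omega
      · exact Or.inl rfl
  have hT : (tailPoly a p).natDegree = deg a := natDegree_sum_C_mul_X_pow (Fin.last (m + 1))
    (by rw [if_neg (Fin.last_pos.ne')]; exact neg_ne_zero.mpr hp) fun j hj => Or.inr (hlt j hj)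
  have hDd : (derivPoly a p).natDegree = deg a - 1 := natDegree_sum_C_mul_X_pow (Fin.last (m + 1))
    (mul_ne_zero (by exact_mod_cast hd.ne') hp) fun j hj => by
      have := hlt j hj
      rcases Nat.eq_zero_or_pos (a j) with h0 | h0
      · simp [h0]
      · right; omega
  have hD : derivPoly a p ≠ 0 := by
    intro h0
    have h1 : (derivPoly a p).coeff (deg a - 1) = deg a * p (Fin.last (m + 1)) := by
      rw [derivPoly, finsetSum_coeff, Finset.sum_eq_single (Fin.last (m + 1))]
      · rw [coeff_C_mul_X_pow, if_pos rfl]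
      · intro j _ hj
        have := hlt j hj
        rw [coeff_C_mul_X_pow]
        rcases Nat.eq_zero_or_pos (a j) with h0 | h0
        · simp [h0]
        · rw [if_neg (show ¬ a (Fin.last (m + 1)) - 1 = a j - 1 by omega)]
      · simp
    rw [h0, coeff_zero, zero_eq_mul] at h1
    exact h1.elim (by exact_mod_cast hd.ne') hp
  have hdeg : ∀ k < deg a, quotCoeff a p k * (P k).comp (tailPoly a p) ≠ 0 →
      (quotCoeff a p k * (P k).comp (tailPoly a p)).natDegree
        = deg a - 1 - k + (P k).natDegree * deg a := by
    intro k hk hne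
    rw [natDegree_mul (left_ne_zero_of_mul hne) (right_ne_zero_of_mul hne), hS k hk, natDegree_comp,
      hT]
  by_contra hc
  have hR : (C c * X ^ (deg a * n) * derivPoly a p).degree
      = ((deg a * n + (deg a - 1) : ℕ) : WithBot ℕ) := by
    rw [degree_eq_natDegree (mul_ne_zero (mul_ne_zero (C_ne_zero.mpr hc) (by simp)) hD),
      natDegree_mul (mul_ne_zero (C_ne_zero.mpr hc) (by simp)) hD, natDegree_C_mul_X_pow _ _ hc, hDd]
  -- Nonzero summands have degrees distinct modulo d, so the degree of the sum is the largest of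
  -- them.
  have hsum := degree_sum_eq_of_disjoint
    (fun k => quotCoeff a p k * (P k).comp (tailPoly a p)) (Finset.range (deg a)) (by
      rintro k ⟨hk, hk0⟩ l ⟨hl, hl0⟩ hkl heq
      have hk := Finset.mem_range.mp hk
      have hl := Finset.mem_range.mp hl
      simp only [Function.comp_apply] at heq
      have := natDegree_eq_of_degree_eq heq
      rw [hdeg k hk hk0, hdeg l hl hl0] at this
      have := congrArg (· % deg a) this
      simp only [Nat.add_mul_mod_self_right] at this
      rw [Nat.mod_eq_of_lt (by omega), Nat.mod_eq_of_lt (by omega)] at this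
      omega)
  rw [h, hR] at hsum
  obtain ⟨k, hk, hk2⟩ := Finset.exists_mem_eq_sup (Finset.range (deg a)) ⟨0, by simpa using hd⟩
    fun k => (quotCoeff a p k * (P k).comp (tailPoly a p)).degree
  rw [← hsum] at hk2
  have hk := Finset.mem_range.mp hk
  have hne : quotCoeff a p k * (P k).comp (tailPoly a p) ≠ 0 := fun h0 => by
    rw [h0, degree_zero] at hk2
    exact WithBot.coe_ne_bot hk2
  have hn := natDegree_eq_of_degree_eq_some hk2.symm
  rw [hdeg k hk hne] at hn
  have hmod := congrArg (· % deg a) hn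
  simp only [Nat.add_mul_mod_self_right, Nat.mul_add_mod_self_left] at hmod
  rw [Nat.mod_eq_of_lt (by omega), Nat.mod_eq_of_lt (by omega)] at hmod
  obtain rfl : k = 0 := by omega
  have hP0 : P 0 ≠ 0 := fun h0 => hne (by simp [h0])
  rw [degree_eq_natDegree hP0] at hP
  have hP : (P 0).natDegree < n := by exact_mod_cast hP
  have : (P 0).natDegree * deg a = n * deg a := by
    rw [mul_comm n]; omega
  have := Nat.eq_of_mul_eq_mul_right hd this
  omega

theorem eval_quotCoeff (k : ℕ) (u : ℂ) : (quotCoeff a p k).eval u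
    = ∑ j, if k < a j then p j * u ^ (a j - 1 - k) else 0 := by
  rw [quotCoeff, eval_finsetSum]
  refine Finset.sum_congr rfl fun j _ => ?_
  split_ifs <;> simp

theorem sum_quotCoeff_mul_pow (hd : ∀ j, a j ≤ deg a) (u t : ℂ) :
    ∑ k ∈ Finset.range (deg a), (quotCoeff a p k).eval u * t ^ k
      = ∑ j, p j * ∑ k ∈ Finset.range (a j), t ^ k * u ^ (a j - 1 - k) := by
  simp only [eval_quotCoeff, Finset.sum_mul]
  rw [Finset.sum_comm]
  refine Finset.sum_congr rfl fun j _ => ?_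
  rw [Finset.mul_sum]
  symm
  rw [Finset.sum_subset_zero_on_sdiff (Finset.range_mono (hd j)) (fun k hk => ?_) (fun k hk => ?_)]
  · rw [if_neg (by simpa using (Finset.mem_sdiff.mp hk).2), zero_mul]
  · rw [if_pos (Finset.mem_range.mp hk)]; ring

theorem sum_quotCoeff_mul_pow_self (hd : ∀ j, a j ≤ deg a) (u : ℂ) :
    ∑ k ∈ Finset.range (deg a), (quotCoeff a p k).eval u * u ^ k = (derivPoly a p).eval u := by
  rw [sum_quotCoeff_mul_pow hd, derivPoly, eval_finsetSum]
  refine Finset.sum_congr rfl fun j _ => ?_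
  rw [Finset.sum_congr rfl fun k hk => show u ^ k * u ^ (a j - 1 - k) = u ^ (a j - 1) by
    rw [← pow_add]; congr 1; have := Finset.mem_range.mp hk; omega]
  simp
  ring

/-- The sum is the divided difference of f at t and u, which vanishes when f takes the same value at
distinct t and u. -/
theorem sum_quotCoeff_mul_pow_of_ne (hd : ∀ j, a j ≤ deg a) {u t : ℂ} (htu : t ≠ u)
    (h : ∑ j, p j * (t ^ a j - u ^ a j) = 0) :
    ∑ k ∈ Finset.range (deg a), (quotCoeff a p k).eval u * t ^ k = 0 := by
  apply mul_right_cancel₀ (sub_ne_zero.mpr htu)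
  rw [sum_quotCoeff_mul_pow hd, Finset.sum_mul, zero_mul, ← h]
  refine Finset.sum_congr rfl fun j _ => ?_
  rw [mul_assoc, geom_sum₂_mul]

end degree

/-! ### Linear independence of the solutions -/

section independence

theorem pd_iter_sum {r : ℕ} {U : Set (Fin r → ℂ)} (hU : IsOpen U) {ι : Type*} (s : Finset ι)
    (c : ι → ℂ) {F : ι → (Fin r → ℂ) → ℂ} (hF : ∀ i, AnalyticOnNhd ℂ (F i) U) (j : Fin r) (n : ℕ) :
    Set.EqOn ((pd j)^[n] fun x => ∑ i ∈ s, c i * F i x)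
      (fun x => ∑ i ∈ s, c i * (pd j)^[n] (F i) x) U := by
  induction n with
  | zero => exact fun _ _ => rfl
  | succ n ih =>
    intro x hx
    simp only [Function.iterate_succ_apply']
    have hd : ∀ i, DifferentiableAt ℂ ((pd j)^[n] (F i)) x := fun i =>
      (pd_iter_analytic j n (hF i) x hx).differentiableAt
    rw [pd_congr hU j ih hx, pd_fun_sum _ _ fun i _ => (hd i).const_mul (c i)]
    exact Finset.sum_congr rfl fun i _ => pd_const_mul j (c i) (hd i)

theorem hyperPoly_of_neg_snd {r : ℕ} (a : Fin r → ℕ) (n : ℤ) {i : ℤ} (hi : i < 0) :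
    hyperPoly (curveMatrix a) ![n, i] = 0 := by
  apply hyperPoly_eq_zero
  rintro ⟨u, hu⟩
  rw [curveMatrix_mulVec_eq_iff] at hu
  omega

/-- The member of index (-n, -b) is ∂_0^{n-1} of ρ^{b-1} ∂_0 ρ, and b times the latter is ∂_0 (ρ^b).
-/
theorem IsSimpleRootOn.natCast_mul_psiFamily {m : ℕ} {a : Fin (m + 1) → ℕ}
    {U : Set (Fin (m + 1) → ℂ)} {ρ : (Fin (m + 1) → ℂ) → ℂ} (hU : IsOpen U)
    (h : IsSimpleRootOn a U ρ) (d : ℕ) {n : ℕ} (hn : 0 < n) (b : ℕ) {x : Fin (m + 1) → ℂ}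
    (hx : x ∈ U) :
    b * psiFamily a d ρ (-n) (-b) x = (pd 0)^[n] (fun x => ρ x ^ b) x := by
  have han : AnalyticOnNhd ℂ (fun x => ρ x ^ ((b : ℤ) - 1) * pd 0 ρ x) U :=
    AnalyticOnNhd.mul (fun x hx => (h.holomorphic x hx).fun_zpow (h.ne_zero x hx))
      (pd_analytic 0 h.holomorphic)
  have h1 : Set.EqOn (pd 0 fun x => ρ x ^ b)
      (fun x => ∑ _i ∈ ({0} : Finset ℕ), (b : ℂ) * (ρ x ^ ((b : ℤ) - 1) * pd 0 ρ x)) U := by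
    intro y hy
    have := pd_zpow (F := ρ) b (h.ne_zero y hy) (h.holomorphic y hy).differentiableAt 0
    simp only [zpow_natCast, Int.cast_natCast] at this
    rw [this]
    simp [mul_assoc]
  obtain ⟨k, rfl⟩ : ∃ k, n = k + 1 := ⟨n - 1, by omega⟩
  rw [Function.iterate_succ_apply, pd_iter_congr hU 0 k h1 hx,
    pd_iter_sum hU _ (fun _ => (b : ℂ)) (fun _ => han) 0 k hx, psiFamily, if_neg (by omega),
    show (-(-((k + 1 : ℕ) : ℤ)) - 1).toNat = k by omega, neg_neg]
  simp

variable {m : ℕ} {a : Fin (m + 2) → ℕ} {α : Fin 2 → ℤ} {U : Set (Fin (m + 2) → ℂ)}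

theorem bigPsi0_neg_neg (ha : ∀ j, j ≠ 0 → 0 < a j) (n : ℕ) {b : ℕ} (hb : 0 < b) :
    bigPsi0 a ![-n, -b] = 0 := by
  rw [bigPsi0_eq_sum ha (K := n) (by omega)]
  funext x
  refine Finset.sum_eq_zero fun k _ => ?_
  rw [bigPsiTerm, matC, hyperPoly_of_neg_snd _ _ (by omega)]
  simp

/-- Only the term with Φ^C((0, 0)) = 1 survives, a nonzero multiple of x_0^{-n}. -/
theorem bigPsi0_neg_zero (ha : ∀ j, j ≠ 0 → 0 < a j) {n : ℕ} (hn : 0 < n)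
    {x : Fin (m + 2) → ℂ} (hx : x 0 ≠ 0) : bigPsi0 a ![-n, 0] x ≠ 0 := by
  obtain ⟨k, rfl⟩ : ∃ k, n = k + 1 := ⟨n - 1, by omega⟩
  rw [bigPsi0_eq_sum ha (K := k + 1) (by omega)]
  beta_reduce
  rw [Finset.sum_range_succ, Finset.sum_eq_zero, zero_add, bigPsiTerm, matC]
  · have h1 := hyperPoly_natCast (fun j : Fin (m + 1) => a j.succ) 0 0 fun j => x j.succ
    rw [show -((k + 1 : ℕ) : ℤ) + (k + 1) = (0 : ℕ) by push_cast; ring, h1]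
    simp [coefPow, Nat.factorial_ne_zero, hx]
  · intro i hi
    have := Finset.mem_range.mp hi
    rw [bigPsiTerm, matC, hyperPoly_of_neg _ (by push_cast; omega)]
    simp

variable {ρ : Fin (deg a) → (Fin (m + 2) → ℂ) → ℂ} {c : Fin (deg a) → ℂ} {c' : ℂ}

/-- Derivatives of a linear relation between the functions `psiFamily` and `bigPsi0`. -/
theorem relation_deriv (hU : IsOpen U) (ha0 : a 0 = 0) (ha : ∀ j, j ≠ 0 → 0 < a j)
    (hd : ∀ j, a j ≤ deg a) (hU0 : ∀ x ∈ U, x 0 ≠ 0) (hρ : ∀ i, IsSimpleRootOn a U (ρ i))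
    (hα : α ∉ natImage (curveMatrix a))
    (h : ∀ x ∈ U, ∑ i, c i * psiFamily a (deg a) (ρ i) (α 0) (α 1) x + c' * bigPsi0 a α x = 0)
    {n b : ℤ} {u : Fin (m + 2) → ℕ} (hu0 : ((∑ j, u j : ℕ) : ℤ) = α 0 + n)
    (hu1 : ((∑ j, u j * a j : ℕ) : ℤ) = α 1 + b) {x : Fin (m + 2) → ℂ} (hx : x ∈ U) :
    ∑ i, c i * psiFamily a (deg a) (ρ i) (-n) (-b) x + c' * bigPsi0 a ![-n, -b] x = 0 := by
  have hfam := pdMulti_family hU (a := a) (F := 0) (n := α 0) (b := α 1)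
    (G := fun n b x => ∑ i, c i * psiFamily a (deg a) (ρ i) n b x + c' * bigPsi0 a ![n, b] x)
    (by
      intro n b hb j y hy
      have hd1 : ∀ i, DifferentiableAt ℂ (psiFamily a (deg a) (ρ i) n b) y := fun i =>
        ((hρ i).psiFamily_analytic _ _ _ y hy).differentiableAt
      have hd2 : DifferentiableAt ℂ (bigPsi0 a ![n, b]) y :=
        (bigPsi0_analyticAt ha _ _ (hU0 y hy)).differentiableAt
      rw [pd_fun_add j (DifferentiableAt.fun_sum fun i _ => (hd1 i).const_mul _)
        (hd2.const_mul _), pd_fun_sum _ _ fun i _ => (hd1 i).const_mul _, pd_const_mul _ _ hd2,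
        pd_bigPsi0 ha0 ha hb j (hU0 y hy)]
      congr 1
      exact Finset.sum_congr rfl fun i _ => by
        rw [pd_const_mul _ _ (hd1 i), (hρ i).pd_psiFamily hU ha0 hd n b hb j y hy])
    (by rwa [vec_eta]) (by intro y hy; have := h y hy; rw [vec_eta]; exact this.symm) u hx
  rw [pdMulti_zero_fun, hu0, hu1, show α 0 - (α 0 + n) = -n by ring,
    show α 1 - (α 1 + b) = -b by ring] at hfam
  exact hfam.symm

theorem relation_pow (hU : IsOpen U) (ha0 : a 0 = 0) (ha : ∀ j, j ≠ 0 → 0 < a j)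
    (hd : ∀ j, a j ≤ deg a) (hU0 : ∀ x ∈ U, x 0 ≠ 0) (hρ : ∀ i, IsSimpleRootOn a U (ρ i))
    (hα : α ∉ natImage (curveMatrix a))
    (h : ∀ x ∈ U, ∑ i, c i * psiFamily a (deg a) (ρ i) (α 0) (α 1) x + c' * bigPsi0 a α x = 0)
    {n b : ℕ} (hn : 0 < n) (hb : 0 < b) {u : Fin (m + 2) → ℕ}
    (hu0 : ((∑ j, u j : ℕ) : ℤ) = α 0 + n) (hu1 : ((∑ j, u j * a j : ℕ) : ℤ) = α 1 + b)
    (x : Fin (m + 2) → ℂ) (hx : x ∈ U) :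
    (pd 0)^[n] (fun x => ∑ i, c i * ρ i x ^ b) x = 0 := by
  rw [pd_iter_sum hU _ c (fun i => (hρ i).holomorphic.fun_pow b) 0 n hx]
  have h1 := relation_deriv hU ha0 ha hd hU0 hρ hα h hu0 hu1 hx
  rw [bigPsi0_neg_neg ha n hb, Pi.zero_apply, mul_zero, add_zero] at h1
  calc _ = ∑ i, c i * (b * psiFamily a (deg a) (ρ i) (-n) (-b) x) :=
        Finset.sum_congr rfl fun i _ => by
          rw [(hρ i).natCast_mul_psiFamily hU (deg a) hn b hx]
    _ = b * ∑ i, c i * psiFamily a (deg a) (ρ i) (-n) (-b) x := by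
        rw [Finset.mul_sum]; exact Finset.sum_congr rfl fun i _ => by ring
    _ = 0 := by rw [h1, mul_zero]

/-- Along the line in direction x_0 the power sums ∑ c_l ρ_l^{dn+k} are polynomials P_k in z = x_0.
Weighting them with the coefficients of the divided difference at ρ_i removes every l ≠ i. As z is
itself a polynomial in ρ_i, a polynomial identity in ρ_i results. -/
theorem coeff_eq_zero_of_pd_iter (hU : IsOpen U) (hmono : StrictMono a) (ha0 : a 0 = 0)
    (hpos : 0 < deg a) (hl : ∀ x ∈ U, x (Fin.last (m + 1)) ≠ 0)
    (hρ : ∀ i, IsSimpleRootOn a U (ρ i)) (hinj : ∀ x ∈ U, Function.Injective fun i => ρ i x)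
    {p : Fin (m + 2) → ℂ} (hp : p ∈ U) {n : ℕ} {N : ℕ → ℕ} (hN : N 0 = n)
    (h : ∀ k < deg a, ∀ x ∈ U, (pd 0)^[N k] (fun x => ∑ i, c i * ρ i x ^ (deg a * n + k)) x = 0)
    (i : Fin (deg a)) : c i = 0 := by
  have hd : ∀ j, a j ≤ deg a := fun j => hmono.monotone (Fin.le_last j)
  have hcont : Continuous fun z : ℂ => Function.update p 0 z :=
    continuous_const.update 0 continuous_id
  obtain ⟨ε, hε, hball⟩ := Metric.isOpen_iff.mp (hU.preimage hcont) (p 0)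
    (by simpa using hp)
  have hex : ∀ k, ∃ P : Polynomial ℂ, k < deg a → P.degree < N k ∧ ∀ z ∈ Metric.ball (p 0) ε,
      ∑ i, c i * ρ i (Function.update p 0 z) ^ (deg a * n + k) = P.eval z := by
    intro k
    by_cases hk : k < deg a
    · obtain ⟨P, hP⟩ := exists_polynomial_of_pd_iter p 0 Metric.isOpen_ball
        (convex_ball (p 0) ε).isPreconnected hball (N k)
        (F := fun x => ∑ i, c i * ρ i x ^ (deg a * n + k))
        (Finset.analyticOnNhd_fun_sum _ fun i _ =>
          analyticOnNhd_const.mul ((hρ i).holomorphic.fun_pow _)) (h k hk)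
      exact ⟨P, fun _ => hP⟩
    · exact ⟨0, fun h => absurd h hk⟩
  choose P hP using hex
  refine eq_zero_of_sum_quotCoeff_mul (p := p) (P := P) (n := n) hmono hpos (hl p hp)
    (by have := (hP 0 hpos).1; rwa [hN] at this) ?_
  have hroot : ∀ z ∈ Metric.ball (p 0) ε, ∀ i,
      z + ∑ j : Fin (m + 1), p j.succ * ρ i (Function.update p 0 z) ^ a j.succ = 0 := by
    intro z hz i
    have := (hρ i).root _ (hball hz)
    rw [Fin.sum_univ_succ, ha0] at this
    simpa using this
  have htail : ∀ z ∈ Metric.ball (p 0) ε, ∀ i,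
      (tailPoly a p).eval (ρ i (Function.update p 0 z)) = z := by
    intro z hz i
    have h1 := hroot z hz i
    have h2 : (tailPoly a p).eval (ρ i (Function.update p 0 z))
        = -∑ j : Fin (m + 1), p j.succ * ρ i (Function.update p 0 z) ^ a j.succ := by
      simp [tailPoly, Polynomial.eval_finsetSum, Fin.sum_univ_succ (n := m + 1),
        Fin.succ_ne_zero]
    rw [h2]
    linear_combination -h1
  apply Polynomial.eq_of_infinite_eval_eq
  -- The tail polynomial recovers z from ρ_i, so ρ_i is injective on the disc and takes infinitely
  -- many values.
  have hinf : ((fun z => ρ i (Function.update p 0 z)) '' Metric.ball (p 0) ε).Infinite := by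
    refine Set.Infinite.image (fun z hz w hw hzw => ?_) ?_
    · rw [← htail z hz i, ← htail w hw i]
      exact congrArg (fun t => (tailPoly a p).eval t) hzw
    · exact infinite_of_mem_nhds (p 0) (Metric.ball_mem_nhds _ hε)
  refine hinf.mono ?_
  rintro _ ⟨z, hz, rfl⟩
  set y := Function.update p 0 z
  have hy : y ∈ U := hball hz
  simp only [Set.mem_ofPred_eq, Polynomial.eval_finsetSum, Polynomial.eval_mul,
    Polynomial.eval_comp, htail z hz i, Polynomial.eval_C, Polynomial.eval_pow, Polynomial.eval_X]
  calc ∑ k ∈ Finset.range (deg a), (quotCoeff a p k).eval (ρ i y) * (P k).eval z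
      = ∑ k ∈ Finset.range (deg a), (quotCoeff a p k).eval (ρ i y)
          * ∑ l, c l * ρ l y ^ (deg a * n + k) :=
        Finset.sum_congr rfl fun k hk => by rw [(hP k (Finset.mem_range.mp hk)).2 z hz]
    _ = ∑ l, c l * ρ l y ^ (deg a * n)
          * ∑ k ∈ Finset.range (deg a), (quotCoeff a p k).eval (ρ i y) * ρ l y ^ k := by
        simp only [Finset.mul_sum]
        rw [Finset.sum_comm]
        refine Finset.sum_congr rfl fun l _ => Finset.sum_congr rfl fun k _ => ?_
        rw [pow_add]; ring
    _ = _ := by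
        rw [Finset.sum_eq_single i, sum_quotCoeff_mul_pow_self hd]
        · intro l _ hli
          rw [sum_quotCoeff_mul_pow_of_ne hd (fun he => hli (hinj y hy he)), mul_zero]
          have h1 := hroot z hz i
          have h2 := hroot z hz l
          rw [Fin.sum_univ_succ, ha0]
          simp only [mul_sub, Finset.sum_sub_distrib, pow_zero]
          linear_combination h2 - h1
        · simp

theorem relation_trivial (hU : IsOpen U) (hmono : StrictMono a) (ha0 : a 0 = 0)
    (hgcd : Finset.univ.gcd a = 1) (hα : α ∈ setE a)
    (hU0 : ∀ x ∈ U, x 0 ≠ 0) (hl : ∀ x ∈ U, x (Fin.last (m + 1)) ≠ 0)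
    (hρ : ∀ i, IsSimpleRootOn a U (ρ i)) (hinj : ∀ x ∈ U, Function.Injective fun i => ρ i x)
    {p : Fin (m + 2) → ℂ} (hp : p ∈ U)
    (h : ∀ x ∈ U, ∑ i, c i * psiFamily a (deg a) (ρ i) (α 0) (α 1) x + c' * bigPsi0 a α x = 0) :
    (∀ i, c i = 0) ∧ c' = 0 := by
  have ha : ∀ j, j ≠ 0 → 0 < a j := fun j hj => ha0 ▸ hmono (Fin.pos_iff_ne_zero.mpr hj)
  have hd : ∀ j, a j ≤ deg a := fun j => hmono.monotone (Fin.le_last j)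
  have hpos : 0 < deg a := ha _ Fin.last_pos.ne'
  have hA : α ∉ natImage (curveMatrix a) := hα.1.2
  obtain ⟨N1, hN1⟩ := exists_of_mem_setEd hα.2
  obtain ⟨N2, hN2⟩ := exists_of_gcd_eq_one ha0 hgcd α
  have hc : ∀ i, c i = 0 := by
    set n := N1 + N2 + 1 with hn
    -- Every exponent d n + k is then positive and beyond the threshold from the gcd condition.
    have hbig : N2 + 1 ≤ deg a * n := by nlinarith
    -- For k = 0 the order must be exactly n, which is where E_d enters; for k > 0 any order will
    -- do.
    have hex : ∀ k, ∃ M, 0 < M ∧ (k = 0 → M = n) ∧ ∃ u : Fin (m + 2) → ℕ,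
        ((∑ j, u j : ℕ) : ℤ) = α 0 + M ∧
        ((∑ j, u j * a j : ℕ) : ℤ) = α 1 + (deg a * n + k : ℕ) := by
      intro k
      rcases Nat.eq_zero_or_pos k with rfl | hk
      · exact ⟨n, by omega, fun _ => rfl, hN1 n (by omega)⟩
      · obtain ⟨M, hM, hu⟩ := hN2 (deg a * n + k) (by omega)
        exact ⟨M, hM, fun h => absurd h hk.ne', hu⟩
    choose M hM0 hM u hu0 hu1 using hex
    exact coeff_eq_zero_of_pd_iter hU hmono ha0 hpos hl hρ hinj hp (hM 0 rfl) fun k _ =>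
      relation_pow hU ha0 ha hd hU0 hρ hA h (hM0 k) (by omega) (hu0 k) (hu1 k)
  refine ⟨hc, ?_⟩
  -- With all c_i = 0, descend to index (-(N + 1), 0), where Ψ_0 does not vanish.
  obtain ⟨N, hN⟩ := exists_of_mem_setE0 ha0 hα.1
  obtain ⟨u, hu0, hu1⟩ := hN (N + 1) (by omega)
  have := relation_deriv hU ha0 ha hd hU0 hρ hA h (b := 0) hu0 (by rw [hu1, add_zero]) hp
  simp only [hc, zero_mul, Finset.sum_const_zero, zero_add, neg_zero] at this
  exact (mul_eq_zero.mp this).resolve_right (bigPsi0_neg_zero ha (by omega) (hU0 p hp))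

end independence

end AHyp

/-! ### Roots of f off the singular locus -/

namespace AHyp
open Polynomial

variable {m : ℕ} {a : Fin (m + 2) → ℕ}

theorem eval_genPoly (x : Fin (m + 2) → ℂ) (t : ℂ) :
    (genPoly a x).eval t = ∑ j, x j * t ^ a j := by
  simp [genPoly, Polynomial.eval_finsetSum]

theorem deg_pos (hmono : StrictMono a) : 0 < deg a :=
  (Nat.zero_le (a 0)).trans_lt (hmono (Fin.last_pos))

theorem natDegree_genPoly (hmono : StrictMono a) {x : Fin (m + 2) → ℂ}
    (hx : x (Fin.last (m + 1)) ≠ 0) : (genPoly a x).natDegree = deg a :=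
  natDegree_sum_C_mul_X_pow (Fin.last (m + 1)) hx fun _ hj =>
    Or.inr (hmono (Fin.lt_last_iff_ne_last.mpr hj))

/-- The resultant of f and f' is, up to sign, the leading coefficient times the discriminant;
neither vanishes off Σ. -/
theorem genPoly_separable (hmono : StrictMono a) {x : Fin (m + 2) → ℂ}
    (hx : x ∉ singLocus a) : (genPoly a x).Separable := by
  simp only [singLocus, Set.mem_ofPred_eq, not_or] at hx
  have hn := natDegree_genPoly hmono hx.2.1
  have hpos := deg_pos hmono
  have h0 : genPoly a x ≠ 0 := by
    intro h
    rw [h, natDegree_zero] at hn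
    omega
  have hr := Polynomial.resultant_deriv (f := genPoly a x)
    (natDegree_pos_iff_degree_pos.mp (by omega))
  rw [← Polynomial.natDegree_derivative] at hr
  by_contra hs
  have h1 := Polynomial.resultant_eq_zero_iff.mpr ⟨Or.inl h0, hs⟩
  rw [h1] at hr
  have h2 : (genPoly a x).leadingCoeff ≠ 0 := leadingCoeff_ne_zero.mpr h0
  have h3 := hx.2.2
  simp_all

theorem isRoot_genPoly_ne_zero (hmono : StrictMono a) (ha0 : a 0 = 0) {x : Fin (m + 2) → ℂ}
    (hx : x 0 ≠ 0) {t : ℂ} (ht : (genPoly a x).IsRoot t) : t ≠ 0 := by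
  rintro rfl
  rw [Polynomial.IsRoot, eval_genPoly, Finset.sum_eq_single 0] at ht
  · simp [ha0] at ht
    exact hx ht
  · intro j _ hj
    have : 0 < a j := (Nat.zero_le (a 0)).trans_lt (hmono (Fin.pos_iff_ne_zero.mpr hj))
    simp [this.ne']
  · simp

theorem mul_eval_derivative_genPoly (x : Fin (m + 2) → ℂ) (t : ℂ) :
    t * (genPoly a x).derivative.eval t = ∑ j, (a j : ℂ) * x j * t ^ a j := by
  simp only [genPoly, derivative_sum, derivative_C_mul, derivative_X_pow,
    Polynomial.eval_finsetSum, Finset.mul_sum]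
  refine Finset.sum_congr rfl fun j _ => ?_
  rcases Nat.eq_zero_or_pos (a j) with h | h
  · simp [h]
  · obtain ⟨k, hk⟩ := Nat.exists_eq_succ_of_ne_zero h.ne'
    simp [hk, pow_succ]
    ring

theorem genPoly_simple (hmono : StrictMono a) (ha0 : a 0 = 0) {x : Fin (m + 2) → ℂ}
    (hx : x ∉ singLocus a) {t : ℂ} (ht : (genPoly a x).IsRoot t) :
    ∑ j, (a j : ℂ) * x j * t ^ a j ≠ 0 := by
  rw [← mul_eval_derivative_genPoly]
  have h0 : x 0 ≠ 0 := fun h => hx (Or.inl h)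
  refine mul_ne_zero (isRoot_genPoly_ne_zero hmono ha0 h0 ht) ?_
  have := (genPoly_separable hmono hx).eval₂_derivative_ne_zero (RingHom.id ℂ)
    (x := t) (by simpa using ht)
  simpa using this

theorem IsRootSystemOn.isSimpleRootOn (hmono : StrictMono a) (ha0 : a 0 = 0)
    {U : Set (Fin (m + 2) → ℂ)} (hU : U ⊆ (singLocus a)ᶜ)
    {ρ : Fin (deg a) → (Fin (m + 2) → ℂ) → ℂ} (h : IsRootSystemOn a U ρ) (i : Fin (deg a)) :
    IsSimpleRootOn a U (ρ i) where
  holomorphic := h.holomorphic i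
  root x hx := by rw [← eval_genPoly]; exact h.isRoot i x hx
  ne_zero x hx := isRoot_genPoly_ne_zero hmono ha0 (fun h0 => hU hx (Or.inl h0)) (h.isRoot i x hx)
  simple x hx := genPoly_simple hmono ha0 (hU hx) (h.isRoot i x hx)

theorem exists_injective_roots (hmono : StrictMono a) {x : Fin (m + 2) → ℂ}
    (hx : x ∉ singLocus a) :
    ∃ r : Fin (deg a) → ℂ, Function.Injective r ∧ ∀ i, (genPoly a x).IsRoot (r i) := by
  have hl : x (Fin.last (m + 1)) ≠ 0 := fun h => hx (Or.inr (Or.inl h))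
  have hn := natDegree_genPoly hmono hl
  have hnd := nodup_roots (genPoly_separable hmono hx)
  have hc : (genPoly a x).roots.toFinset.card = deg a := by
    rw [Multiset.toFinset_card_of_nodup hnd, ← hn]
    exact (IsAlgClosed.splits _).natDegree_eq_card_roots.symm
  let e := Finset.equivFinOfCardEq hc
  refine ⟨fun i => (e.symm i : ℂ), Subtype.val_injective.comp e.symm.injective, fun i => ?_⟩
  have := (e.symm i).2
  rw [Multiset.mem_toFinset] at this
  exact isRoot_of_mem_roots this

end AHyp

/-! ### The root covering and holomorphic choices of roots -/

namespace AHyp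
open Polynomial Topology

variable {m : ℕ} {a : Fin (m + 2) → ℕ}

/-- The map `(t, x_1, …) ↦ (x_0, x_1, …)`, where `x_0` is such that `t` is a root of `f(x; ·)`. -/
noncomputable def rootMap (a : Fin (m + 2) → ℕ) (y : Fin (m + 2) → ℂ) : Fin (m + 2) → ℂ :=
  Fin.cons (-∑ j : Fin (m + 1), y j.succ * y 0 ^ a j.succ) fun j => y j.succ

theorem rootMap_zero (y : Fin (m + 2) → ℂ) :
    rootMap a y 0 = -∑ j : Fin (m + 1), y j.succ * y 0 ^ a j.succ := rfl

theorem rootMap_succ (y : Fin (m + 2) → ℂ) (j : Fin (m + 1)) :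
    rootMap a y j.succ = y j.succ := rfl

theorem isRoot_of_rootMap_eq (ha0 : a 0 = 0) {x y : Fin (m + 2) → ℂ} (h : rootMap a y = x) :
    (genPoly a x).IsRoot (y 0) := by
  rw [Polynomial.IsRoot, eval_genPoly, Fin.sum_univ_succ, ← h, rootMap_zero]
  simp [rootMap_succ, ha0]

theorem rootMap_cons (ha0 : a 0 = 0) {x : Fin (m + 2) → ℂ} {t : ℂ}
    (h : (genPoly a x).IsRoot t) : rootMap a (Fin.cons t fun j => x j.succ) = x := by
  rw [Polynomial.IsRoot, eval_genPoly, Fin.sum_univ_succ] at h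
  funext j
  refine Fin.cases ?_ (fun j => ?_) j
  · rw [rootMap_zero]
    simp only [Fin.cons_zero, Fin.cons_succ]
    rw [ha0, pow_zero, mul_one] at h
    linear_combination -h
  · rw [rootMap_succ, Fin.cons_succ]

theorem eq_of_rootMap_eq {y z : Fin (m + 2) → ℂ} (h : rootMap a y = rootMap a z)
    (h0 : y 0 = z 0) : y = z := by
  funext j
  refine Fin.cases h0 (fun j => ?_) j
  rw [← rootMap_succ (a := a) y, ← rootMap_succ (a := a) z, h]

theorem analyticAt_rootMap (y : Fin (m + 2) → ℂ) : AnalyticAt ℂ (rootMap a) y := by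
  have hc : ∀ j : Fin (m + 2), AnalyticAt ℂ (fun y : Fin (m + 2) → ℂ => y j) y := fun j =>
    (ContinuousLinearMap.proj (R := ℂ) (φ := fun _ : Fin (m + 2) => ℂ) j).analyticAt y
  rw [analyticAt_pi_iff]
  intro j
  refine Fin.cases ?_ (fun j => ?_) j
  · simp only [rootMap_zero]
    exact (Finset.analyticAt_fun_sum _ fun j _ => (hc _).fun_mul ((hc 0).fun_pow _)).fun_neg
  · exact hc _

theorem continuous_rootMap : Continuous (rootMap a) :=
  continuous_iff_continuousAt.mpr fun y => (analyticAt_rootMap y).continuousAt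

theorem fderiv_rootMap_apply (y v : Fin (m + 2) → ℂ) (j : Fin (m + 2)) :
    fderiv ℂ (rootMap a) y v j = fderiv ℂ (fun z => rootMap a z j) y v := by
  have h := (analyticAt_rootMap (a := a) y).differentiableAt.hasFDerivAt
  rw [hasFDerivAt_pi'] at h
  rw [(h j).fderiv]
  rfl

theorem pd_rootMap_zero (y : Fin (m + 2) → ℂ) :
    y 0 * pd 0 (fun z => rootMap a z 0) y
      = -∑ j : Fin (m + 1), (a j.succ : ℂ) * y j.succ * y 0 ^ a j.succ := by
  have hc : ∀ j : Fin (m + 2), DifferentiableAt ℂ (fun y : Fin (m + 2) → ℂ => y j) y := fun j =>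
    differentiableAt_apply j y
  have e : (fun z : Fin (m + 2) → ℂ => rootMap a z 0)
      = fun z => (-1) * ∑ j : Fin (m + 1), z j.succ * z 0 ^ a j.succ := by
    funext z; rw [rootMap_zero]; ring
  rw [e, pd_const_mul _ _ (DifferentiableAt.fun_sum fun j _ => (hc _).fun_mul ((hc 0).fun_pow _)),
    pd_fun_sum _ _ (fun j _ => (hc _).fun_mul ((hc 0).fun_pow _)), ← mul_assoc, mul_comm (y 0),
    mul_assoc, Finset.mul_sum, neg_one_mul]
  congr 1
  refine Finset.sum_congr rfl fun j _ => ?_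
  rw [pd_fun_mul _ (hc _) ((hc 0).fun_pow _), pd_pow _ (hc 0), pd_coord, pd_coord,
    if_neg (Fin.succ_ne_zero j), if_pos rfl]
  rcases Nat.eq_zero_or_pos (a j.succ) with h | h
  · simp [h]
  · obtain ⟨k, hk⟩ := Nat.exists_eq_succ_of_ne_zero h.ne'
    rw [hk, Nat.succ_sub_one, pow_succ]
    ring

/-- The Jacobian is triangular with a single diagonal entry other than 1, namely the negative of the
t-derivative of f. The hypothesis says that t times this derivative is nonzero. -/
theorem injective_fderiv_rootMap {y : Fin (m + 2) → ℂ}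
    (h : ∑ j : Fin (m + 1), (a j.succ : ℂ) * y j.succ * y 0 ^ a j.succ ≠ 0) :
    Function.Injective (fderiv ℂ (rootMap a) y) := by
  rw [injective_iff_map_eq_zero]
  intro v hv
  have hs : ∀ j : Fin (m + 1), v j.succ = 0 := fun j => by
    have h1 := fderiv_rootMap_apply (a := a) y v j.succ
    have h2 : fderiv ℂ (fun z : Fin (m + 2) → ℂ => rootMap a z j.succ) y
        = ContinuousLinearMap.proj j.succ :=
      (ContinuousLinearMap.proj (R := ℂ) (φ := fun _ : Fin (m + 2) => ℂ) j.succ).fderiv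
    rw [h2, hv] at h1
    exact h1.symm
  have e : v = v 0 • Pi.single 0 1 := by
    funext j
    refine Fin.cases ?_ (fun j => ?_) j
    · simp
    · simp [hs]
  have h1 := fderiv_rootMap_apply (a := a) y v 0
  rw [hv, e, map_smul] at h1
  have h2 := pd_rootMap_zero (a := a) y
  have h3 : v 0 = 0 := by
    by_contra h0
    have h4 : pd 0 (fun z => rootMap a z 0) y = 0 := by
      have : v 0 * pd 0 (fun z => rootMap a z 0) y = 0 := h1.symm
      exact (mul_eq_zero.mp this).resolve_left h0
    rw [h4, mul_zero, eq_comm, neg_eq_zero] at h2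
    exact h h2
  rw [e, h3, zero_smul]

theorem exists_openPartialHomeomorph_rootMap {y : Fin (m + 2) → ℂ}
    (h : ∑ j : Fin (m + 1), (a j.succ : ℂ) * y j.succ * y 0 ^ a j.succ ≠ 0) :
    ∃ e : OpenPartialHomeomorph (Fin (m + 2) → ℂ) (Fin (m + 2) → ℂ), y ∈ e.source ∧
      rootMap a = e ∧ AnalyticAt ℂ e.symm (rootMap a y) := by
  let f' : (Fin (m + 2) → ℂ) ≃L[ℂ] (Fin (m + 2) → ℂ) :=
    (LinearEquiv.ofInjectiveEndo (fderiv ℂ (rootMap a) y).toLinearMap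
      (injective_fderiv_rootMap h)).toContinuousLinearEquiv
  have hf' : fderiv ℂ (rootMap a) y = f' := by
    ext v : 1
    rfl
  have hc : ContDiffAt ℂ 1 (rootMap a) y := (analyticAt_rootMap y).contDiffAt
  have hd : HasFDerivAt (rootMap a) (f' : (Fin (m + 2) → ℂ) →L[ℂ] (Fin (m + 2) → ℂ)) y :=
    hf' ▸ (analyticAt_rootMap y).differentiableAt.hasFDerivAt
  let e := hc.toOpenPartialHomeomorph (rootMap a) hd one_ne_zero
  have he : (e : (Fin (m + 2) → ℂ) → (Fin (m + 2) → ℂ)) = rootMap a :=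
    hc.toOpenPartialHomeomorph_coe hd one_ne_zero
  have hs : y ∈ e.source := hc.mem_toOpenPartialHomeomorph_source hd one_ne_zero
  have hy : e.symm (rootMap a y) = y := by rw [← he]; exact e.left_inv hs
  refine ⟨e, hs, he.symm, ?_⟩
  refine e.analyticAt_symm (i := f') ?_ ?_ ?_
  · rw [← he]; exact e.map_source hs
  · rw [hy, he]; exact analyticAt_rootMap y
  · rw [hy, he]; exact hf'

/-- For |t| > 1 the leading term is balanced by m + 1 terms of size at most R |t|^{d-1}. The
uniformity on compact sets makes `rootMap` proper where x_{m+1} ≠ 0. -/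
theorem norm_le_of_isRoot (hmono : StrictMono a) {x : Fin (m + 2) → ℂ} {R δ : ℝ} (hδ : 0 < δ)
    (hx : ‖x‖ ≤ R) (hl : δ ≤ ‖x (Fin.last (m + 1))‖) {t : ℂ} (ht : (genPoly a x).IsRoot t) :
    ‖t‖ ≤ max 1 ((m + 1 : ℕ) * R / δ) := by
  rcases le_or_gt ‖t‖ 1 with h1 | h1
  · exact h1.trans (le_max_left _ _)
  refine le_trans ?_ (le_max_right _ _)
  have hpos := deg_pos hmono
  rw [Polynomial.IsRoot, eval_genPoly, Fin.sum_univ_castSucc] at ht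
  have h2 : ‖x (Fin.last (m + 1)) * t ^ deg a‖
      ≤ (m + 1 : ℕ) * (R * ‖t‖ ^ (deg a - 1)) := by
    rw [eq_neg_of_add_eq_zero_right ht, norm_neg]
    refine (norm_sum_le_of_le _ (f := fun i : Fin (m + 1) => x i.castSucc * t ^ a i.castSucc)
      (n := fun _ => R * ‖t‖ ^ (deg a - 1)) fun i _ => ?_).trans ?_
    · rw [norm_mul, norm_pow]
      have h3 : a i.castSucc < deg a := hmono (Fin.castSucc_lt_last i)
      exact mul_le_mul ((norm_le_pi_norm x _).trans hx)
        (pow_le_pow_right₀ h1.le (by omega)) (by positivity) ((norm_nonneg x).trans hx)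
    · simp
  rw [norm_mul, norm_pow] at h2
  obtain ⟨k, hk⟩ := Nat.exists_eq_succ_of_ne_zero hpos.ne'
  rw [hk, Nat.succ_sub_one, pow_succ] at h2
  rw [le_div_iff₀ hδ]
  have h4 : 0 < ‖t‖ ^ k := pow_pos (one_pos.trans h1) k
  have h5 : δ * ‖t‖ ≤ ‖x (Fin.last (m + 1))‖ * ‖t‖ := by gcongr
  refine le_of_mul_le_mul_right ?_ h4
  calc ‖t‖ * δ * ‖t‖ ^ k = δ * ‖t‖ * ‖t‖ ^ k := by ring
    _ ≤ ‖x (Fin.last (m + 1))‖ * ‖t‖ * ‖t‖ ^ k := by gcongr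
    _ = ‖x (Fin.last (m + 1))‖ * (‖t‖ ^ k * ‖t‖) := by ring
    _ ≤ _ := h2
    _ = _ := by ring

theorem isCompact_rootMap_preimage (hmono : StrictMono a) (ha0 : a 0 = 0)
    {K : Set (Fin (m + 2) → ℂ)} (hK : IsCompact K) (h : ∀ x ∈ K, x (Fin.last (m + 1)) ≠ 0) :
    IsCompact (rootMap a ⁻¹' K) := by
  rcases K.eq_empty_or_nonempty with rfl | hne
  · simp
  obtain ⟨p, hp, hmin⟩ := hK.exists_isMinOn hne
    (f := fun x => ‖x (Fin.last (m + 1))‖) (by fun_prop)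
  obtain ⟨R, hR⟩ := hK.isBounded.exists_norm_le
  refine Metric.isCompact_of_isClosed_isBounded (hK.isClosed.preimage continuous_rootMap) ?_
  have hR0 : 0 ≤ R := (norm_nonneg p).trans (hR p hp)
  refine isBounded_iff_forall_norm_le.mpr
    ⟨max R (max 1 ((m + 1 : ℕ) * R / ‖p (Fin.last (m + 1))‖)), fun y hy => ?_⟩
  rw [pi_norm_le_iff_of_nonneg (hR0.trans (le_max_left _ _))]
  refine Fin.cases ?_ fun j => ?_
  · exact (norm_le_of_isRoot hmono (norm_pos_iff.mpr (h p hp)) (hR _ hy) (hmin hy)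
      (isRoot_of_rootMap_eq ha0 rfl)).trans (le_max_right _ _)
  · rw [← rootMap_succ (a := a) y]
    exact ((norm_le_pi_norm _ _).trans (hR _ hy)).trans (le_max_left _ _)

theorem finite_rootMap_fiber (hmono : StrictMono a) (ha0 : a 0 = 0) {x : Fin (m + 2) → ℂ}
    (hx : x (Fin.last (m + 1)) ≠ 0) : (rootMap a ⁻¹' {x}).Finite := by
  have h0 : genPoly a x ≠ 0 := by
    intro h
    have := natDegree_genPoly hmono hx
    have := deg_pos hmono
    simp_all
  refine Set.Finite.of_finite_image (f := fun y => y 0)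
    ((genPoly a x).roots.toFinset.finite_toSet.subset ?_) ?_
  · rintro _ ⟨y, hy, rfl⟩
    simpa [h0] using isRoot_of_rootMap_eq ha0 hy
  · intro y hy z hz h
    exact eq_of_rootMap_eq (a := a) (Eq.trans hy (Eq.symm hz)) h

theorem sum_ne_zero_of_rootMap_mem (hmono : StrictMono a) (ha0 : a 0 = 0)
    {y : Fin (m + 2) → ℂ} (hy : rootMap a y ∉ singLocus a) :
    ∑ j : Fin (m + 1), (a j.succ : ℂ) * y j.succ * y 0 ^ a j.succ ≠ 0 := by
  have := genPoly_simple hmono ha0 hy (isRoot_of_rootMap_eq ha0 rfl)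
  rw [Fin.sum_univ_succ] at this
  simpa [ha0, rootMap_succ] using this

/-- Over U the map is proper by the root bound, has finite fibres, and is a local homeomorphism
because the roots are simple. -/
theorem isCoveringMapOn_rootMap (hmono : StrictMono a) (ha0 : a 0 = 0)
    {U : Set (Fin (m + 2) → ℂ)} (hU : IsOpen U) (hUs : U ⊆ (singLocus a)ᶜ) :
    IsCoveringMapOn (rootMap a) U := by
  have hl : ∀ x ∈ U, x (Fin.last (m + 1)) ≠ 0 := fun x hx h => hUs hx (Or.inr (Or.inl h))
  have hV : IsOpen (rootMap a ⁻¹' U) := hU.preimage continuous_rootMap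
  refine IsCoveringMapOn.of_isCoveringMap_restrictPreimage _ hU hV ?_
  rw [isCoveringMap_iff_isCoveringMapOn_univ]
  have hcont : Continuous (U.restrictPreimage (rootMap a)) :=
    continuous_rootMap.restrictPreimage
  have : LocallyCompactSpace U := hU.locallyCompactSpace
  have hproper : IsProperMap (U.restrictPreimage (rootMap a)) := by
    rw [isProperMap_iff_isCompact_preimage]
    refine ⟨hcont, fun K hK => ?_⟩
    rw [Subtype.isCompact_iff] at hK ⊢
    have := isCompact_rootMap_preimage hmono ha0 hK (by rintro _ ⟨x, -, rfl⟩; exact hl x x.2)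
    convert this using 1
    ext y
    constructor
    · rintro ⟨y, hy, rfl⟩
      exact ⟨_, hy, rfl⟩
    · rintro ⟨x, hx, hxy⟩
      refine ⟨⟨y, ?_⟩, ?_, rfl⟩
      · rw [Set.mem_preimage, ← hxy]; exact x.2
      · rw [Set.mem_preimage]
        convert hx
        exact Subtype.ext hxy.symm
  refine hproper.isClosedMap.isCoveringMapOn_of_isLocalHomeomorphOn (fun x _ => ?_) ?_
  · refine Set.Finite.of_finite_image (f := Subtype.val)
      ((finite_rootMap_fiber hmono ha0 (hl x x.2)).subset ?_) Subtype.val_injective.injOn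
    rintro _ ⟨y, hy, rfl⟩
    exact congrArg Subtype.val hy
  · have hval : IsLocalHomeomorph (Subtype.val : U → _) :=
      hU.isOpenEmbedding_subtypeVal.isLocalHomeomorph
    have hval' : IsLocalHomeomorph (Subtype.val : rootMap a ⁻¹' U → _) :=
      hV.isOpenEmbedding_subtypeVal.isLocalHomeomorph
    have hloc : IsLocalHomeomorphOn (rootMap a) (rootMap a ⁻¹' U) := fun y hy => by
      obtain ⟨e, h1, h2, -⟩ := exists_openPartialHomeomorph_rootMap
        (sum_ne_zero_of_rootMap_mem hmono ha0 (hUs hy))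
      exact ⟨e, h1, h2⟩
    refine IsLocalHomeomorphOn.of_comp_left (g := Subtype.val) ?_
      (hval.isLocalHomeomorphOn.mono (Set.subset_univ _)) fun x _ => hcont.continuousAt
    exact hloc.comp (hval'.isLocalHomeomorphOn.mono (Set.subset_univ _)) fun y _ => y.2

/-- Lift the inclusion of U through the covering, once for each of the d roots at a base point. -/
theorem exists_isRootSystemOn (hmono : StrictMono a) (ha0 : a 0 = 0)
    {U : Set (Fin (m + 2) → ℂ)} (hU : IsOpen U) (hUsc : IsSimplyConnected U)
    (hUs : U ⊆ (singLocus a)ᶜ) :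
    ∃ ρ : Fin (deg a) → (Fin (m + 2) → ℂ) → ℂ, IsRootSystemOn a U ρ := by
  have := hUsc.simplyConnectedSpace
  have := hU.locallyPathConnectedSpace
  obtain ⟨p, hp⟩ := hUsc.nonempty
  have cov := isCoveringMapOn_rootMap hmono ha0 hU hUs
  let f : C(U, Fin (m + 2) → ℂ) := ⟨Subtype.val, continuous_subtype_val⟩
  obtain ⟨r, hr, hroot⟩ := exists_injective_roots hmono (hUs hp)
  have hlift : ∀ i, ∃ F : C(U, Fin (m + 2) → ℂ), F ⟨p, hp⟩ = Fin.cons (r i) (fun j => p j.succ) ∧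
      rootMap a ∘ F = f := fun i =>
    (cov.existsUnique_continuousMap_lifts f (a₀ := ⟨p, hp⟩) (rootMap_cons ha0 (hroot i))
      fun x => x.2).exists
  choose F hFp hF using hlift
  have hF' : ∀ i (x : U), rootMap a (F i x) = x := fun i x => congrFun (hF i) x
  have hval : ∀ i (x) (hx : x ∈ U),
      extendZero (fun x : U => F i x 0) x = F i ⟨x, hx⟩ 0 := fun i x hx =>
    extendZero_apply (fun x : U => F i x 0) ⟨x, hx⟩
  refine ⟨fun i => extendZero fun x : U => F i x 0, fun i x hx => ?_, fun i x hx => ?_,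
    fun x hx i j hij => ?_⟩
  · obtain ⟨e, he, hee, han⟩ := exists_openPartialHomeomorph_rootMap (a := a) (y := F i ⟨x, hx⟩)
      (sum_ne_zero_of_rootMap_mem hmono ha0 (by rw [hF']; exact hUs hx))
    rw [hF'] at han
    -- Near x the continuous lift agrees with the analytic local inverse of `rootMap`.
    refine ((analyticAt_pi_iff.mp han) 0).congr ?_
    have h1 : ∀ᶠ z : U in 𝓝 ⟨x, hx⟩, F i z ∈ e.source :=
      (F i).continuous.continuousAt.eventually (e.open_source.mem_nhds he)
    rw [nhds_subtype_eq_comap, Filter.eventually_comap] at h1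
    filter_upwards [h1, hU.mem_nhds hx] with z hz hzU
    rw [hval i z hzU, ← e.left_inv (hz ⟨z, hzU⟩ rfl), ← hee, hF']
  · rw [hval i x hx]
    exact isRoot_of_rootMap_eq ha0 (hF' i ⟨x, hx⟩)
  · beta_reduce at hij
    rw [hval i x hx, hval j x hx] at hij
    have h1 : F i ⟨x, hx⟩ = F j ⟨x, hx⟩ :=
      eq_of_rootMap_eq (a := a) (by rw [hF', hF']) hij
    -- Lifts that agree at one point are equal, so a coincidence of roots anywhere would appear at
    -- the base point.
    have h2 : F i = F j :=
      (cov.existsUnique_continuousMap_lifts f (a₀ := ⟨x, hx⟩) (e₀ := F j ⟨x, hx⟩)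
        (hF' j ⟨x, hx⟩) fun x => x.2).unique ⟨h1, hF i⟩ ⟨rfl, hF j⟩
    apply hr
    have h3 := congrFun ((hFp i).symm.trans ((congrArg (· ⟨p, hp⟩) h2).trans (hFp j))) 0
    simpa using h3

/-! ### Algebraicity -/

section algebraic

variable {r : ℕ} {U : Set (Fin r → ℂ)} {φ ψ : U → ℂ}

theorem IsAlgebraicFun.mul (hφ : IsAlgebraicFun φ) (hψ : IsAlgebraicFun ψ) :
    IsAlgebraicFun fun x => φ x * ψ x := by
  let _ : Algebra (MvPolynomial (Fin r) ℂ) (U → ℂ) :=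
    (RingHom.pi fun x : U => MvPolynomial.eval (x : Fin r → ℂ)).toAlgebra
  rw [isAlgebraicFun_iff] at *
  exact IsAlgebraic.mul hφ hψ

theorem isAlgebraicFun_eval (P : MvPolynomial (Fin r) ℂ) :
    IsAlgebraicFun fun x : U => MvPolynomial.eval (x : Fin r → ℂ) P := by
  let _ : Algebra (MvPolynomial (Fin r) ℂ) (U → ℂ) :=
    (RingHom.pi fun x : U => MvPolynomial.eval (x : Fin r → ℂ)).toAlgebra
  rw [isAlgebraicFun_iff]
  exact isAlgebraic_algebraMap P

theorem isAlgebraicFun_const (c : ℂ) : IsAlgebraicFun fun _ : U => c := by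
  simpa using isAlgebraicFun_eval (U := U) (MvPolynomial.C c)

theorem isAlgebraicFun_coord (j : Fin r) : IsAlgebraicFun fun x : U => (x : Fin r → ℂ) j := by
  simpa using isAlgebraicFun_eval (U := U) (MvPolynomial.X j)

theorem IsAlgebraicFun.inv (hφ : IsAlgebraicFun φ) (h0 : ∀ x, φ x ≠ 0) :
    IsAlgebraicFun fun x => (φ x)⁻¹ := by
  let _ : Algebra (MvPolynomial (Fin r) ℂ) (U → ℂ) :=
    (RingHom.pi fun x : U => MvPolynomial.eval (x : Fin r → ℂ)).toAlgebra
  let _ : Invertible φ := ⟨fun x => (φ x)⁻¹, funext fun x => inv_mul_cancel₀ (h0 x),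
    funext fun x => mul_inv_cancel₀ (h0 x)⟩
  rw [isAlgebraicFun_iff] at *
  exact hφ.invOf

theorem IsAlgebraicFun.pow (hφ : IsAlgebraicFun φ) (n : ℕ) : IsAlgebraicFun fun x => φ x ^ n := by
  induction n with
  | zero => simpa using isAlgebraicFun_const 1
  | succ n ih => simpa only [pow_succ] using ih.mul hφ

theorem IsAlgebraicFun.zpow (hφ : IsAlgebraicFun φ) (h0 : ∀ x, φ x ≠ 0) (n : ℤ) :
    IsAlgebraicFun fun x => φ x ^ n := by
  rcases n with n | n
  · simpa using hφ.pow n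
  · simpa only [zpow_negSucc] using (hφ.pow (n + 1)).inv fun x => pow_ne_zero _ (h0 x)

theorem IsAlgebraicFun.sum {ι : Type*} (s : Finset ι) {f : ι → U → ℂ}
    (h : ∀ i ∈ s, IsAlgebraicFun (f i)) : IsAlgebraicFun fun x => ∑ i ∈ s, f i x := by
  classical
  induction s using Finset.induction_on with
  | empty => simpa using isAlgebraicFun_const 0
  | insert i s hi ih =>
    simp only [Finset.sum_insert hi]
    exact (h i (Finset.mem_insert_self i s)).add
      (ih fun j hj => h j (Finset.mem_insert_of_mem hj))

/-- The witness is f itself with indeterminate coefficients; injectivity of the exponents prevents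
X_l from being cancelled. -/
theorem isAlgebraicFun_of_root {a : Fin r → ℕ} (ha : Function.Injective a) (l : Fin r)
    (h : ∀ x : U, ∑ j, (x : Fin r → ℂ) j * φ x ^ a j = 0) : IsAlgebraicFun φ := by
  refine ⟨∑ j, Polynomial.C (MvPolynomial.X j) * Polynomial.X ^ a j, fun h0 => ?_, fun x => ?_⟩
  · have := congrArg (fun P => P.coeff (a l)) h0
    simp [Polynomial.finsetSum_coeff, Polynomial.coeff_X_pow, ha.eq_iff] at this
  · rw [← h x]
    simp [Polynomial.map_sum, Polynomial.eval_finsetSum]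

theorem exists_mvPolynomial_coefPow (a : Fin r → ℕ) (n : ℕ) (i : ℤ) :
    ∃ P : MvPolynomial (Fin r) ℂ, ∀ x, coefPow a n i x = MvPolynomial.eval x P := by
  induction n generalizing i with
  | zero => exact ⟨MvPolynomial.C (if i = 0 then 1 else 0), fun x => by simp [coefPow]⟩
  | succ n ih =>
    choose P hP using ih
    exact ⟨∑ j, MvPolynomial.X j * P (i - a j), fun x => by simp [coefPow, hP]⟩

theorem exists_mvPolynomial_hyperPoly (a : Fin r → ℕ) (n i : ℤ) :
    ∃ P : MvPolynomial (Fin r) ℂ, ∀ x,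
      hyperPoly (curveMatrix a) ![n, i] x = MvPolynomial.eval x P := by
  rcases lt_or_ge n 0 with hn | hn
  · exact ⟨0, fun x => by simp [hyperPoly_of_neg a hn]⟩
  · lift n to ℕ using hn
    obtain ⟨P, hP⟩ := exists_mvPolynomial_coefPow a n i
    refine ⟨MvPolynomial.C ((n.factorial : ℂ)⁻¹) * P, fun x => ?_⟩
    rw [hyperPoly_natCast, hP, MvPolynomial.eval_mul, MvPolynomial.eval_C, div_eq_inv_mul]

end algebraic

theorem isAlgebraicFun_psiFamily {r : ℕ} {a : Fin (r + 1) → ℕ} (ha : Function.Injective a)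
    {U : Set (Fin (r + 1) → ℂ)} {ρ : (Fin (r + 1) → ℂ) → ℂ} (h : IsSimpleRootOn a U ρ) (d : ℕ)
    {n : ℤ} (hn : 0 ≤ n) (b : ℤ) : IsAlgebraicFun fun x : U => psiFamily a d ρ n b x := by
  simp only [psiFamily, if_pos hn]
  have hρ : IsAlgebraicFun fun x : U => ρ x :=
    isAlgebraicFun_of_root ha 0 fun x => h.root x x.2
  refine IsAlgebraicFun.sum _ fun i _ => ?_
  obtain ⟨P, hP⟩ := exists_mvPolynomial_hyperPoly a n i
  simp only [hP, div_eq_mul_inv]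
  exact (isAlgebraicFun_eval P).mul
    ((hρ.zpow (fun x => h.ne_zero x x.2) _).mul (isAlgebraicFun_const _))

/-! ### Assembling the basis -/

section

variable {m : ℕ} {a : Fin (m + 2) → ℕ} {U : Set (Fin (m + 2) → ℂ)}

theorem isAlgebraicFun_bigPsi0 (ha : ∀ j, j ≠ 0 → 0 < a j) (hU0 : ∀ x ∈ U, x 0 ≠ 0)
    (α : Fin 2 → ℤ) : IsAlgebraicFun fun x : U => bigPsi0 a α x := by
  rw [← vec_eta α, bigPsi0_eq_sum ha (K := (α 1 - α 0).toNat) (by omega)]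
  refine IsAlgebraicFun.sum _ fun k _ => ?_
  obtain ⟨P, hP⟩ := exists_mvPolynomial_hyperPoly (fun j => a j.succ) (α 0 + (k + 1)) (α 1)
  have hQ : ∀ x : Fin (m + 2) → ℂ, hyperPoly (matC a) ![α 0 + (k + 1), α 1] (fun j => x j.succ)
      = MvPolynomial.eval x (MvPolynomial.rename Fin.succ P) := fun x => by
    rw [MvPolynomial.eval_rename]; exact hP _
  simp only [bigPsiTerm, hQ, div_eq_mul_inv]
  exact ((isAlgebraicFun_const _).mul (isAlgebraicFun_eval _)).mul
    (((isAlgebraicFun_coord 0).pow _).inv fun x => pow_ne_zero _ (hU0 x x.2))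

/-- Both the logarithm and the omitted index i = α 1 carry the coefficient Φ^A(α) = 0. -/
theorem psi_eq_psiFamily {α : Fin 2 → ℤ} (hα : α ∉ natImage (curveMatrix a)) (hα0 : 0 ≤ α 0)
    (ρ : (Fin (m + 2) → ℂ) → ℂ) :
    psi a ρ α = psiFamily a (deg a) ρ (α 0) (α 1) := by
  funext x
  have h0 : hyperPoly (curveMatrix a) α x = 0 := by rw [hyperPoly_eq_zero hα]; rfl
  rw [psi, h0, zero_mul, add_zero, psiFamily, if_pos hα0]
  refine Finset.sum_erase _ ?_
  rw [vec_eta, h0, zero_mul]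

/-- The functions `ψ_1, …, ψ_d` and `Ψ_0` as algebraic solutions. -/
noncomputable def solutionFamily (hU : IsOpen U) (ρ : Fin (deg a) → (Fin (m + 2) → ℂ) → ℂ)
    (α : Fin 2 → ℤ)
    (h1 : ∀ i, (fun x : U => psi a (ρ i) α x)
      ∈ algSolutions (curveMatrix a) (fun i => (α i : ℂ)) U hU)
    (h2 : (fun x : U => bigPsi0 a α x) ∈ algSolutions (curveMatrix a) (fun i => (α i : ℂ)) U hU) :
    Option (Fin (deg a)) → algSolutions (curveMatrix a) (fun i => (α i : ℂ)) U hU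
  | some i => ⟨_, h1 i⟩
  | none => ⟨_, h2⟩

theorem exists_linearIndependent_solutions (hmono : StrictMono a) (ha0 : a 0 = 0)
    (hgcd : Finset.univ.gcd a = 1) {α : Fin 2 → ℤ} (hα : α ∈ setE a) (hU : IsOpen U)
    (hne : U.Nonempty) (hUs : U ⊆ (singLocus a)ᶜ)
    {ρ : Fin (deg a) → (Fin (m + 2) → ℂ) → ℂ} (hρ : IsRootSystemOn a U ρ) :
    ∃ v : Option (Fin (deg a)) → algSolutions (curveMatrix a) (fun i => (α i : ℂ)) U hU,
      LinearIndependent ℂ v ∧ (∀ i, (v (some i) : U → ℂ) = fun x : U => psi a (ρ i) α x) ∧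
        (v none : U → ℂ) = fun x : U => bigPsi0 a α x := by
  have ha : ∀ j, j ≠ 0 → 0 < a j := fun j hj => ha0 ▸ hmono (Fin.pos_iff_ne_zero.mpr hj)
  have hd : ∀ j, a j ≤ deg a := fun j => hmono.monotone (Fin.le_last j)
  have hA : α ∉ natImage (curveMatrix a) := hα.1.2
  have hα0 : 0 ≤ α 0 := fst_nonneg_of_mem_setE ha0 hd (deg_pos hmono) hα
  have hU0 : ∀ x ∈ U, x 0 ≠ 0 := fun x hx h => hUs hx (Or.inl h)
  have hUl : ∀ x ∈ U, x (Fin.last (m + 1)) ≠ 0 := fun x hx h => hUs hx (Or.inr (Or.inl h))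
  have hs := hρ.isSimpleRootOn hmono ha0 hUs
  have h1 : ∀ i, (fun x : U => psi a (ρ i) α x)
      ∈ algSolutions (curveMatrix a) (fun i => (α i : ℂ)) U hU := fun i => by
    rw [psi_eq_psiFamily hA hα0]
    exact ⟨⟨_, (hs i).isHypergeometricOn_psiFamily hU ha0 hd hA hα0, rfl⟩,
      isAlgebraicFun_psiFamily hmono.injective (hs i) _ hα0 _⟩
  have h2 : (fun x : U => bigPsi0 a α x)
      ∈ algSolutions (curveMatrix a) (fun i => (α i : ℂ)) U hU :=
    ⟨⟨_, isHypergeometricOn_bigPsi0 ha0 ha hU hU0 hA, rfl⟩, isAlgebraicFun_bigPsi0 ha hU0 α⟩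
  refine ⟨solutionFamily hU ρ α h1 h2, ?_, fun i => rfl, rfl⟩
  rw [Fintype.linearIndependent_iff]
  intro g hg
  obtain ⟨p, hp⟩ := hne
  have hrel := relation_trivial (c := fun i => g (some i)) (c' := g none) hU hmono ha0 hgcd hα
    hU0 hUl hs hρ.distinct hp fun x hx => by
      have h3 := congrFun (congrArg Subtype.val hg) ⟨x, hx⟩
      rw [Fintype.sum_option] at h3
      simp only [Submodule.coe_add, Submodule.coe_sum, Submodule.coe_smul, Pi.add_apply,
        Finset.sum_apply, Pi.smul_apply, smul_eq_mul, solutionFamily, Submodule.coe_zero,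
        Pi.zero_apply, psi_eq_psiFamily hA hα0] at h3
      rw [add_comm]
      exact h3
  intro i
  rcases i with _ | i
  · exact hrel.2
  · exact hrel.1 i

end

end AHyp

theorem theorem2p6 {m : ℕ} (a : Fin (m + 2) → ℕ) (ha : StrictMono a) (ha0 : a 0 = 0)
    (hgcd : Finset.univ.gcd a = 1)
    (α : Fin 2 → ℤ) (hα : α ∈ AHyp.setE a)
    (U : Set (Fin (m + 2) → ℂ)) (hU : IsOpen U) (hUsc : IsSimplyConnected U)
    (hUsing : U ⊆ (AHyp.singLocus a)ᶜ) :
    ((AHyp.deg a + 1 : ℕ) : Cardinal) ≤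
        Module.rank ℂ (AHyp.algSolutions (AHyp.curveMatrix a) (fun i => (α i : ℂ)) U hU) ∧
      (∃ ρ : Fin (AHyp.deg a) → (Fin (m + 2) → ℂ) → ℂ, AHyp.IsRootSystemOn a U ρ) ∧
      ∀ ρ : Fin (AHyp.deg a) → (Fin (m + 2) → ℂ) → ℂ, AHyp.IsRootSystemOn a U ρ →
        ∃ b : Module.Basis (Option (Fin (AHyp.deg a))) ℂ
            (AHyp.algSolutions (AHyp.curveMatrix a) (fun i => (α i : ℂ)) U hU),
          (∀ i, (b (some i) : U → ℂ) = fun x : U => AHyp.psi a (ρ i) α x) ∧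
          (b none : U → ℂ) = fun x : U => AHyp.bigPsi0 a α x := by
  obtain ⟨p, hp⟩ := hUsc.nonempty
  have hlow : ∀ ρ : Fin (AHyp.deg a) → (Fin (m + 2) → ℂ) → ℂ, AHyp.IsRootSystemOn a U ρ →
      ((AHyp.deg a + 1 : ℕ) : Cardinal) ≤
        Module.rank ℂ (AHyp.algSolutions (AHyp.curveMatrix a) (fun i => (α i : ℂ)) U hU) := by
    intro ρ hρ
    obtain ⟨v, hv, -⟩ := AHyp.exists_linearIndependent_solutions ha ha0 hgcd hα hU ⟨p, hp⟩
      hUsing hρ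
    simpa using hv.cardinal_le_rank
  have hex := AHyp.exists_isRootSystemOn ha ha0 hU hUsc hUsing
  have hup := AHyp.rank_algSolutions_le ha0
    (fun j hj => ha0 ▸ ha (Fin.pos_iff_ne_zero.mpr hj))
    (fun j => ha.monotone (Fin.le_last j)) hα.1.2 hU hUsc.isPathConnected.isConnected.isPreconnected
    hp (fun h => hUsing hp (Or.inl h))
  -- The bounds meet at d + 1, so for any choice of roots the independent family is already a basis.
  have hrank := le_antisymm hup (hlow _ hex.choose_spec)
  refine ⟨hrank.ge, hex, fun ρ hρ => ?_⟩
  obtain ⟨v, hv, hv1, hv2⟩ := AHyp.exists_linearIndependent_solutions ha ha0 hgcd hα hU ⟨p, hp⟩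
    hUsing hρ
  have hfin := Module.finrank_eq_of_rank_eq hrank
  refine ⟨basisOfLinearIndependentOfCardEqFinrank hv (by simp [hfin]), ?_, ?_⟩
  · simpa using hv1
  · simpa using hv2
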